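/- Let $n\ge 1$, let $w_0=1$ and let $w_1,\dots,w_n$ be positive integers; put $\mu=w_0+\cdots+w_n$ and $w^w=w_1^{w_1}\cdots w_n^{w_n}$. Let $c_0\le c_1\le\cdots\le c_{\mu-1}$ be the elements $f$ of $\{\ell/w_i \mid 0\le \ell\le w_i-1,\ 0\le i\le n\}$ in increasing order, each repeated $\#\{j \mid w_jf\in\mathbb Z\}$ times, and let $\alpha_k=k-\mu c_k$. Let $a(0)=0\in\mathbb N^{n+1}$ and $a(k+1)=a(k)+\mathbf 1_{i(k)}$, where $i(k)$ is the least index $i$ for which $a(k)_i/w_i$ is minimal. Let $U=(\mathbb C^*)^n$, $u_0=u_1^{-w_1}\cdots u_n^{-w_n}$, $F=u_1+\cdots+u_n+xu_0$, $\theta=\tau^{-1}$, and let $$G=\Omega^n(U)[x,x^{-1},\tau,\tau^{-1}]\big/(d_u-\tau d_uF\wedge)\,\Omega^{n-1}(U)[x,x^{-1},\tau,\tau^{-1}]$$ be the Gauss–Manin system of $F$, with its connection $\nabla_{\partial_\tau}(\omega\tau^i)=i\omega\tau^{i-1}-F\omega\tau^i$, $\nabla_{\partial_x}(\omega\tau^i)=\mathcal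 L_{\partial_x}(\omega)\tau^i-\frac{\partial F}{\partial x}\omega\tau^{i+1}$. For $0\le k\le\mu-1$ let $\omega_k\in G$ be the class of $\big(\prod_{i\ge1} w_i^{a(k)_i}\big)^{-1}(xu_0)^{a(k)_0}u_1^{a(k)_1}\cdots u_n^{a(k)_n}\frac{du_1}{u_1}\wedge\cdots\wedge\frac{du_n}{u_n}$, and for $\alpha\in\mathbb Q$ let $V^\alpha G$ be the $\mathbb C[\theta,\theta^{-1}]$-span of the $x^p\omega_k$ with $p\in\mathbb Z$, $p+c_k\ge\alpha$; put $V^{>\alpha}G=\bigcup_{\beta>\alpha}V^\beta G$ and $\overline G=\bigoplus_{\alpha\in[0,1)}V^\alpha G/V^{>\alpha}G$. Then: 1. $V^\bullet G$ is the Kashiwara–Malgrange filtration of $G$ at $x=0$: it is the unique decreasing exhaustive filtration of $G$, indexed by $\frac1N\mathbb Z$ for some $N\ge 1$, by $\mathbb C[x,\theta,\theta^{-1}]$-submodules of finite type stable under $x\nabla_{\partial_x}$ and $\nabla_{\theta\partial_\theta}$, with $V^{\alpha+1}=xV^\alpha$ and $x\nabla_{\partial_x}-\alpha$ nilpotent on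 $V^\alpha/V^{>\alpha}$. 2. The classes $[\omega_k]\in V^{c_k}G/V^{>c_k}G$, $0\le k\le\mu-1$, form a basis of $\overline G$ over $\mathbb C[\theta,\theta^{-1}]$. The connection $\nabla$ in the direction $\theta$ preserves $V^\bullet G$ and induces on $\overline G$ a connection $\overline\nabla$ whose matrix in this basis is $$\Big(\frac{\overline A_0}{\theta}+A_\infty\Big)\frac{d\theta}{\theta},$$ where $A_\infty=\mathrm{Diag}(\alpha_0,\dots,\alpha_{\mu-1})$ and, rows and columns being numbered from $0$ to $\mu-1$, $(\overline A_0)_{i,j}=\mu$ if $i=j+1$ and $c_i=c_j$, and $(\overline A_0)_{i,j}=0$ otherwise. 3. There is a pairing $S$ on $G$ with values in $\mathbb C[x,x^{-1},\theta,\theta^{-1}]$, with $pS(\cdot,\cdot)=S(p\,\cdot,\cdot)=S(\cdot,p(x,-\theta)\,\cdot)$ for $p=p(x,\theta)$, such that $S(\omega_k,\omega_\ell)=\frac{\theta^n}{w_1\cdots w_n}$ if $k+\ell=n$, $S(\omega_k,\omega_\ell)=\frac{x\,\theta^n}{w^w\,w_1\cdots w_n}$ if $k\ge n+1$ and $k+\ell=\mu+n$,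 and $S(\omega_k,\omega_\ell)=0$ otherwise. One has $S(V^0G,V^0G)\subset\mathbb C[x,\theta,\theta^{-1}]$ and $S(V^\beta G,V^{1-\beta}G)\subset x\,\mathbb C[x,\theta,\theta^{-1}]$ for $0<\beta<1$. Taking the coefficient of $x^0$, respectively of $x^1$, on these pieces, and $0$ on the pieces of degrees $\beta,\gamma\in[0,1)$ with $\beta+\gamma\notin\{0,1\}$, one gets a pairing $\overline S$ on $\overline G$ with values in $\mathbb C[\theta,\theta^{-1}]$, linear in the first variable and semilinear for $\theta\mapsto-\theta$ in the second. It satisfies $\overline S([\omega_k],[\omega_\ell])=\frac{\theta^n}{w_1\cdots w_n}$ if $k+\ell=n$, $\overline S([\omega_k],[\omega_\ell])=\frac{\theta^n}{w_1^{w_1+1}\cdots w_n^{w_n+1}}$ if $k\ge n+1$ and $k+\ell=\mu+n$, and $\overline S([\omega_k],[\omega_\ell])=0$ otherwise. 4. Let $\overline H$ be the trivial bundle on $\mathbb P^1$ obtained by gluing the $\mathbb C[\theta]$-lattice $\overline G_0$ and the $\mathbb C[\tau]$-lattice of $\overline G$ generated by the $[\omega_k]$. Then $\overline{\mathcal S}_w=(\overline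 H,\overline\nabla,\overline S,n)$ is a Saito structure of weight $n$ on $\mathbb P^1$: $\overline\nabla$ is a (flat) meromorphic connection on the trivial bundle $\overline H$ with a pole of order at most $1$ (Poincaré rank) at $\theta=0$, a logarithmic pole at $\theta=\infty$ and no other pole; $\overline S$ is $\overline\nabla$-flat, takes values in $\theta^n\mathcal O_{\mathbb P^1}$, is nondegenerate (at $0$ and $\infty$ also), and satisfies $\overline S(h',h)(\theta)=(-1)^n\,\overline S(h,h')(-\theta)$. 5. Let $\overline E=\overline G_0/\theta\overline G_0$, and let $\overline R_0$, $\overline R_\infty$ and $\overline g$ be induced on $\overline E$ by $\theta^2\overline\nabla_{\partial_\theta}$, by $\overline\nabla_{\tau\partial_\tau}$ (acting on the fibre of $\overline H$ at $\infty$, which is identified with $\overline E$ through the global sections) and by the coefficient of $\theta^n$ in $\overline S$. The classes of the $[\omega_k]$ form a basis of $\overline E$ over $\mathbb C$, in which $\overline R_0$ and $\overline R_\infty$ have matrices $\overline A_0$ and $-A_\infty$; and $\overline{\mathbb F}_w=(\overline E,\overline R_0,\overline R_\infty,\overline g)$ is a Frobenius type structure on a point: $\overline E$ is finite dimensional, $\overline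 g$ is symmetric and nondegenerate, $\overline R_0^*=\overline R_0$ and $\overline R_\infty+\overline R_\infty^*=r\,\mathrm{Id}$ for some $r\in\mathbb C$, where $^*$ is the adjoint with respect to $\overline g$. -/

import Mathlib

noncomputable section

namespace LimitSaito

/-! ### Combinatorics of the weights -/

/-- `μ = w₀ + ⋯ + wₙ`. -/
def mu {n : ℕ} (w : Fin (n + 1) → ℕ) : ℕ := ∑ i, w i

/-- The set `F = {ℓ / wᵢ | 0 ≤ ℓ ≤ wᵢ - 1, 0 ≤ i ≤ n}`. -/
def fracSet {n : ℕ} (w : Fin (n + 1) → ℕ) : Finset ℚ :=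
  Finset.univ.biUnion fun i => (Finset.range (w i)).image fun l : ℕ => (l : ℚ) / (w i : ℚ)

/-- `S_f = {j | w_j f ∈ ℤ}` (a rational number is an integer iff its denominator is `1`). -/
def intSet {n : ℕ} (w : Fin (n + 1) → ℕ) (f : ℚ) : Finset (Fin (n + 1)) :=
  Finset.univ.filter fun j => ((w j : ℚ) * f).den = 1

/-- The elements `f₁ < ⋯ < f_k` of `F` in increasing order, each `f` repeated `#S_f` times. -/
def cList {n : ℕ} (w : Fin (n + 1) → ℕ) : List ℚ :=
  (fracSet w).sort.flatMap fun f => List.replicate (intSet w f).card f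

/-- The sequence `c₀ ≤ c₁ ≤ ⋯ ≤ c_{μ-1}` (and `0` beyond `μ - 1`, never used). -/
def c {n : ℕ} (w : Fin (n + 1) → ℕ) (k : ℕ) : ℚ := (cList w).getD k 0

/-- `α_k = k - μ c_k`. -/
def alpha {n : ℕ} (w : Fin (n + 1) → ℕ) (k : ℕ) : ℚ := (k : ℚ) - (mu w : ℚ) * c w k

/-- The indices `i` at which `a_i / w_i` is minimal. -/
def minSet {n : ℕ} (w a : Fin (n + 1) → ℕ) : Finset (Fin (n + 1)) :=
  Finset.univ.filter fun i => ∀ j, (a i : ℚ) / (w i : ℚ) ≤ (a j : ℚ) / (w j : ℚ)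

theorem minSet_nonempty {n : ℕ} (w a : Fin (n + 1) → ℕ) : (minSet w a).Nonempty := by
  obtain ⟨i, -, hi⟩ := Finset.exists_min_image (Finset.univ : Finset (Fin (n + 1)))
    (fun i => (a i : ℚ) / (w i : ℚ)) Finset.univ_nonempty
  exact ⟨i, by simpa [minSet] using hi⟩

/-- The least index `i` at which `a_i / w_i` is minimal. -/
def minIndex {n : ℕ} (w a : Fin (n + 1) → ℕ) : Fin (n + 1) :=
  (minSet w a).min' (minSet_nonempty w a)

/-- The multi-indices `a(k)`: `a(0) = 0` and `a(k+1) = a(k) + 1_{i(k)}`. -/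
def a {n : ℕ} (w : Fin (n + 1) → ℕ) : ℕ → Fin (n + 1) → ℕ
  | 0 => 0
  | k + 1 => a w k + Pi.single (minIndex w (a w k)) 1

theorem c_mem {n : ℕ} (w : Fin (n + 1) → ℕ) (k : ℕ) : c w k ∈ Set.Ico (0 : ℚ) 1 := by
  have key : ∀ f ∈ cList w, f ∈ Set.Ico (0 : ℚ) 1 := by
    intro f hf
    simp only [cList, List.mem_flatMap, List.mem_replicate, Finset.mem_sort] at hf
    obtain ⟨g, hg, -, rfl⟩ := hf
    simp only [fracSet, Finset.mem_biUnion, Finset.mem_univ, true_and, Finset.mem_image,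
      Finset.mem_range] at hg
    obtain ⟨i, l, hl, rfl⟩ := hg
    have hw : (0 : ℚ) < w i := by exact_mod_cast (Nat.zero_le l).trans_lt hl
    refine ⟨by positivity, ?_⟩
    rw [div_lt_one hw]
    exact_mod_cast hl
  unfold c
  by_cases h : k < (cList w).length
  · rw [List.getD_eq_getElem _ _ h]
    exact key _ (List.getElem_mem h)
  · rw [List.getD_eq_default _ _ (not_lt.mp h)]
    simp

/-! ### Laurent polynomials and their derivations -/

/-- `ℂ[θ, θ⁻¹]`; the variable `LaurentPolynomial.T 1` is `θ`, and `τ = θ⁻¹`. -/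
abbrev CTheta : Type := LaurentPolynomial ℂ

/-- `ℂ[x, x⁻¹, θ, θ⁻¹]`, as Laurent polynomials in `x` over `ℂ[θ, θ⁻¹]`. -/
abbrev CXTheta : Type := LaurentPolynomial CTheta

/-- `𝒪(U)[x, x⁻¹, θ, θ⁻¹]` where `U = (ℂ*)ⁿ` has coordinates `u₁, …, uₙ`: the Laurent
polynomials in `u₁, …, uₙ` over `ℂ[x, x⁻¹, θ, θ⁻¹]`. -/
abbrev Fun (n : ℕ) : Type := AddMonoidAlgebra CXTheta (Fin n → ℤ)

instance : CommRing CTheta := inferInstance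

instance : CommRing CXTheta := inferInstance

instance (n : ℕ) : CommRing (Fun n) := inferInstance

instance : AddCommGroup CTheta := inferInstance

instance : AddCommGroup CXTheta := inferInstance

instance (n : ℕ) : AddCommGroup (Fun n) := inferInstance

/-- `θ ∈ ℂ[θ, θ⁻¹]`. -/
def theta : CTheta := LaurentPolynomial.T 1

/-- `τ = θ⁻¹ ∈ ℂ[θ, θ⁻¹]`. -/
def tau : CTheta := LaurentPolynomial.T (-1)

/-- `x ∈ ℂ[x, x⁻¹, θ, θ⁻¹]`. -/
def xVar : CXTheta := LaurentPolynomial.T 1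

section Derivations

variable {S M : Type*} [CommRing S] [Algebra ℂ S] [AddCommMonoid M]

/-- The `ℂ`-linear map `s u^m ↦ (δ(s) + χ(m) s) u^m` on the monoid algebra `S[M]`. -/
def monDerLin (δ : Derivation ℂ S S) (χ : M →+ ℤ) :
    AddMonoidAlgebra S M →ₗ[ℂ] AddMonoidAlgebra S M where
  toFun f := AddMonoidAlgebra.ofCoeff
    (Finsupp.onFinset f.coeff.support (fun m => δ (f.coeff m) + χ m • f.coeff m) (by
      intro m hm
      rw [Finsupp.mem_support_iff]
      intro h0
      exact hm (by simp [h0])))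
  map_add' f g := by
    ext m
    simp
    ring
  map_smul' r f := by
    ext m
    simp

theorem monDerLin_coeff (δ : Derivation ℂ S S) (χ : M →+ ℤ) (f : AddMonoidAlgebra S M) (m : M) :
    (monDerLin δ χ f).coeff m = δ (f.coeff m) + χ m • f.coeff m := by
  simp [monDerLin]

theorem monDerLin_single (δ : Derivation ℂ S S) (χ : M →+ ℤ) (m : M) (s : S) :
    monDerLin δ χ (AddMonoidAlgebra.single m s) =
      AddMonoidAlgebra.single m (δ s + χ m • s) := by
  classical
  ext m'
  rw [monDerLin_coeff]
  simp only [AddMonoidAlgebra.coeff_single, Finsupp.single_apply]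
  split_ifs with h
  · subst h; rfl
  · simp

theorem monDerLin_mul (δ : Derivation ℂ S S) (χ : M →+ ℤ) (f g : AddMonoidAlgebra S M) :
    monDerLin δ χ (f * g) = f * monDerLin δ χ g + g * monDerLin δ χ f := by
  induction f using AddMonoidAlgebra.induction_linear with
  | zero => simp
  | add f₁ f₂ h₁ h₂ => rw [add_mul, map_add, h₁, h₂, map_add]; ring
  | single m s =>
    induction g using AddMonoidAlgebra.induction_linear with
    | zero => simp
    | add g₁ g₂ h₁ h₂ => rw [mul_add, map_add, h₁, h₂, map_add]; ring
    | single m' s' =>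
      rw [monDerLin_single, monDerLin_single, AddMonoidAlgebra.single_mul_single,
        monDerLin_single, AddMonoidAlgebra.single_mul_single,
        AddMonoidAlgebra.single_mul_single, add_comm m' m, ← AddMonoidAlgebra.single_add]
      congr 1
      simp only [Derivation.leibniz, map_add, smul_eq_mul, zsmul_eq_mul, Int.cast_add]
      ring

/-- The derivation `s u^m ↦ (δ(s) + χ(m) s) u^m` of the monoid algebra `S[M]`. -/
def monDer (δ : Derivation ℂ S S) (χ : M →+ ℤ) :
    Derivation ℂ (AddMonoidAlgebra S M) (AddMonoidAlgebra S M) :=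
  Derivation.mk' (monDerLin δ χ) (fun f g => by
    simpa only [smul_eq_mul] using monDerLin_mul δ χ f g)

theorem monDer_coeff (δ : Derivation ℂ S S) (χ : M →+ ℤ) (f : AddMonoidAlgebra S M) (m : M) :
    (monDer δ χ f).coeff m = δ (f.coeff m) + χ m • f.coeff m := monDerLin_coeff δ χ f m

theorem monDer_single (δ : Derivation ℂ S S) (χ : M →+ ℤ) (m : M) (s : S) :
    monDer δ χ (AddMonoidAlgebra.single m s) =
      AddMonoidAlgebra.single m (δ s + χ m • s) := monDerLin_single δ χ m s

/-- The derivations with `δ = 0` are `S`-linear. -/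
theorem monDer_zero_smul (χ : M →+ ℤ) (s : S) (f : AddMonoidAlgebra S M) :
    monDer (0 : Derivation ℂ S S) χ (s • f) = s • monDer (0 : Derivation ℂ S S) χ f := by
  ext m
  simp [monDer_coeff, mul_left_comm]

/-- The derivations `δ` (coefficientwise) and `χ` commute. -/
theorem monDer_comm (δ : Derivation ℂ S S) (χ : M →+ ℤ) (f : AddMonoidAlgebra S M) :
    monDer (0 : Derivation ℂ S S) χ (monDer δ 0 f) =
      monDer δ 0 (monDer (0 : Derivation ℂ S S) χ f) := by
  ext m
  simp [monDer_coeff]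

end Derivations

/-- `θ ∂_θ` on `ℂ[θ, θ⁻¹]`. -/
def thetaDer : Derivation ℂ CTheta CTheta := monDer 0 (AddMonoidHom.id ℤ)

/-- `θ ∂_θ` on `ℂ[x, x⁻¹, θ, θ⁻¹]`. -/
def thetaDerX : Derivation ℂ CXTheta CXTheta := monDer thetaDer 0

/-- `x ∂_x` on `ℂ[x, x⁻¹, θ, θ⁻¹]`. -/
def xDer : Derivation ℂ CXTheta CXTheta := monDer 0 (AddMonoidHom.id ℤ)

/-- `∂_τ = -θ · (θ ∂_θ)` on `𝒪(U)[x, x⁻¹, θ, θ⁻¹]`. -/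
def dTau (n : ℕ) : Derivation ℂ (Fun n) (Fun n) :=
  algebraMap CTheta (Fun n) (-theta) • monDer thetaDerX 0

/-- `∂_x = x⁻¹ · (x ∂_x)` on `𝒪(U)[x, x⁻¹, θ, θ⁻¹]`. -/
def dX (n : ℕ) : Derivation ℂ (Fun n) (Fun n) :=
  algebraMap CXTheta (Fun n) (LaurentPolynomial.T (-1)) • monDer xDer 0

/-- `u_i ∂/∂u_i` on `𝒪(U)[x, x⁻¹, θ, θ⁻¹]`. -/
def uDer {n : ℕ} (i : Fin n) : Derivation ℂ (Fun n) (Fun n) :=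
  monDer 0 (Pi.evalAddMonoidHom (fun _ : Fin n => ℤ) i)

/-- The monomial `u^m = u₁^{m₁} ⋯ uₙ^{mₙ}`. -/
def uMon {n : ℕ} (m : Fin n → ℤ) : Fun n := AddMonoidAlgebra.single m 1

/-- `u₀ = u₁^{-w₁} ⋯ uₙ^{-wₙ}`. -/
def u0 {n : ℕ} (w : Fin (n + 1) → ℕ) : Fun n := uMon fun i => -(w i.succ : ℤ)

/-- `F = u₁ + ⋯ + uₙ + x / (u₁^{w₁} ⋯ uₙ^{wₙ})`. -/
def F {n : ℕ} (w : Fin (n + 1) → ℕ) : Fun n :=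
  ∑ i : Fin n, uMon (Pi.single i 1) + xVar • u0 w

/-! ### Algebraic differential forms on the torus and the Gauss–Manin system -/

/-- `Ω^•(U)[x, x⁻¹, θ, θ⁻¹]`: the algebraic differential forms on the torus `U` (relative to the
parameters `x` and `θ`). The forms `du_J/u_J = ⋀_{j ∈ J} du_j/u_j`, with `J ⊆ {1, …, n}` and the
factors in increasing order, are a basis over the functions; a form is given by its
coefficients in this basis. -/
abbrev Forms (n : ℕ) : Type := Finset (Fin n) → Fun n

/-- `Ω^k(U)[x, x⁻¹, θ, θ⁻¹]`. -/
def Omega (n k : ℕ) : Submodule CXTheta (Forms n) where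
  carrier := {η | ∀ J, J.card ≠ k → η J = 0}
  add_mem' h₁ h₂ J hJ := by simp [h₁ J hJ, h₂ J hJ]
  zero_mem' _ _ := rfl
  smul_mem' r η h J hJ := by simp [h J hJ]

/-- The sign `(-1)^{#{j ∈ J | j < i}}`: for `i ∈ J`, it is the sign with
`du_i/u_i ∧ du_{J∖i}/u_{J∖i} = ± du_J/u_J`. -/
def formSign {n : ℕ} (i : Fin n) (J : Finset (Fin n)) : ℤ :=
  (-1) ^ (J.filter (· < i)).card

/-- The twisted differential `d_u - τ d_uF ∧` on `Ω^•(U)[x, x⁻¹, θ, θ⁻¹]`, where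
`d_u(g du_J/u_J) = ∑_i u_i ∂g/∂u_i · du_i/u_i ∧ du_J/u_J`. -/
def twistedD {n : ℕ} (w : Fin (n + 1) → ℕ) : Forms n →ₗ[CXTheta] Forms n where
  toFun η J := ∑ i ∈ J, formSign i J •
    (uDer i (η (J.erase i)) - tau • (uDer i (F w) * η (J.erase i)))
  map_add' η₁ η₂ := by
    funext J
    rw [Pi.add_apply, ← Finset.sum_add_distrib]
    refine Finset.sum_congr rfl fun i _ => ?_
    rw [← smul_add, Pi.add_apply, map_add, mul_add, smul_add]
    congr 1
    abel
  map_smul' r η := by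
    funext J
    rw [Pi.smul_apply, RingHom.id_apply, Finset.smul_sum]
    refine Finset.sum_congr rfl fun i _ => ?_
    have h : uDer i (r • η (J.erase i)) = r • uDer i (η (J.erase i)) := monDer_zero_smul _ _ _
    rw [Pi.smul_apply, h, mul_smul_comm, smul_comm tau r, ← smul_sub, smul_comm]

/-- The boundaries `(d_u - τ d_uF ∧) Ω^{n-1}(U)[x, x⁻¹, θ, θ⁻¹]` inside
`Ωⁿ(U)[x, x⁻¹, θ, θ⁻¹]`. -/
def boundaries {n : ℕ} (w : Fin (n + 1) → ℕ) : Submodule CXTheta (Omega n n) :=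
  ((Omega n (n - 1)).map (twistedD w)).comap (Omega n n).subtype

/-- The (Fourier–Laplace transform of the) Gauss–Manin system
`G = Ωⁿ(U)[x, x⁻¹, τ, τ⁻¹] / (d_u - τ d_uF ∧) Ω^{n-1}(U)[x, x⁻¹, τ, τ⁻¹]`. -/
def GaussManin {n : ℕ} (w : Fin (n + 1) → ℕ) : Type := Omega n n ⧸ boundaries w

instance {n : ℕ} (w : Fin (n + 1) → ℕ) : AddCommGroup (GaussManin w) :=
  inferInstanceAs (AddCommGroup (Omega n n ⧸ boundaries w))

instance {n : ℕ} (w : Fin (n + 1) → ℕ) : Module CXTheta (GaussManin w) :=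
  inferInstanceAs (Module CXTheta (Omega n n ⧸ boundaries w))

instance {n : ℕ} (w : Fin (n + 1) → ℕ) : Module CTheta (GaussManin w) :=
  inferInstanceAs (Module CTheta (Omega n n ⧸ boundaries w))

instance {n : ℕ} (w : Fin (n + 1) → ℕ) : Module ℂ (GaussManin w) :=
  inferInstanceAs (Module ℂ (Omega n n ⧸ boundaries w))

instance {n : ℕ} (w : Fin (n + 1) → ℕ) : IsScalarTower CTheta CXTheta (GaussManin w) :=
  inferInstanceAs (IsScalarTower CTheta CXTheta (Omega n n ⧸ boundaries w))

instance {n : ℕ} (w : Fin (n + 1) → ℕ) : IsScalarTower ℂ CTheta (GaussManin w) :=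
  inferInstanceAs (IsScalarTower ℂ CTheta (Omega n n ⧸ boundaries w))

instance {n : ℕ} (w : Fin (n + 1) → ℕ) : IsScalarTower ℂ CXTheta (GaussManin w) :=
  inferInstanceAs (IsScalarTower ℂ CXTheta (Omega n n ⧸ boundaries w))

/-- The class in `G` of an `n`-form. -/
def GaussManin.mk {n : ℕ} (w : Fin (n + 1) → ℕ) : Omega n n →ₗ[CXTheta] GaussManin w :=
  (boundaries w).mkQ


/-- The operator `η ↦ δ(η) - g η` on forms, `δ` acting on the coefficients in the basis
`du_J/u_J`. -/
def twist {n : ℕ} (δ : Derivation ℂ (Fun n) (Fun n)) (g : Fun n) : Forms n →ₗ[ℂ] Forms n where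
  toFun η J := δ (η J) - g * η J
  map_add' η₁ η₂ := by
    funext J
    simp only [Pi.add_apply, map_add, mul_add]
    abel
  map_smul' r η := by
    funext J
    simp only [Pi.smul_apply, Derivation.map_smul, RingHom.id_apply, mul_smul_comm, smul_sub]

theorem uDer_comm {n : ℕ} (δ : Derivation ℂ CXTheta CXTheta) (i : Fin n) (h : Fun n) :
    uDer i (monDer δ 0 h) = monDer δ 0 (uDer i h) := monDer_comm _ _ _

theorem uDer_smul {n : ℕ} (r : CXTheta) (i : Fin n) (h : Fun n) :
    uDer i (r • h) = r • uDer i h := monDer_zero_smul _ _ _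

theorem uDer_algebraMap {n : ℕ} (r : CXTheta) (i : Fin n) :
    uDer i (algebraMap CXTheta (Fun n) r) = 0 := by
  rw [Algebra.algebraMap_eq_smul_one, uDer_smul, Derivation.map_one_eq_zero, smul_zero]

theorem twist_comm_aux {A : Type*} [CommRing A] [Algebra ℂ A] (d δ : Derivation ℂ A A)
    (g t f : A) (h₁ : ∀ h, d (δ h) = δ (d h)) (h₂ : d g = δ (t * f)) (h : A) :
    d (δ h - g * h) - t * (f * (δ h - g * h)) =
      δ (d h - t * (f * h)) - g * (d h - t * (f * h)) := by
  have h₃ : δ (t * (f * h)) = t * f * δ h + h * d g := by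
    rw [← mul_assoc, Derivation.leibniz, h₂, smul_eq_mul, smul_eq_mul]
  rw [map_sub, map_sub, h₃, Derivation.leibniz, h₁, smul_eq_mul, smul_eq_mul]
  ring

/-- `twist δ g` commutes with `d_u - τ d_uF ∧` as soon as the coefficients do. -/
theorem twist_comm {n : ℕ} (w : Fin (n + 1) → ℕ) (δ : Derivation ℂ (Fun n) (Fun n)) (g : Fun n)
    (h₁ : ∀ i h, uDer i (δ h) = δ (uDer i h))
    (h₂ : ∀ i, uDer i g = δ (tau • uDer i (F w))) (η : Forms n) :
    twistedD w (twist δ g η) = twist δ g (twistedD w η) := by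
  funext J
  have key : ∀ i, uDer i (twist δ g η (J.erase i)) -
      tau • (uDer i (F w) * twist δ g η (J.erase i)) =
      δ (uDer i (η (J.erase i)) - tau • (uDer i (F w) * η (J.erase i))) -
      g * (uDer i (η (J.erase i)) - tau • (uDer i (F w) * η (J.erase i))) := by
    intro i
    have h := h₂ i
    rw [Algebra.smul_def] at h
    rw [Algebra.smul_def, Algebra.smul_def]
    exact twist_comm_aux (uDer i) δ g _ _ (h₁ i) h (η (J.erase i))
  have e₁ : twistedD w (twist δ g η) J = ∑ i ∈ J, formSign i J •
      (uDer i (twist δ g η (J.erase i)) - tau • (uDer i (F w) * twist δ g η (J.erase i))) := rfl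
  have e₂ : twist δ g (twistedD w η) J = δ (∑ i ∈ J, formSign i J •
      (uDer i (η (J.erase i)) - tau • (uDer i (F w) * η (J.erase i)))) -
    g * ∑ i ∈ J, formSign i J •
      (uDer i (η (J.erase i)) - tau • (uDer i (F w) * η (J.erase i))) := rfl
  rw [e₁, e₂, map_sum, Finset.mul_sum, ← Finset.sum_sub_distrib]
  refine Finset.sum_congr rfl fun i _ => ?_
  rw [key, smul_sub, mul_smul_comm]
  congr 1
  exact (map_zsmul δ _ _).symm

/-- The descent to `G` of an operator `twist δ g` commuting with `d_u - τ d_uF ∧`. -/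
def descend {n : ℕ} (w : Fin (n + 1) → ℕ) (δ : Derivation ℂ (Fun n) (Fun n)) (g : Fun n)
    (h : ∀ η, twistedD w (twist δ g η) = twist δ g (twistedD w η)) :
    GaussManin w →ₗ[ℂ] GaussManin w :=
  have hΩ : ∀ k, ∀ η ∈ Omega n k, twist δ g η ∈ Omega n k := fun k η hη J hJ => by
    change δ (η J) - g * η J = 0
    rw [hη J hJ]
    simp
  let f : Omega n n →ₗ[ℂ] Omega n n :=
    { toFun := fun η => ⟨twist δ g η.1, hΩ n η.1 η.2⟩
      map_add' := fun η₁ η₂ => Subtype.ext (map_add (twist δ g) η₁.1 η₂.1)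
      map_smul' := fun r η => Subtype.ext (map_smul (twist δ g) r η.1) }
  have hf : (boundaries w).restrictScalars ℂ ≤ ((boundaries w).restrictScalars ℂ).comap f := by
    rintro η ⟨ξ, hξ, hη⟩
    exact ⟨twist δ g ξ, hΩ _ ξ hξ, (h ξ).trans (congrArg (twist δ g) hη)⟩
  (Submodule.Quotient.restrictScalarsEquiv ℂ (boundaries w)).toLinearMap ∘ₗ
    Submodule.mapQ _ _ f hf ∘ₗ
    (Submodule.Quotient.restrictScalarsEquiv ℂ (boundaries w)).symm.toLinearMap


theorem monDer_uMon {n : ℕ} (δ : Derivation ℂ CXTheta CXTheta) (m : Fin n → ℤ) :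
    monDer δ 0 (uMon m) = 0 := by
  rw [uMon, monDer_single]
  simp

theorem monDer_algebraMap {n : ℕ} (δ : Derivation ℂ CXTheta CXTheta) (r : CXTheta) :
    monDer δ 0 (algebraMap CXTheta (Fun n) r) = algebraMap CXTheta (Fun n) (δ r) := by
  have h : ∀ s : CXTheta, algebraMap CXTheta (Fun n) s = AddMonoidAlgebra.single 0 s :=
    fun s => rfl
  rw [h, h, monDer_single]
  simp

theorem algebraMap_tower {n : ℕ} (r : CTheta) :
    algebraMap CTheta (Fun n) r =
      algebraMap CXTheta (Fun n) (algebraMap CTheta CXTheta r) := rfl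

theorem dTau_comm {n : ℕ} (i : Fin n) (h : Fun n) :
    uDer i (dTau n h) = dTau n (uDer i h) := by
  rw [dTau, Derivation.smul_apply, Derivation.smul_apply, smul_eq_mul, smul_eq_mul,
    Derivation.leibniz, algebraMap_tower, uDer_algebraMap, smul_zero, add_zero, smul_eq_mul,
    uDer_comm]

theorem dX_comm {n : ℕ} (i : Fin n) (h : Fun n) :
    uDer i (dX n h) = dX n (uDer i h) := by
  rw [dX, Derivation.smul_apply, Derivation.smul_apply, smul_eq_mul, smul_eq_mul,
    Derivation.leibniz, uDer_algebraMap, smul_zero, add_zero, smul_eq_mul, uDer_comm]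

theorem thetaDerX_x : thetaDerX xVar = 0 := by
  have h : xVar = AddMonoidAlgebra.single 1 1 := rfl
  rw [h, thetaDerX, monDer_single]
  simp

theorem dTau_tau (n : ℕ) : dTau n (algebraMap CTheta (Fun n) tau) = 1 := by
  have h : thetaDerX (algebraMap CTheta CXTheta tau) = algebraMap CTheta CXTheta (-tau) := by
    have h' : ∀ s : CTheta, algebraMap CTheta CXTheta s = AddMonoidAlgebra.single 0 s :=
      fun s => rfl
    have ht : tau = AddMonoidAlgebra.single (-1) 1 := rfl
    rw [h', h', thetaDerX, monDer_single, thetaDer, ht, monDer_single]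
    congr 1
    simp
  rw [dTau, Derivation.smul_apply, algebraMap_tower tau, monDer_algebraMap, h, ← algebraMap_tower,
    smul_eq_mul, ← map_mul, neg_mul_neg, theta, tau, ← LaurentPolynomial.T_add, add_neg_cancel,
    LaurentPolynomial.T_zero, map_one]

theorem dX_smul {n : ℕ} (r : CTheta) (h : Fun n) : dX n (r • h) = r • dX n h := by
  have hr : xDer (algebraMap CTheta CXTheta r) = 0 := by
    have h' : algebraMap CTheta CXTheta r = AddMonoidAlgebra.single 0 r := rfl
    rw [h', xDer, monDer_single]
    simp
  rw [Algebra.smul_def r h, Derivation.leibniz, Algebra.smul_def r (dX n h), smul_eq_mul,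
    smul_eq_mul, algebraMap_tower]
  have hz : dX n (algebraMap CXTheta (Fun n) (algebraMap CTheta CXTheta r)) = 0 := by
    rw [dX, Derivation.smul_apply, monDer_algebraMap, hr, map_zero, smul_zero]
  rw [hz, mul_zero, add_zero]

theorem dTau_F {n : ℕ} (w : Fin (n + 1) → ℕ) : dTau n (F w) = 0 := by
  rw [dTau, Derivation.smul_apply, F, map_add, map_sum, Algebra.smul_def xVar,
    Derivation.leibniz, monDer_algebraMap, u0, monDer_uMon, thetaDerX_x]
  simp [monDer_uMon]

theorem twist_tau_comm {n : ℕ} (w : Fin (n + 1) → ℕ) (η : Forms n) :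
    twistedD w (twist (dTau n) (F w) η) = twist (dTau n) (F w) (twistedD w η) := by
  refine twist_comm w _ _ dTau_comm (fun i => ?_) η
  rw [Algebra.smul_def, Derivation.leibniz, dTau_tau, ← dTau_comm, dTau_F, map_zero]
  simp

theorem twist_x_comm {n : ℕ} (w : Fin (n + 1) → ℕ) (η : Forms n) :
    twistedD w (twist (dX n) (tau • dX n (F w)) η) =
      twist (dX n) (tau • dX n (F w)) (twistedD w η) := by
  refine twist_comm w _ _ dX_comm (fun i => ?_) η
  rw [dX_smul, ← dX_comm, Algebra.smul_def, Algebra.smul_def, Derivation.leibniz,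
    algebraMap_tower, uDer_algebraMap]
  simp

/-- The connection in the direction `∂_τ`: `∇_{∂_τ}(ω τⁱ) = i ω τ^{i-1} - F ω τⁱ`. -/
def nablaTau {n : ℕ} (w : Fin (n + 1) → ℕ) : GaussManin w →ₗ[ℂ] GaussManin w :=
  descend w (dTau n) (F w) (twist_tau_comm w)

/-- The connection in the direction `∂_x`:
`∇_{∂_x}(ω τⁱ) = L_{∂_x}(ω) τⁱ - (∂F/∂x) ω τ^{i+1}`. -/
def nablaX {n : ℕ} (w : Fin (n + 1) → ℕ) : GaussManin w →ₗ[ℂ] GaussManin w :=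
  descend w (dX n) (tau • dX n (F w)) (twist_x_comm w)

/-- `∇_{θ∂_θ} = -τ ∇_{∂_τ}`. -/
def nablaThetaEuler {n : ℕ} (w : Fin (n + 1) → ℕ) (g : GaussManin w) : GaussManin w :=
  -(tau • nablaTau w g)

/-- `x ∇_{∂_x}`. -/
def nablaXEuler {n : ℕ} (w : Fin (n + 1) → ℕ) (g : GaussManin w) : GaussManin w :=
  xVar • nablaX w g

/-- The `n`-form `g du₁/u₁ ∧ ⋯ ∧ duₙ/uₙ`. -/
def topForm {n : ℕ} (g : Fun n) : Omega n n :=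
  ⟨Pi.single Finset.univ g, fun J hJ => by
    have h : J ≠ Finset.univ := by
      rintro rfl
      exact hJ (by simp)
    rw [Pi.single_eq_of_ne h]⟩

/-- The sections `ω_k^φ`: the class of
`(∏ w_i^{a(k)_i})⁻¹ (x u₀)^{a(k)₀} u₁^{a(k)₁} ⋯ uₙ^{a(k)ₙ} du₁/u₁ ∧ ⋯ ∧ duₙ/uₙ`.
If `w₀ = 1` then `a(k)₀ = 1` for `1 ≤ k ≤ μ`, while `a(0) = 0`. -/
def omega {n : ℕ} (w : Fin (n + 1) → ℕ) (k : ℕ) : GaussManin w :=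
  GaussManin.mk w (topForm
    ((∏ i, (w i : ℂ) ^ a w k i)⁻¹ •
      ((xVar • u0 w) ^ a w k 0 * ∏ i : Fin n, uMon (Pi.single i 1) ^ a w k i.succ)))

/-! ### The Kashiwara–Malgrange filtration at `x = 0` -/

/-- `V^{>α}`, the union of the `V^β` with `β > α`, for a decreasing filtration `V`. -/
def Vgt {n : ℕ} {w : Fin (n + 1) → ℕ} (V : ℚ → Submodule CTheta (GaussManin w)) (α : ℚ) :
    Submodule CTheta (GaussManin w) :=
  ⨆ β : Set.Ioi α, V β

/-- `V` is the Kashiwara–Malgrange filtration of the Gauss–Manin system `G` at `x = 0`: a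
decreasing exhaustive filtration of `G`, indexed by some `(1/N)ℤ`, such that
`V^{α+1} = x V^α` (so the `V^α` are `ℂ[x, θ, θ⁻¹]`-submodules, and stability under `x∇_{∂_x}`
means `∇_{∂_x} V^α ⊆ V^{α-1}`), each `V^α` is of finite type over `ℂ[x, θ, θ⁻¹]`, stable under
`x∇_{∂_x}` and `∇_{θ∂_θ}`, and `x∇_{∂_x} - α` is nilpotent on `V^α / V^{>α}`. -/
structure IsKashiwaraMalgrange {n : ℕ} (w : Fin (n + 1) → ℕ)
    (V : ℚ → Submodule CTheta (GaussManin w)) : Prop where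
  antitone : Antitone V
  exhaustive : ∀ g, ∃ α, g ∈ V α
  discrete : ∃ N : ℕ, 0 < N ∧ ∀ α : ℚ, V α = V ((⌈(N : ℚ) * α⌉ : ℚ) / N)
  x_smul : ∀ α g, xVar • g ∈ V (α + 1) ↔ g ∈ V α
  finite_type : ∀ α, ∃ s : Finset (GaussManin w), V α =
    Submodule.span CTheta {g | ∃ p : ℕ, ∃ h ∈ s, g = xVar ^ p • h}
  x_stable : ∀ α, ∀ g ∈ V α, nablaXEuler w g ∈ V α
  theta_stable : ∀ α, ∀ g ∈ V α, nablaThetaEuler w g ∈ V α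
  nilpotent : ∀ α, ∃ m : ℕ, ∀ g ∈ V α,
    (fun h => nablaXEuler w h - (α : ℂ) • h)^[m] g ∈ Vgt V α

/-- The filtration `V^•G`. With `v(ω_k^φ) = c_k ∈ [0, 1)`, `V^αG` is spanned over `ℂ[θ, θ⁻¹]` by
the `x^p ω_k^φ` with `p + v(ω_k^φ) ≥ α`; so, for `0 ≤ α < 1`, it is generated over
`ℂ[x, θ, θ⁻¹]` by the `ω_k^φ` with `v(ω_k^φ) ≥ α` and the `x ω_k^φ` with `v(ω_k^φ) < α`, and
`V^{α+p}G = x^p V^αG`. -/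
def V {n : ℕ} (w : Fin (n + 1) → ℕ) (α : ℚ) : Submodule CTheta (GaussManin w) :=
  Submodule.span CTheta {g | ∃ (k : Fin (mu w)) (p : ℤ), α ≤ p + c w k ∧
    g = (LaurentPolynomial.T p : CXTheta) • omega w k}

theorem omega_mem {n : ℕ} (w : Fin (n + 1) → ℕ) (k : Fin (mu w)) : omega w k ∈ V w (c w k) :=
  Submodule.subset_span ⟨k, 0, by simp, by simp⟩

/-- `G^α = V^αG / V^{>α}G`. -/
def Gr {n : ℕ} (w : Fin (n + 1) → ℕ) (α : ℚ) : Type :=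
  V w α ⧸ (Vgt (V w) α).comap (V w α).subtype

instance {n : ℕ} (w : Fin (n + 1) → ℕ) (α : ℚ) : AddCommGroup (Gr w α) :=
  inferInstanceAs (AddCommGroup (V w α ⧸ (Vgt (V w) α).comap (V w α).subtype))

instance {n : ℕ} (w : Fin (n + 1) → ℕ) (α : ℚ) : Module CTheta (Gr w α) :=
  inferInstanceAs (Module CTheta (V w α ⧸ (Vgt (V w) α).comap (V w α).subtype))

instance {n : ℕ} (w : Fin (n + 1) → ℕ) (α : ℚ) : Module ℂ (Gr w α) :=
  inferInstanceAs (Module ℂ (V w α ⧸ (Vgt (V w) α).comap (V w α).subtype))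

instance {n : ℕ} (w : Fin (n + 1) → ℕ) (α : ℚ) : IsScalarTower ℂ CTheta (Gr w α) :=
  inferInstanceAs (IsScalarTower ℂ CTheta (V w α ⧸ (Vgt (V w) α).comap (V w α).subtype))

/-- The class in `G^α` of an element of `V^αG`. -/
def Gr.mk {n : ℕ} (w : Fin (n + 1) → ℕ) (α : ℚ) : V w α →ₗ[CTheta] Gr w α :=
  ((Vgt (V w) α).comap (V w α).subtype).mkQ

/-- `Ḡ = ⨁_{α ∈ [0, 1)} G^α`, a module over `ℂ[θ, θ⁻¹]`. -/
def GBar {n : ℕ} (w : Fin (n + 1) → ℕ) : Type :=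
  DirectSum (Set.Ico (0 : ℚ) 1) fun α => Gr w α

instance {n : ℕ} (w : Fin (n + 1) → ℕ) : AddCommGroup (GBar w) :=
  inferInstanceAs (AddCommGroup (DirectSum (Set.Ico (0 : ℚ) 1) fun α => Gr w α))

instance {n : ℕ} (w : Fin (n + 1) → ℕ) : Module CTheta (GBar w) :=
  inferInstanceAs (Module CTheta (DirectSum (Set.Ico (0 : ℚ) 1) fun α => Gr w α))

instance {n : ℕ} (w : Fin (n + 1) → ℕ) : Module ℂ (GBar w) :=
  inferInstanceAs (Module ℂ (DirectSum (Set.Ico (0 : ℚ) 1) fun α => Gr w α))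

instance {n : ℕ} (w : Fin (n + 1) → ℕ) : IsScalarTower ℂ CTheta (GBar w) :=
  inferInstanceAs (IsScalarTower ℂ CTheta (DirectSum (Set.Ico (0 : ℚ) 1) fun α => Gr w α))

/-- The class in `G^α ⊆ Ḡ` of an element of `V^αG`. -/
def gcls {n : ℕ} {w : Fin (n + 1) → ℕ} (α : Set.Ico (0 : ℚ) 1) (g : V w α) : GBar w :=
  DirectSum.lof CTheta _ (fun α : Set.Ico (0 : ℚ) 1 => Gr w α) α (Gr.mk w α g)

/-- The class `[ω_k^φ] ∈ G^{c_k} ⊆ Ḡ`. -/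
def omegaBar {n : ℕ} (w : Fin (n + 1) → ℕ) (k : Fin (mu w)) : GBar w :=
  gcls ⟨c w k, c_mem w k⟩ ⟨omega w k, omega_mem w k⟩

/-! ### Saito structures on `ℙ¹` and Frobenius type structures on a point -/

/-- `ℂ[θ]`. -/
abbrev OZero : Subalgebra ℂ CTheta := Algebra.adjoin ℂ {theta}

/-- `ℂ[τ] = ℂ[θ⁻¹]`. -/
abbrev OInf : Subalgebra ℂ CTheta := Algebra.adjoin ℂ {tau}

instance : CommRing OZero := inferInstance

instance : CommRing OInf := inferInstance

/-- `θ`, as an element of `ℂ[θ]`. -/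
def thetaZero : OZero := ⟨theta, Algebra.subset_adjoin rfl⟩

/-- `i^*`: the ring automorphism `p(θ) ↦ p(-θ)` of `ℂ[θ, θ⁻¹]`. -/
def conjTheta : CTheta →+* CTheta :=
  LaurentPolynomial.eval₂ (LaurentPolynomial.C : ℂ →+* CTheta)
    (-(LaurentPolynomial.isUnit_T (R := ℂ) 1).unit : CThetaˣ)

/-- The ring automorphism `p(x, θ) ↦ p(x, -θ)` of `ℂ[x, x⁻¹, θ, θ⁻¹]`. -/
def conjThetaX : CXTheta →+* CXTheta := AddMonoidAlgebra.mapRingHom ℤ conjTheta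

/-- `θⁿ ℂ[θ]`: the sections over `ℙ¹ ∖ {∞}` of `θⁿ 𝒪`, regular over this chart. -/
def thetaPowZero (n : ℕ) : Set CTheta := {f | ∃ h ∈ OZero, f = theta ^ n * h}

/-- `θⁿ ℂ[τ]`: the sections over `ℙ¹ ∖ {0}` of `θⁿ 𝒪`. -/
def thetaPowInf (n : ℕ) : Set CTheta := {f | ∃ h ∈ OInf, f = theta ^ n * h}

section Saito

variable {H : Type*} [AddCommGroup H] [Module ℂ H] [Module CTheta H] [IsScalarTower ℂ CTheta H]

/-- A Saito structure of weight `n` on `ℙ¹` (over a point).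

The bundle is given by its module `H` of sections over `ℂ* = ℙ¹ ∖ {0, ∞}`, over `ℂ[θ, θ⁻¹]`, and by
the lattices `H₀`, over `ℂ[θ]`, and `H_∞`, over `ℂ[τ]`, of sections over `ℙ¹ ∖ {∞}` and over
`ℙ¹ ∖ {0}`; its global sections are the elements of `H₀ ∩ H_∞`. `nabla` is the operator
`∇_{θ∂_θ}`, and `S` is the pairing, `ℂ[θ, θ⁻¹]`-linear in the first variable and `i^*`-semilinear
in the second. A connection over a curve is automatically flat. -/
structure IsSaitoStructure (n : ℕ) (H₀ : Submodule OZero H) (Hinf : Submodule OInf H)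
    (nabla : H →ₗ[ℂ] H) (S : H →ₗ[CTheta] H →ₛₗ[conjTheta] CTheta) : Prop where
  weight_pos : 0 < n
  /-- The bundle is trivial: there is a basis of global sections. -/
  trivial : ∃ (r : ℕ) (σ : Module.Basis (Fin r) CTheta H),
    H₀ = Submodule.span OZero (Set.range σ) ∧ Hinf = Submodule.span OInf (Set.range σ)
  /-- `∇` is a connection. -/
  leibniz : ∀ (f : CTheta) (h : H), nabla (f • h) = thetaDer f • h + f • nabla h
  /-- `∇` has a pole of order (Poincaré rank) at most `1` along `θ = 0`:
  `θ²∇_{∂_θ}` preserves `H₀`. -/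
  pole_zero : ∀ h ∈ H₀, theta • nabla h ∈ H₀
  /-- `∇` has a logarithmic pole at `∞`: `∇_{τ∂_τ} = -∇_{θ∂_θ}` preserves `H_∞`. -/
  pole_inf : ∀ h ∈ Hinf, nabla h ∈ Hinf
  /-- `S` is `∇`-flat. -/
  flat : ∀ h h', thetaDer (S h h') = S (nabla h) h' + S h (nabla h')
  /-- `S` takes values in `θⁿ 𝒪`. -/
  values_zero : ∀ h ∈ H₀, ∀ h' ∈ H₀, S h h' ∈ thetaPowZero n
  values_inf : ∀ h ∈ Hinf, ∀ h' ∈ Hinf, S h h' ∈ thetaPowInf n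
  /-- `S` is nondegenerate: it induces a perfect pairing with values in `θⁿ 𝒪` on each of the two
  charts. -/
  nondeg_zero : ∀ φ : H →ₗ[CTheta] CTheta, (∀ h ∈ H₀, φ h ∈ thetaPowZero n) →
    ∃! h', h' ∈ H₀ ∧ ∀ h, φ h = S h h'
  nondeg_inf : ∀ φ : H →ₗ[CTheta] CTheta, (∀ h ∈ Hinf, φ h ∈ thetaPowInf n) →
    ∃! h', h' ∈ Hinf ∧ ∀ h, φ h = S h h'
  /-- `S` is symmetric: `θ⁻ⁿ S` is `i^*`-hermitian. -/
  symm : ∀ h h', S h' h = (-1) ^ n * conjTheta (S h h')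

/-- The fibre `E = H₀ / θ H₀` at `θ = 0` of the bundle with lattice `H₀`. -/
def Fibre (H₀ : Submodule OZero H) : Type _ :=
  H₀ ⧸ ((Ideal.span {thetaZero} : Ideal OZero) • (⊤ : Submodule OZero H₀))

instance (H₀ : Submodule OZero H) : AddCommGroup (Fibre H₀) :=
  inferInstanceAs
    (AddCommGroup (H₀ ⧸ ((Ideal.span {thetaZero} : Ideal OZero) • (⊤ : Submodule OZero H₀))))

instance (H₀ : Submodule OZero H) : Module OZero (Fibre H₀) :=
  inferInstanceAs
    (Module OZero (H₀ ⧸ ((Ideal.span {thetaZero} : Ideal OZero) • (⊤ : Submodule OZero H₀))))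

instance (H₀ : Submodule OZero H) : Module ℂ (Fibre H₀) :=
  inferInstanceAs
    (Module ℂ (H₀ ⧸ ((Ideal.span {thetaZero} : Ideal OZero) • (⊤ : Submodule OZero H₀))))

/-- The class in the fibre at `θ = 0`. -/
def Fibre.mk (H₀ : Submodule OZero H) : H₀ →ₗ[OZero] Fibre H₀ :=
  ((Ideal.span {thetaZero} : Ideal OZero) • (⊤ : Submodule OZero H₀)).mkQ

/-- `(E, R₀, R_∞, g)`, with `E` the fibre at `θ = 0`, is the tuple attached to a Saito structure:
`R₀[σ] = [θ²∇_{∂_θ}σ]`; `R_∞[σ] = [∇_{τ∂_τ}σ]` for a global section `σ`, the class being taken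
in the fibre at `∞` and both fibres being identified through global sections; and
`g([σ], [σ'])` is the coefficient of `θⁿ` in `S(σ, σ')`. -/
structure IsAttached (n : ℕ) (H₀ : Submodule OZero H) (Hinf : Submodule OInf H)
    (nabla : H →ₗ[ℂ] H) (S : H →ₗ[CTheta] H →ₛₗ[conjTheta] CTheta)
    (R₀ Rinf : Module.End ℂ (Fibre H₀)) (g : LinearMap.BilinForm ℂ (Fibre H₀)) : Prop where
  zero : ∀ h : H₀, ∃ h' : H₀, (h' : H) = theta • nabla h ∧
    R₀ (Fibre.mk H₀ h) = Fibre.mk H₀ h'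
  inf : ∀ σ : H₀, (σ : H) ∈ Hinf → ∃ ρ : H₀, (ρ : H) ∈ Hinf ∧
    (∃ h ∈ Hinf, -nabla σ - ρ = tau • h) ∧
    Rinf (Fibre.mk H₀ σ) = Fibre.mk H₀ ρ
  pairing : ∀ h h' : H₀, g (Fibre.mk H₀ h) (Fibre.mk H₀ h') =
    (S h h').coeff (n : ℤ)

end Saito

/-- A Frobenius type structure `(E, R₀, R_∞, g)` on a point. -/
structure IsFrobeniusTypeOnPoint {E : Type*} [AddCommGroup E] [Module ℂ E]
    (R₀ Rinf : Module.End ℂ E) (g : LinearMap.BilinForm ℂ E) : Prop where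
  finite : FiniteDimensional ℂ E
  symm : g.IsSymm
  nondegenerate : g.Nondegenerate
  zero : ∀ e e', g (R₀ e) e' = g e (R₀ e')
  inf : ∃ r : ℂ, ∀ e e', g (Rinf e) e' + g e (Rinf e') = r * g e e'

/-! ### The limits -/

/-- `Ā₀`: its entry `(i, j)` is `μ` if `i = j + 1` and `c_i = c_j`, and `0` otherwise
(rows and columns are numbered from `0`). -/
def ABar {n : ℕ} (w : Fin (n + 1) → ℕ) : Matrix (Fin (mu w)) (Fin (mu w)) ℂ :=
  Matrix.of fun i j => if (i : ℕ) = j + 1 ∧ c w i = c w j then (mu w : ℂ) else 0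

/-- `A_∞ = Diag(α₀, …, α_{μ-1})`. -/
def AInf {n : ℕ} (w : Fin (n + 1) → ℕ) : Matrix (Fin (mu w)) (Fin (mu w)) ℂ :=
  Matrix.diagonal fun i => ((alpha w i : ℚ) : ℂ)

/-- `Ḡ₀`: the `ℂ[θ]`-submodule of `Ḡ` generated by the `[ω_k^φ]`. -/
def GBarZero {n : ℕ} (w : Fin (n + 1) → ℕ) : Submodule OZero (GBar w) :=
  Submodule.span OZero (Set.range (omegaBar w))

/-- The `ℂ[τ]`-submodule of `Ḡ` generated by the `[ω_k^φ]`: it extends `Ḡ₀` to the trivial bundle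
`H̄` on `ℙ¹` whose global sections are the combinations of the `[ω_k^φ]`. -/
def GBarInf {n : ℕ} (w : Fin (n + 1) → ℕ) : Submodule OInf (GBar w) :=
  Submodule.span OInf (Set.range (omegaBar w))

/-- `∇̄` is the limit of the connection: `∇_{θ∂_θ}` preserves `V^•G`, and `∇̄_{θ∂_θ}` is the
operator it induces on the graded pieces. -/
def IsLimitConnection {n : ℕ} (w : Fin (n + 1) → ℕ) (nablaBar : GBar w →ₗ[ℂ] GBar w) : Prop :=
  ∀ (α : Set.Ico (0 : ℚ) 1) (g : V w α), ∃ h : nablaThetaEuler w g ∈ V w α,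
    nablaBar (gcls α g) = gcls α ⟨nablaThetaEuler w g, h⟩

/-- The pairing on `G`, `ℂ[x, x⁻¹, θ, θ⁻¹]`-linear in the first variable, semilinear with respect to
`p(x, θ) ↦ p(x, -θ)` in the second, given in terms of the `ω_k^φ`. -/
def IsPairing {n : ℕ} (w : Fin (n + 1) → ℕ)
    (S : GaussManin w →ₗ[CXTheta] GaussManin w →ₛₗ[conjThetaX] CXTheta) : Prop :=
  ∀ k l : Fin (mu w), S (omega w k) (omega w l) =
    if (k : ℕ) + l = n then
      ((∏ i, (w i : ℂ))⁻¹ • theta ^ n) • (1 : CXTheta)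
    else if n + 1 ≤ (k : ℕ) ∧ (k : ℕ) + l = mu w + n then
      ((∏ i, (w i : ℂ) ^ w i)⁻¹ • (∏ i, (w i : ℂ))⁻¹ • theta ^ n) • xVar
    else 0

/-- `S̄` is the limit of the pairing `S`: `S(V^0G, V^0G) ⊆ ℂ[x, θ, θ⁻¹]` and `S̄` is on `G^0` the
constant coefficient in `x`; if `β + γ = 1` then `S(V^βG, V^γG) ⊆ x ℂ[x, θ, θ⁻¹]` and `S̄` is on
`G^β × G^γ` the coefficient of `x`; and `S̄` vanishes on the other `G^β × G^γ`. -/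
def IsLimitPairing {n : ℕ} (w : Fin (n + 1) → ℕ)
    (S : GaussManin w →ₗ[CXTheta] GaussManin w →ₛₗ[conjThetaX] CXTheta)
    (SBar : GBar w →ₗ[CTheta] GBar w →ₛₗ[conjTheta] CTheta) : Prop :=
  ∀ (β γ : Set.Ico (0 : ℚ) 1) (g : V w β) (h : V w γ),
    ((β : ℚ) + γ = 0 → (∀ m : ℤ, m < 0 → (S g h).coeff m = 0) ∧
      SBar (gcls β g) (gcls γ h) = (S g h).coeff 0) ∧
    ((β : ℚ) + γ = 1 → (∀ m : ℤ, m < 1 → (S g h).coeff m = 0) ∧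
      SBar (gcls β g) (gcls γ h) = (S g h).coeff 1) ∧
    ((β : ℚ) + γ ≠ 0 → (β : ℚ) + γ ≠ 1 → SBar (gcls β g) (gcls γ h) = 0)

/-- The values of the limit pairing on the `[ω_k^φ]`. -/
def HasLimitValues {n : ℕ} (w : Fin (n + 1) → ℕ)
    (SBar : GBar w →ₗ[CTheta] GBar w →ₛₗ[conjTheta] CTheta) : Prop :=
  ∀ k l : Fin (mu w), SBar (omegaBar w k) (omegaBar w l) =
    if (k : ℕ) + l = n then (∏ i, (w i : ℂ))⁻¹ • theta ^ n
    else if n + 1 ≤ (k : ℕ) ∧ (k : ℕ) + l = mu w + n then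
      (∏ i, (w i : ℂ) ^ (w i + 1))⁻¹ • theta ^ n
    else 0

/-- The class of `[ω_k^φ]` in the fibre `Ē = Ḡ₀ / θ Ḡ₀`. -/
def omegaFibre {n : ℕ} (w : Fin (n + 1) → ℕ) (k : Fin (mu w)) : Fibre (GBarZero w) :=
  Fibre.mk (GBarZero w) ⟨omegaBar w k, Submodule.subset_span ⟨k, rfl⟩⟩

end LimitSaito

end

noncomputable section

namespace LimitSaito

/-! ### Combinatorics of the sequences `a` and `c` -/

/-! Put D = θ x∇_{∂_x}. As x enters F only through x u₀, D sends the class of u^m to that of -x u₀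
u^m, and the relations of G say that u_i u^m has class (m_i θ - w_i D) u^m. Each step of the
sequence a multiplies the monomial of ω_k by x u₀ or by u_i / w_i, so that D ω_k = ℓ_k θ ω_k -
ω_{k+1} with ℓ_k = min a(k)_i / w_i (`DOp_omega`), and the recursion closes up with ω_μ = x ω₀ / w^w
because a(μ) = w. Counting the steps at which each entry is raised gives ℓ_k = c_k (`c_eq_level`).
Homogeneity of F, with u_i of degree 1 and x of degree μ, then gives ∇_{θ∂_θ} ω_k = k ω_k - μ
x∇_{∂_x} ω_k = α_k ω_k + μ τ ω_{k+1}.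

The ω_k are a basis of G. Their span is stable under D, hence under multiplication by u₀ and by the
u_i, so it is everything (`omega_span`). For independence, G is shown to be universal among modules
with an operator D obeying the Leibniz rule in x and a vector e with -D ∏_{i≥1} ∏_{j<w_i} (jθ - w_i
D) e = x e (`exists_linearMap`). The free module with basis e_k and the recursion above is such a
module, and the resulting map sends ω_k to e_k.

On x^p ω_k the operator x∇_{∂_x} is p + c_k up to a multiple of x^p ω_{k+1}. The index p + c_k does
not decrease with k, and ω_μ, a multiple of x ω₀, has index 1 > c_{μ-1}. Hence x∇_{∂_x} - α is
nilpotent on the graded pieces. Uniqueness is a Bézout argument: two such filtrations are comparable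
up to a shift, and generalized eigenvalues of x∇_{∂_x} on different steps are coprime
(`IsKashiwaraMalgrange.le`).

In the graded module [ω_{k+1}] survives next to [ω_k] exactly when c_{k+1} = c_k, which gives Ā₀.
The pairing relies on two facts on c: c_k = 0 exactly for k ≤ n, and c_k + c_l = 1 when k > n and k
+ l = μ + n (`c_symm`). They yield Ā₀* = Ā₀ and A_∞ + A_∞* = n. The Saito and Frobenius type
structures follow formally for any matrices with these two properties and a pairing whose matrix is
supported on the graph of an involution of the indices. -/

theorem coe_map_range {α : Type*} (f : ℕ → α) (m : ℕ) :
    (((List.range m).map f : List α) : Multiset α) = ∑ k ∈ Finset.range m, {f k} := by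
  induction m with
  | zero => simp
  | succ m ih =>
    rw [Finset.sum_range_succ, ← ih, List.range_succ, List.map_append, ← Multiset.coe_add]
    rfl

section Combinatorics

variable {n : ℕ} (w : Fin (n + 1) → ℕ)

/-- The minimal value of `a(k)_i / w_i`. -/
def level (k : ℕ) : ℚ := (a w k (minIndex w (a w k)) : ℚ) / (w (minIndex w (a w k)) : ℚ)

theorem level_le (k : ℕ) (j : Fin (n + 1)) : level w k ≤ (a w k j : ℚ) / (w j : ℚ) := by
  have h : minIndex w (a w k) ∈ minSet w (a w k) := Finset.min'_mem _ _
  simp only [minSet, Finset.mem_filter, Finset.mem_univ, true_and] at h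
  exact h j

theorem a_succ (k : ℕ) : a w (k + 1) = a w k + Pi.single (minIndex w (a w k)) 1 := rfl

theorem sum_a (k : ℕ) : ∑ i, a w k i = k := by
  induction k with
  | zero => simp [a]
  | succ k ih => simp [a_succ, Finset.sum_add_distrib, ih]

theorem level_mono : Monotone (level w) := by
  refine monotone_nat_of_le_succ fun k => (level_le w k (minIndex w (a w (k + 1)))).trans ?_
  rw [level.eq_1 w (k + 1)]
  gcongr
  simp [a_succ]

theorem level_nonneg (k : ℕ) : 0 ≤ level w k := by
  unfold level
  positivity

/-- At step k exactly one entry, the minimal one, goes from j to j + 1, and then the level is j /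
w_i. So the levels of the first K steps are the j / w_i with j < a(K)_i, with multiplicity. The form
with an arbitrary commutative monoid serves for counting, for multisets and for products of
polynomials. -/
theorem prod_level {A : Type*} [CommMonoid A] (f : ℚ → A) (K : ℕ) :
    ∏ k ∈ Finset.range K, f (level w k) =
      ∏ i, ∏ j ∈ Finset.range (a w K i), f ((j : ℚ) / (w i : ℚ)) := by
  induction K with
  | zero => simp [a]
  | succ K ih =>
    rw [Finset.prod_range_succ, ih, ← Finset.mul_prod_erase _ _ (Finset.mem_univ (minIndex w (a w K))),
      ← Finset.mul_prod_erase _ _ (Finset.mem_univ (minIndex w (a w K)))]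
    have h1 : a w (K + 1) (minIndex w (a w K)) = a w K (minIndex w (a w K)) + 1 := by
      simp [a_succ]
    have h2 : ∏ i ∈ Finset.univ.erase (minIndex w (a w K)),
          ∏ j ∈ Finset.range (a w (K + 1) i), f ((j : ℚ) / (w i : ℚ)) =
        ∏ i ∈ Finset.univ.erase (minIndex w (a w K)),
          ∏ j ∈ Finset.range (a w K i), f ((j : ℚ) / (w i : ℚ)) := by
      refine Finset.prod_congr rfl fun i hi => ?_
      have : a w (K + 1) i = a w K i := by simp [a_succ, Finset.ne_of_mem_erase hi]
      rw [this]
    rw [h1, h2, Finset.prod_range_succ, level]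
    exact mul_right_comm _ _ _

variable {w} (hw : ∀ i, 0 < w i)
include hw

/-- If every a(k)_i were at least w_i, the sum k of the entries would be at least μ. -/
theorem level_lt_one {k : ℕ} (hk : k < mu w) : level w k < 1 := by
  by_contra! h
  have : ∑ i, w i ≤ ∑ i, a w k i := Finset.sum_le_sum fun i _ => by
    have h1 := h.trans (level_le w k i)
    rw [one_le_div (by exact_mod_cast hw i)] at h1
    exact_mod_cast h1
  rw [sum_a] at this
  exact absurd this (not_le.mpr hk)

/-- An entry is raised only when a_i / w_i is the minimum, which is below 1 before step μ. -/
theorem a_le {k : ℕ} (hk : k ≤ mu w) (i : Fin (n + 1)) : a w k i ≤ w i := by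
  induction k generalizing i with
  | zero => simp [a]
  | succ k ih =>
    by_cases hi : i = minIndex w (a w k)
    · have h := level_lt_one hw hk
      rw [level, div_lt_one (by exact_mod_cast hw _)] at h
      subst hi
      have h' : a w k (minIndex w (a w k)) < w (minIndex w (a w k)) := by exact_mod_cast h
      simpa [a_succ] using h'
    · simpa [a_succ, hi] using ih (Nat.le_of_succ_le hk) i

theorem a_mu : a w (mu w) = w := by
  have h := (Finset.sum_eq_sum_iff_of_le (s := Finset.univ) (f := a w (mu w)) (g := w)
    fun i _ => a_le hw le_rfl i).mp (by rw [sum_a, mu])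
  exact funext fun i => h i (Finset.mem_univ i)

/-- Both lists are sorted, so it suffices that each f occurs equally often. In the list of levels, f
is counted once for each i such that f = j / w_i with 0 ≤ j < w_i; for f in the set of fractions
this means that w_i f is an integer, so the total is `(intSet w f).card`. -/
theorem cList_eq : cList w = (List.range (mu w)).map (level w) := by
  have hsorted : (cList w).Pairwise (· ≤ ·) := by
    rw [cList, List.pairwise_flatMap]
    refine ⟨fun f _ => List.pairwise_replicate_of_refl, ?_⟩
    have h : (fracSet w).sort.Pairwise (· ≤ ·) := (fracSet w).pairwise_sort (· ≤ ·)
    refine h.imp fun hfg x hx y hy => ?_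
    rw [List.eq_of_mem_replicate hx, List.eq_of_mem_replicate hy]
    exact hfg
  have hsorted' : ((List.range (mu w)).map (level w)).Pairwise (· ≤ ·) := by
    rw [List.pairwise_map]
    exact List.pairwise_lt_range.imp fun h => level_mono w h.le
  refine List.Perm.eq_of_pairwise (fun _ _ _ _ => le_antisymm) hsorted hsorted' ?_
  rw [List.perm_iff_count]
  intro f
  have hR : ((List.range (mu w)).map (level w)).count f =
      ∑ i, ∑ j ∈ Finset.range (w i), if (j : ℚ) / (w i : ℚ) = f then 1 else 0 := by
    -- The indicator of f, written multiplicatively, turns the product formula into a count.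
    have h := prod_level w (fun q => Multiplicative.ofAdd (if q = f then 1 else 0)) (mu w)
    rw [a_mu hw] at h
    have h' : ∑ k ∈ Finset.range (mu w), (if level w k = f then 1 else 0) =
      ∑ i, ∑ j ∈ Finset.range (w i), if (j : ℚ) / (w i : ℚ) = f then 1 else 0 := by
      simpa [← ofAdd_sum] using h
    rw [← h', ← Finset.card_filter, List.count_eq_countP, List.countP_map,
      List.countP_eq_length_filter]
    rfl
  have hrow : ∀ i, (∑ j ∈ Finset.range (w i), if (j : ℚ) / (w i : ℚ) = f then 1 else 0) =
      if f ∈ fracSet w ∧ ((w i : ℚ) * f).den = 1 then 1 else 0 := by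
    intro i
    have hwi : (w i : ℚ) ≠ 0 := by exact_mod_cast (hw i).ne'
    split_ifs with h
    · obtain ⟨hf, hden⟩ := h
      simp only [fracSet, Finset.mem_biUnion, Finset.mem_univ, true_and, Finset.mem_image,
        Finset.mem_range] at hf
      obtain ⟨i', l, hl, rfl⟩ := hf
      have hwi' : (0 : ℚ) < w i' := by exact_mod_cast (Nat.zero_le l).trans_lt hl
      set f : ℚ := (l : ℚ) / w i' with hf
      have hf0 : 0 ≤ f := by positivity
      have hf1 : f < 1 := by rw [hf, div_lt_one hwi']; exact_mod_cast hl
      have hnum := Rat.coe_int_num_of_den_eq_one hden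
      have hwp : (0 : ℚ) < w i := by exact_mod_cast hw i
      -- The only j in the row with j / w_i = f is m = w_i f.
      obtain ⟨m, hm⟩ := Int.eq_ofNat_of_zero_le (a := ((w i : ℚ) * f).num)
        (Rat.num_nonneg.mpr (by positivity))
      rw [hm] at hnum
      have hmf : (m : ℚ) = w i * f := by exact_mod_cast hnum
      have hmw : m < w i := by
        have : (m : ℚ) < w i := by rw [hmf]; nlinarith
        exact_mod_cast this
      rw [Finset.sum_eq_single_of_mem m (Finset.mem_range.mpr hmw)]
      · rw [if_pos]; rw [hmf]; field_simp
      · intro j _ hj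
        rw [if_neg]
        rintro h
        apply hj
        have : (j : ℚ) = m := by rw [hmf, ← h]; field_simp
        exact_mod_cast this
    · refine Finset.sum_eq_zero fun j hj => if_neg ?_
      rintro rfl
      refine h ⟨?_, ?_⟩
      · simp only [fracSet, Finset.mem_biUnion, Finset.mem_univ, true_and, Finset.mem_image]
        exact ⟨i, j, hj, rfl⟩
      · rw [mul_div_cancel₀ _ hwi]
        exact Rat.den_natCast j
  rw [hR, Finset.sum_congr rfl fun i _ => hrow i, cList, List.count_flatMap]
  have hcount : (List.count f ∘ fun g => List.replicate (intSet w g).card g) =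
      fun g => if g = f then (intSet w f).card else 0 := by
    funext g
    simp only [Function.comp, List.count_replicate, beq_iff_eq]
    split_ifs with h
    · rw [h]
    · rfl
  rw [hcount, ← Multiset.sum_coe, ← Multiset.map_coe, Finset.sort_eq]
  change ∑ g ∈ fracSet w, _ = _
  rw [Finset.sum_ite_eq']
  by_cases hf : f ∈ fracSet w
  · simp [hf, intSet]
  · simp [hf]

theorem c_eq_level {k : ℕ} (hk : k < mu w) : c w k = level w k := by
  rw [c, cList_eq hw, List.getD_eq_getElem _ _ (by simpa using hk)]
  simp

theorem c_mono {k l : ℕ} (hkl : k ≤ l) (hl : l < mu w) : c w k ≤ c w l := by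
  rw [c_eq_level hw (hkl.trans_lt hl), c_eq_level hw hl]
  exact level_mono w hkl

/-- A positive level makes all n + 1 entries of a(k) at least 1, so that k ≥ n + 1. -/
theorem c_eq_zero {k : ℕ} (hk : k < mu w) (hkn : k ≤ n) : c w k = 0 := by
  rw [c_eq_level hw hk]
  by_contra h
  have h0 : 0 < level w k := lt_of_le_of_ne (level_nonneg w k) (Ne.symm h)
  have : ∑ _i : Fin (n + 1), 1 ≤ ∑ i, a w k i := Finset.sum_le_sum fun i _ => by
    have h1 := h0.trans_le (level_le w k i)
    rw [Nat.one_le_iff_ne_zero]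
    rintro h2
    simp [h2] at h1
  rw [sum_a] at this
  simp at this
  omega

/-- As long as the level is 0 only zero entries are raised, so all entries are at most 1; one of
them is still 0, hence k ≤ n. -/
theorem c_pos {k : ℕ} (hk : k < mu w) (hkn : n < k) : 0 < c w k := by
  rw [c_eq_level hw hk]
  by_contra h
  have h0 : level w k = 0 := le_antisymm (not_lt.mp h) (level_nonneg w k)
  have hz : ∀ k, level w k = 0 → a w k (minIndex w (a w k)) = 0 := fun k h => by
    rw [level, div_eq_zero_iff] at h
    rcases h with h | h
    · exact_mod_cast h
    · exact absurd h (by exact_mod_cast (hw _).ne')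
  have h1 : ∀ k' ≤ k, ∀ i, a w k' i ≤ 1 := by
    intro k'
    induction k' with
    | zero => intro _ i; simp [a]
    | succ k' ih =>
      intro hk' i
      by_cases hi : i = minIndex w (a w k')
      · have := hz k' (le_antisymm (h0 ▸ level_mono w (by omega)) (level_nonneg w k'))
        subst hi
        simp [a_succ, this]
      · simpa [a_succ, hi] using ih (by omega) i
  have h2 : ∑ i, a w k i < ∑ _i : Fin (n + 1), 1 :=
    Finset.sum_lt_sum (fun i _ => h1 k le_rfl i)
      ⟨_, Finset.mem_univ _, by rw [hz k h0]; exact one_pos⟩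
  rw [sum_a] at h2
  simp at h2
  omega

theorem n_lt_mu : n < mu w := by
  have : ∑ _i : Fin (n + 1), 1 ≤ ∑ i, w i := Finset.sum_le_sum fun i _ => hw i
  simp at this
  exact this

theorem prod_c {A : Type*} [CommMonoid A] (f : ℚ → A) :
    ∏ k ∈ Finset.range (mu w), f (c w k) =
      ∏ i, ∏ j ∈ Finset.range (w i), f ((j : ℚ) / (w i : ℚ)) := by
  have h := prod_level w f (mu w)
  rw [a_mu hw] at h
  rw [← h]
  exact Finset.prod_congr rfl fun k hk => by rw [c_eq_level hw (Finset.mem_range.mp hk)]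

/-- The values c_{n+1}, …, c_{μ-1} are the j / w_i with 1 ≤ j < w_i, a multiset stable under f ↦ 1 -
f. A sorted list is determined by its multiset, so this list equals its own reflection read
backwards, and entries are compared. -/
theorem c_symm {k l : ℕ} (hk : k < mu w) (hkn : n < k) (hkl : k + l = mu w + n) :
    c w k + c w l = 1 := by
  set L : List ℚ := (List.range (mu w - (n + 1))).map fun t => c w (n + 1 + t) with hL
  have hLs : L.Pairwise (· ≤ ·) := by
    rw [hL, List.pairwise_map]
    refine List.pairwise_lt_range.imp_of_mem fun {s t} hs ht h => c_mono hw (by omega) ?_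
    have := List.mem_range.mp ht
    omega
  have hRs : ((L.map (1 - ·)).reverse).Pairwise (· ≤ ·) := by
    rw [List.pairwise_reverse, List.pairwise_map]
    exact hLs.imp fun h => by linarith
  have key : ∀ g : ℚ → ℚ, ((L.map g : List ℚ) : Multiset ℚ) =
      ∑ i, ∑ j ∈ Finset.range (w i - 1), {g (((j + 1 : ℕ) : ℚ) / (w i : ℚ))} := by
    intro g
    -- Sending the value 0 to the empty multiset discards the indices k ≤ n on one side and the
    -- terms j = 0 on the other.
    have h := prod_c hw (fun q => Multiplicative.ofAdd (if q = 0 then (0 : Multiset ℚ) else {g q}))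
    have h' : ∑ k ∈ Finset.range (mu w), (if c w k = 0 then (0 : Multiset ℚ) else {g (c w k)}) =
        ∑ i, ∑ j ∈ Finset.range (w i),
          if (j : ℚ) / (w i : ℚ) = 0 then (0 : Multiset ℚ) else {g ((j : ℚ) / (w i : ℚ))} := by
      apply Multiplicative.ofAdd.injective
      simpa only [ofAdd_sum] using h
    have hn := n_lt_mu hw
    have h1 : ∑ k ∈ Finset.range (mu w), (if c w k = 0 then (0 : Multiset ℚ) else {g (c w k)}) =
        ((L.map g : List ℚ) : Multiset ℚ) := by
      have hmu : mu w = (n + 1) + (mu w - (n + 1)) := by omega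
      rw [hmu, Finset.sum_range_add, Finset.sum_eq_zero, zero_add]
      · rw [hL, List.map_map, coe_map_range]
        refine Finset.sum_congr rfl fun k hk => if_neg ?_
        have := Finset.mem_range.mp hk
        exact (c_pos hw (by omega) (by omega)).ne'
      · intro k hk
        rw [if_pos (c_eq_zero hw (by have := Finset.mem_range.mp hk; omega)
          (by have := Finset.mem_range.mp hk; omega))]
    rw [← h1, h']
    refine Finset.sum_congr rfl fun i _ => ?_
    have hwi : w i = (w i - 1) + 1 := by have := hw i; omega
    conv_lhs => rw [hwi]
    rw [Finset.sum_range_succ']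
    simp only [Nat.cast_zero, zero_div, if_true, add_zero]
    rw [← hwi]
    refine Finset.sum_congr rfl fun j _ => if_neg ?_
    have : (w i : ℚ) ≠ 0 := by exact_mod_cast (hw i).ne'
    positivity
  have hperm : L.Perm (L.map (1 - ·)).reverse := by
    refine List.Perm.trans ?_ (List.reverse_perm _).symm
    rw [← Multiset.coe_eq_coe]
    have h1 := key id
    rw [List.map_id] at h1
    rw [h1, key]
    refine Finset.sum_congr rfl fun i _ => ?_
    -- This is the substitution of w_i - j for j in each row.
    rw [← Finset.sum_range_reflect]
    refine Finset.sum_congr rfl fun j hj => ?_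
    have hj' := Finset.mem_range.mp hj
    have : (w i : ℚ) ≠ 0 := by exact_mod_cast (hw i).ne'
    have h2 : ((w i - 1 - 1 - j + 1 : ℕ) : ℚ) = w i - (j + 1) := by
      have : w i - 1 - 1 - j + 1 + (j + 1) = w i := by omega
      rw [eq_sub_iff_add_eq]
      exact_mod_cast this
    rw [id, h2]
    congr 1
    push_cast
    field_simp
  have heq := List.Perm.eq_of_pairwise (fun _ _ _ _ => le_antisymm) hLs hRs hperm
  have hlen : L.length = mu w - (n + 1) := by simp [hL]
  have ht : k - (n + 1) < L.length := by omega
  have h3 : L[k - (n + 1)]'ht = ((L.map (1 - ·)).reverse)[k - (n + 1)]'(by simpa using ht) := by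
    congr 1
  rw [List.getElem_reverse] at h3
  simp only [hL, List.getElem_map, List.getElem_range, List.length_map, List.length_range] at h3
  have e1 : n + 1 + (k - (n + 1)) = k := by omega
  have e2 : n + 1 + (mu w - (n + 1) - 1 - (k - (n + 1))) = l := by omega
  rw [e1, e2] at h3
  rw [h3]
  ring

end Combinatorics

/-! ### Generators and relations of the Gauss–Manin system -/

section Relations

variable {n : ℕ} (w : Fin (n + 1) → ℕ)

/-- The class in `G` of `g du₁/u₁ ∧ ⋯ ∧ duₙ/uₙ`. -/
def classOf : Fun n →ₗ[CXTheta] GaussManin w where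
  toFun g := GaussManin.mk w (topForm g)
  map_add' g h := by
    rw [← map_add]
    congr 1
    exact Subtype.ext (Pi.single_add _ _ _)
  map_smul' r g := by
    rw [RingHom.id_apply, ← map_smul]
    congr 1
    exact Subtype.ext (Pi.single_smul _ _ _)

theorem eq_topForm (η : Omega n n) : η = topForm (η.1 Finset.univ) := by
  refine Subtype.ext (funext fun J => ?_)
  by_cases hJ : J = Finset.univ
  · subst hJ; simp [topForm]
  · rw [η.2 J (by rwa [Ne, ← Finset.card_eq_iff_eq_univ, Fintype.card_fin] at *)]
    simp [topForm, Pi.single_eq_of_ne hJ]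

theorem classOf_surjective : Function.Surjective (classOf w) := by
  intro g
  obtain ⟨η, rfl⟩ := Submodule.mkQ_surjective (boundaries w) g
  exact ⟨η.1 Finset.univ, congrArg (GaussManin.mk w) (eq_topForm η).symm⟩

/-- This is the twisted differential of ±g times the product of all du_j/u_j with j ≠ i; only the
index i contributes to its top coefficient, and the sign is chosen to cancel `formSign`. -/
theorem classOf_boundary (hn : 0 < n) (i : Fin n) (g : Fun n) :
    classOf w (uDer i g - tau • (uDer i (F w) * g)) = 0 := by
  classical
  let ξ : Forms n := Pi.single (Finset.univ.erase i) (formSign i Finset.univ • g)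
  have hcard : (Finset.univ.erase i).card = n - 1 := by simp
  refine (Submodule.Quotient.mk_eq_zero _).mpr ⟨ξ, ?_, ?_⟩
  · intro J hJ
    refine Pi.single_eq_of_ne ?_ _
    rintro rfl
    exact hJ hcard
  · funext J
    change ∑ j ∈ J, formSign j J • (uDer j (ξ (J.erase j)) - tau • (uDer j (F w) * ξ (J.erase j))) =
      (Pi.single Finset.univ (uDer i g - tau • (uDer i (F w) * g)) : Forms n) J
    by_cases hJ : J = Finset.univ
    · subst hJ
      rw [Pi.single_eq_same, Finset.sum_eq_single_of_mem i (Finset.mem_univ i)]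
      · have h1 : ξ (Finset.univ.erase i) = formSign i Finset.univ • g := Pi.single_eq_same _ _
        have h2 : formSign i Finset.univ * formSign i Finset.univ = 1 := by
          rw [formSign, ← mul_pow]; simp
        rw [h1, map_zsmul, mul_smul_comm, smul_comm tau, ← smul_sub, smul_smul, h2, one_smul]
      · intro j _ hj
        have h1 : ξ (Finset.univ.erase j) = 0 := Pi.single_eq_of_ne (fun h => hj (by
          have := Finset.notMem_erase j (Finset.univ : Finset (Fin n))
          rw [h] at this
          simpa using this)) _
        rw [h1]
        simp
    · rw [Pi.single_eq_of_ne hJ]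
      refine Finset.sum_eq_zero fun j hj => ?_
      have h1 : ξ (J.erase j) = 0 := Pi.single_eq_of_ne (fun h => hJ (by
        rw [← Finset.card_eq_iff_eq_univ, Fintype.card_fin]
        have h2 := Finset.card_erase_of_mem hj
        rw [h, hcard] at h2
        have := Finset.card_pos.mpr ⟨j, hj⟩
        omega)) _
      rw [h1]
      simp

/-- The linear map on `G` induced by a linear map on functions that vanishes on the relations. -/
def liftOf {M : Type*} [AddCommGroup M] [Module CXTheta M] (Ψ : Fun n →ₗ[CXTheta] M)
    (hΨ : ∀ i g, Ψ (uDer i g - tau • (uDer i (F w) * g)) = 0) : GaussManin w →ₗ[CXTheta] M :=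
  (boundaries w).liftQ (Ψ ∘ₗ LinearMap.proj Finset.univ ∘ₗ (Omega n n).subtype) (by
    rintro η ⟨ξ, -, hη⟩
    have h : η.1 Finset.univ = ∑ i, formSign i Finset.univ •
      (uDer i (ξ (Finset.univ.erase i)) - tau • (uDer i (F w) * ξ (Finset.univ.erase i))) :=
      (congrFun hη Finset.univ).symm
    change Ψ (η.1 Finset.univ) = 0
    rw [h, map_sum]
    exact Finset.sum_eq_zero fun i _ => by rw [map_zsmul, hΨ, smul_zero])

theorem liftOf_classOf {M : Type*} [AddCommGroup M] [Module CXTheta M] (Ψ : Fun n →ₗ[CXTheta] M)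
    (hΨ : ∀ i g, Ψ (uDer i g - tau • (uDer i (F w) * g)) = 0) (g : Fun n) :
    liftOf w Ψ hΨ (classOf w g) = Ψ g := by
  change Ψ ((Pi.single Finset.univ g : Forms n) Finset.univ) = _
  rw [Pi.single_eq_same]

theorem descend_classOf (δ : Derivation ℂ (Fun n) (Fun n)) (g : Fun n)
    (h : ∀ η, twistedD w (twist δ g η) = twist δ g (twistedD w η)) (f : Fun n) :
    descend w δ g h (classOf w f) = classOf w (δ f - g * f) := by
  change GaussManin.mk w _ = GaussManin.mk w _
  congr 1
  refine Subtype.ext (funext fun J => ?_)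
  change δ ((Pi.single Finset.univ f : Forms n) J) - g * (Pi.single Finset.univ f : Forms n) J =
    (Pi.single Finset.univ (δ f - g * f) : Forms n) J
  by_cases hJ : J = Finset.univ
  · subst hJ; simp
  · simp [Pi.single_eq_of_ne hJ]

theorem nablaXEuler_classOf (f : Fun n) : nablaXEuler w (classOf w f) =
    classOf w (monDer xDer 0 f - tau • (monDer xDer 0 (F w) * f)) := by
  have hX : ∀ h : Fun n, xVar • dX n h = monDer xDer 0 h := fun h => by
    rw [dX, Derivation.smul_apply, Algebra.smul_def, smul_eq_mul, ← mul_assoc, ← map_mul, xVar,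
      ← LaurentPolynomial.T_add, add_neg_cancel, LaurentPolynomial.T_zero, map_one, one_mul]
  rw [nablaXEuler, nablaX, descend_classOf, ← map_smul, smul_sub, hX, smul_mul_assoc,
    smul_comm xVar tau, ← smul_mul_assoc, hX]

theorem tau_mul_theta : tau * theta = 1 := by
  rw [tau, theta, ← LaurentPolynomial.T_add]; simp

theorem theta_mul_tau : theta * tau = 1 := by rw [mul_comm, tau_mul_theta]

theorem nablaThetaEuler_classOf (f : Fun n) : nablaThetaEuler w (classOf w f) =
    classOf w (monDer thetaDerX 0 f + tau • (F w * f)) := by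
  have hθ : ∀ h : Fun n, tau • dTau n h = - monDer thetaDerX 0 h := fun h => by
    rw [dTau, Derivation.smul_apply, Algebra.smul_def, smul_eq_mul, ← mul_assoc, ← map_mul,
      mul_neg, tau_mul_theta, map_neg, map_one, neg_one_mul]
  have hs : ∀ (r : CTheta) (f : Fun n), r • classOf w f = classOf w (r • f) := fun r f =>
    ((classOf w).map_smul_of_tower r f).symm
  rw [nablaThetaEuler, nablaTau, descend_classOf, hs, ← map_neg, smul_sub, hθ]
  congr 1
  abel

theorem nablaXEuler_smul (r : CXTheta) (g : GaussManin w) :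
    nablaXEuler w (r • g) = xDer r • g + r • nablaXEuler w g := by
  obtain ⟨f, rfl⟩ := classOf_surjective w g
  rw [← map_smul, nablaXEuler_classOf, nablaXEuler_classOf, ← map_smul, ← map_smul, ← map_add]
  congr 1
  rw [Algebra.smul_def r f, Derivation.leibniz, monDer_algebraMap, smul_eq_mul, smul_eq_mul,
    Algebra.smul_def (xDer r), Algebra.smul_def r, Algebra.smul_def tau, Algebra.smul_def tau]
  ring

theorem nablaThetaEuler_smul (r : CXTheta) (g : GaussManin w) :
    nablaThetaEuler w (r • g) = thetaDerX r • g + r • nablaThetaEuler w g := by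
  obtain ⟨f, rfl⟩ := classOf_surjective w g
  rw [← map_smul, nablaThetaEuler_classOf, nablaThetaEuler_classOf, ← map_smul, ← map_smul,
    ← map_add]
  congr 1
  rw [Algebra.smul_def r f, Derivation.leibniz, monDer_algebraMap, smul_eq_mul, smul_eq_mul,
    Algebra.smul_def (thetaDerX r), Algebra.smul_def r, Algebra.smul_def tau, Algebra.smul_def tau]
  ring

theorem xDer_algebraMap (r : CTheta) : xDer (algebraMap CTheta CXTheta r) = 0 := by
  have h' : algebraMap CTheta CXTheta r = AddMonoidAlgebra.single 0 r := rfl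
  rw [h', xDer, monDer_single]
  simp

theorem thetaDerX_algebraMap (r : CTheta) :
    thetaDerX (algebraMap CTheta CXTheta r) = algebraMap CTheta CXTheta (thetaDer r) := by
  have h' : ∀ r, algebraMap CTheta CXTheta r = AddMonoidAlgebra.single 0 r := fun _ => rfl
  rw [h', h', thetaDerX, monDer_single]
  simp

theorem xDer_T (p : ℤ) : xDer (LaurentPolynomial.T p) = p • LaurentPolynomial.T p := by
  rw [LaurentPolynomial.T, xDer, monDer_single]
  simp

theorem thetaDerX_T (p : ℤ) : thetaDerX (LaurentPolynomial.T p) = 0 := by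
  rw [LaurentPolynomial.T, thetaDerX, monDer_single]
  simp

theorem thetaDer_T (p : ℤ) : thetaDer (LaurentPolynomial.T p) = p • LaurentPolynomial.T p := by
  rw [LaurentPolynomial.T, thetaDer, monDer_single]
  simp

theorem nablaXEuler_smul_theta (r : CTheta) (g : GaussManin w) :
    nablaXEuler w (r • g) = r • nablaXEuler w g := by
  rw [← algebraMap_smul CXTheta r g, nablaXEuler_smul, xDer_algebraMap, zero_smul, zero_add,
    algebraMap_smul]

theorem nablaThetaEuler_smul_theta (r : CTheta) (g : GaussManin w) :
    nablaThetaEuler w (r • g) = thetaDer r • g + r • nablaThetaEuler w g := by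
  rw [← algebraMap_smul CXTheta r g, nablaThetaEuler_smul, thetaDerX_algebraMap,
    algebraMap_smul, algebraMap_smul]

theorem nablaXEuler_add (g h : GaussManin w) :
    nablaXEuler w (g + h) = nablaXEuler w g + nablaXEuler w h := by
  rw [nablaXEuler, map_add, smul_add]; rfl

theorem nablaThetaEuler_add (g h : GaussManin w) :
    nablaThetaEuler w (g + h) = nablaThetaEuler w g + nablaThetaEuler w h := by
  rw [nablaThetaEuler, map_add, smul_add, neg_add]; rfl

/-- `θ x ∇_{∂_x}`, which is linear over `ℂ[θ, θ⁻¹]`. -/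
def DOp : GaussManin w →ₗ[CTheta] GaussManin w where
  toFun g := theta • nablaXEuler w g
  map_add' g h := by rw [nablaXEuler_add, smul_add]
  map_smul' r g := by rw [nablaXEuler_smul_theta, RingHom.id_apply, smul_comm]

theorem DOp_apply (g : GaussManin w) : DOp w g = theta • nablaXEuler w g := rfl

theorem DOp_smul (r : CXTheta) (g : GaussManin w) :
    DOp w (r • g) = (theta • xDer r) • g + r • DOp w g := by
  rw [DOp_apply, nablaXEuler_smul, smul_add, DOp_apply, smul_assoc, smul_comm theta r]

theorem nablaXEuler_eq (g : GaussManin w) : nablaXEuler w g = tau • DOp w g := by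
  rw [DOp_apply, smul_smul, tau_mul_theta, one_smul]

/-- The class in `G` of `u^m du₁/u₁ ∧ ⋯ ∧ duₙ/uₙ`. -/
def mon (m : Fin n → ℤ) : GaussManin w := classOf w (uMon m)

/-- The vector `(w₁, …, wₙ)`. -/
def wvec : Fin n → ℤ := fun i => w i.succ

theorem u0_eq : u0 w = uMon (-wvec w) := rfl

theorem uMon_mul (m m' : Fin n → ℤ) : uMon m * uMon m' = uMon (m + m') := by
  rw [uMon, uMon, AddMonoidAlgebra.single_mul_single, mul_one]; rfl

theorem uDer_uMon (i : Fin n) (m : Fin n → ℤ) : uDer i (uMon m) = m i • uMon m := by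
  rw [uMon, uDer, monDer_single]
  simp

theorem uDer_F (i : Fin n) :
    uDer i (F w) = uMon (Pi.single i 1) - w i.succ • xVar • u0 w := by
  rw [F, map_add, map_sum, uDer_smul, u0_eq, uDer_uMon,
    Finset.sum_eq_single_of_mem i (Finset.mem_univ i), uDer_uMon]
  · rw [sub_eq_add_neg]
    simp only [Pi.single_eq_same, one_smul, Pi.neg_apply, wvec, neg_smul, smul_neg, natCast_zsmul]
    rw [smul_comm]
  · intro j _ hj
    rw [uDer_uMon, Pi.single_eq_of_ne (Ne.symm hj), zero_smul]

theorem smul_classOf (r : CTheta) (f : Fun n) : r • classOf w f = classOf w (r • f) :=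
  ((classOf w).map_smul_of_tower r f).symm

theorem relation_uMon (i : Fin n) (m : Fin n → ℤ) :
    uDer i (uMon m) - tau • (uDer i (F w) * uMon m) =
      m i • uMon m - tau • (uMon (m + Pi.single i 1) -
        w i.succ • xVar • uMon (m - wvec w)) := by
  rw [uDer_uMon, uDer_F, sub_mul, uMon_mul, smul_mul_assoc, smul_mul_assoc, u0_eq, uMon_mul,
    add_comm m, neg_add_eq_sub]

theorem theta_smul_tau_smul {M : Type*} [AddCommGroup M] [Module CTheta M] (g : M) :
    theta • tau • g = g := by
  rw [smul_smul, theta_mul_tau, one_smul]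

theorem tau_smul_theta_smul {M : Type*} [AddCommGroup M] [Module CTheta M] (g : M) :
    tau • theta • g = g := by
  rw [smul_smul, tau_mul_theta, one_smul]

theorem mon_add_single (hn : 0 < n) (i : Fin n) (m : Fin n → ℤ) :
    mon w (m + Pi.single i 1) = w i.succ • xVar • mon w (m - wvec w) + m i • theta • mon w m := by
  have h := classOf_boundary w hn i (uMon m)
  rw [relation_uMon, map_sub, ← smul_classOf, map_sub, map_zsmul, map_nsmul, map_smul] at h
  have h' := congrArg (theta • ·) h
  simp only [smul_sub, theta_smul_tau_smul, smul_zero] at h'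
  rw [smul_comm theta] at h'
  change _ - (mon w _ - w i.succ • xVar • mon w (m - wvec w)) = 0 at h'
  rw [sub_eq_zero, eq_sub_iff_add_eq'] at h'
  exact h'.symm

theorem monDer_xDer_F : monDer xDer 0 (F w) = xVar • u0 w := by
  rw [F, map_add, map_sum, Algebra.smul_def, Derivation.leibniz, monDer_algebraMap, u0,
    monDer_uMon, xVar, xDer_T]
  simp [monDer_uMon, mul_comm]

/-- A monomial u^m does not involve x, so only the term -τ x (∂F/∂x) = -τ x u₀ of the connection
acts. -/
theorem DOp_mon (m : Fin n → ℤ) : DOp w (mon w m) = -(xVar • mon w (m - wvec w)) := by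
  rw [DOp_apply, mon, nablaXEuler_classOf, monDer_uMon, zero_sub, map_neg, ← smul_classOf, smul_neg,
    theta_smul_tau_smul, monDer_xDer_F, smul_mul_assoc, map_smul, u0_eq, uMon_mul, neg_add_eq_sub]
  rfl

theorem mon_sub_wvec (m : Fin n → ℤ) :
    mon w (m - wvec w) = -((LaurentPolynomial.T (-1) : CXTheta) • DOp w (mon w m)) := by
  rw [DOp_mon, smul_neg, neg_neg, smul_smul, xVar, ← LaurentPolynomial.T_add]
  simp

theorem mon_add_single' (hn : 0 < n) (i : Fin n) (m : Fin n → ℤ) :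
    mon w (m + Pi.single i 1) =
      -(w i.succ • DOp w (mon w m)) + m i • theta • mon w m := by
  rw [mon_add_single w hn, DOp_mon, smul_neg, neg_neg]

theorem tau_smul_sum {ι M : Type*} [Fintype ι] [AddCommGroup M] [Module CTheta M] (v : ι → ℕ)
    (m : ι → ℤ) (g h : M) : tau • (∑ i, (-(v i • g) + m i • theta • h) + -g) =
      -((1 + ∑ i, v i) • tau • g) + (∑ i, m i) • h := by
  rw [Finset.sum_add_distrib, Finset.sum_neg_distrib, ← Finset.sum_smul, ← Finset.sum_smul,
    smul_add, smul_add, smul_neg, smul_neg, smul_comm tau, smul_comm tau (∑ i, m i),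
    tau_smul_theta_smul, add_smul, one_smul]
  abel

/-- The class of F u^m is a sum of the classes of u_i u^m and of x u₀ u^m. Each of them is expressed
through D, and the coefficients of D add up to 1 + w_1 + ⋯ + w_n = μ. -/
theorem nablaThetaEuler_mon (hn : 0 < n) (hw₀ : w 0 = 1) (m : Fin n → ℤ) :
    nablaThetaEuler w (mon w m) = -(mu w • tau • DOp w (mon w m)) + (∑ i, m i) • mon w m := by
  rw [mon, nablaThetaEuler_classOf, monDer_uMon, zero_add, ← smul_classOf, F, add_mul,
    Finset.sum_mul, map_add, map_sum, smul_mul_assoc, map_smul, u0_eq, uMon_mul, neg_add_eq_sub]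
  have h1 : ∀ i, classOf w (uMon (Pi.single i 1) * uMon m) =
      -(w i.succ • DOp w (mon w m)) + m i • theta • mon w m := fun i => by
    rw [uMon_mul, add_comm, ← mon_add_single' w hn]; rfl
  have h2 : xVar • classOf w (uMon (m - wvec w)) = - DOp w (mon w m) := by rw [DOp_mon, neg_neg]; rfl
  rw [Finset.sum_congr rfl fun i _ => h1 i, h2, tau_smul_sum, mu, Fin.sum_univ_succ, hw₀]
  rfl

end Relations

/-! ### The action of the connection on the sections `ω_k` -/

section OmegaAction

variable {n : ℕ} (w : Fin (n + 1) → ℕ)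

/-- The exponent of `u` in `ω_k`. -/
def expo (k : ℕ) : Fin n → ℤ := fun i => (a w k i.succ : ℤ) - a w k 0 * w i.succ

theorem uMon_pow (m : Fin n → ℤ) (k : ℕ) : uMon m ^ k = uMon (k • m) := by
  induction k with
  | zero => rw [pow_zero, zero_smul]; rfl
  | succ k ih => rw [pow_succ, ih, uMon_mul, succ_nsmul]

theorem prod_uMon {ι : Type*} (s : Finset ι) (m : ι → Fin n → ℤ) :
    ∏ i ∈ s, uMon (m i) = uMon (∑ i ∈ s, m i) := by
  classical
  induction s using Finset.induction_on with
  | empty => simp; rfl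
  | insert i s hi ih => rw [Finset.prod_insert hi, ih, uMon_mul, Finset.sum_insert hi]

theorem T_pow_smul (k : ℕ) : xVar ^ k = LaurentPolynomial.T (k : ℤ) := by
  rw [xVar, LaurentPolynomial.T_pow, mul_one]

theorem omega_eq (k : ℕ) : omega w k = (∏ i, (w i : ℂ) ^ a w k i)⁻¹ •
    (LaurentPolynomial.T (a w k 0 : ℤ) : CXTheta) • mon w (expo w k) := by
  have h : (xVar • u0 w) ^ a w k 0 * ∏ i : Fin n, uMon (Pi.single i 1) ^ a w k i.succ =
      (LaurentPolynomial.T (a w k 0 : ℤ) : CXTheta) • uMon (expo w k) := by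
    rw [smul_pow, T_pow_smul, smul_mul_assoc, u0_eq, uMon_pow,
      Finset.prod_congr rfl fun i _ => uMon_pow _ _, prod_uMon, uMon_mul]
    congr 2
    funext i
    simp [expo, wvec, Finset.sum_apply, Pi.single_apply]
    ring
  rw [omega, h]
  change classOf w _ = _
  rw [mon, ← map_smul]
  exact (classOf w).map_smul_of_tower _ _

theorem omega_zero : omega w 0 = mon w 0 := by
  rw [omega_eq]
  have : expo w 0 = 0 := by funext i; simp [expo, a]
  rw [this]
  simp [a, LaurentPolynomial.T_zero]

variable {w}

/-- Since a(μ) = w, the monomial is x u₀ u_1^{w_1} ⋯ u_n^{w_n} = x. -/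
theorem omega_mu (hw : ∀ i, 0 < w i) (hw₀ : w 0 = 1) :
    omega w (mu w) = (∏ i, (w i : ℂ) ^ w i)⁻¹ • xVar • omega w 0 := by
  rw [omega_eq, a_mu hw, omega_zero, hw₀]
  have : expo w (mu w) = 0 := by funext i; simp [expo, a_mu hw, hw₀]
  rw [this]
  rfl

theorem DOp_smul_mon (p : ℤ) (m : Fin n → ℤ) :
    DOp w ((LaurentPolynomial.T p : CXTheta) • mon w m) =
      (p : ℂ) • theta • (LaurentPolynomial.T p : CXTheta) • mon w m +
        (LaurentPolynomial.T p : CXTheta) • DOp w (mon w m) := by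
  rw [DOp_smul, xDer_T, Int.cast_smul_eq_zsmul, smul_assoc, smul_assoc, smul_comm theta p]

theorem T_smul_mon_succ (hn : 0 < n) (p : ℤ) (m : Fin n → ℤ) (i : Fin n) :
    (LaurentPolynomial.T p : CXTheta) • mon w (m + Pi.single i 1) =
      -((w i.succ : ℂ) • (LaurentPolynomial.T p : CXTheta) • DOp w (mon w m)) +
        (m i : ℂ) • theta • (LaurentPolynomial.T p : CXTheta) • mon w m := by
  rw [mon_add_single' w hn, smul_add, smul_neg, Nat.cast_smul_eq_nsmul, Int.cast_smul_eq_zsmul,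
    smul_comm _ (w i.succ), smul_comm _ (m i), smul_comm theta]

/-- If i(k) = 0, then ω_{k+1} comes from ω_k by multiplication by x u₀; otherwise by u_i / w_i with
i = i(k). Both act as `level w k` · θ - D: the Leibniz term a(k)₀ θ of the power of x is the level
in the first case, and in the second it completes the exponent of u_i to a(k)_i. -/
theorem DOp_omega (hn : 0 < n) (hw : ∀ i, 0 < w i) (hw₀ : w 0 = 1) (k : ℕ) :
    DOp w (omega w k) = ((level w k : ℚ) : ℂ) • theta • omega w k - omega w (k + 1) := by
  rw [omega_eq w k, omega_eq w (k + 1), LinearMap.map_smul_of_tower, DOp_smul_mon]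
  rcases Fin.eq_zero_or_eq_succ (minIndex w (a w k)) with h0 | ⟨i, hi⟩
  · have ha0 : a w (k + 1) 0 = a w k 0 + 1 := by simp [a_succ, h0]
    have haS : ∀ j : Fin n, a w (k + 1) j.succ = a w k j.succ := fun j => by
      simp [a_succ, h0]
    have hm : expo w (k + 1) = expo w k - wvec w := by
      funext j
      simp only [expo, ha0, haS, wvec, Pi.sub_apply]
      push_cast
      ring
    have hκ : ∏ i, (w i : ℂ) ^ a w (k + 1) i = ∏ i, (w i : ℂ) ^ a w k i := by
      rw [Fin.prod_univ_succ, Fin.prod_univ_succ, hw₀]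
      simp [haS]
    have hl : level w k = a w k 0 := by rw [level, h0, hw₀]; simp
    rw [hm, hκ, ha0, hl, DOp_mon, smul_neg, smul_smul _ xVar, xVar, ← LaurentPolynomial.T_add]
    push_cast
    module
  · have ha0 : a w (k + 1) 0 = a w k 0 := by simp [a_succ, hi]
    have hm : expo w (k + 1) = expo w k + Pi.single i 1 := by
      funext j
      simp only [expo, ha0, Pi.add_apply, a_succ, hi, Pi.single_apply, Fin.succ_inj]
      push_cast
      ring
    have hwi : (w i.succ : ℂ) ≠ 0 := by exact_mod_cast (hw _).ne'
    have hκ : ∏ j, (w j : ℂ) ^ a w (k + 1) j = (∏ j, (w j : ℂ) ^ a w k j) * w i.succ := by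
      rw [← hi, a_succ]
      simp only [Pi.add_apply, pow_add, Finset.prod_mul_distrib]
      congr 1
      rw [Finset.prod_eq_single_of_mem _ (Finset.mem_univ (minIndex w (a w k)))]
      · simp
      · intro j _ hj
        simp [hj]
    have hl : ((level w k : ℚ) : ℂ) = (a w k i.succ : ℂ) / w i.succ := by
      rw [level, hi]; push_cast; rfl
    rw [hm, hκ, ha0, hl, T_smul_mon_succ hn, mul_inv]
    have he : ((expo w k i : ℤ) : ℂ) = a w k i.succ - a w k 0 * w i.succ := by
      rw [expo]; push_cast; rfl
    rw [he, smul_comm theta (_ : ℂ)]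
    generalize theta • (LaurentPolynomial.T _ : CXTheta) • mon w _ = Y
    generalize (LaurentPolynomial.T _ : CXTheta) • DOp w _ = Z
    match_scalars
    · field_simp
      ring
    · field_simp

theorem nablaThetaEuler_smul_complex (z : ℂ) (g : GaussManin w) :
    nablaThetaEuler w (z • g) = z • nablaThetaEuler w g := by
  rw [nablaThetaEuler, map_smul, nablaThetaEuler, smul_neg, smul_comm]

/-- This is the Euler relation for the grading with u_i of degree 1 and x of degree μ: F has degree
1, and the monomial of ω_k has degree ∑ a(k)_i = k. -/
theorem nablaThetaEuler_omega (hn : 0 < n) (hw₀ : w 0 = 1) (k : ℕ) :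
    nablaThetaEuler w (omega w k) =
      (k : ℂ) • omega w k - (mu w : ℂ) • tau • DOp w (omega w k) := by
  have hs : ((∑ i, expo w k i : ℤ) : ℂ) = k - mu w * a w k 0 := by
    have h1 := sum_a w k
    have h2 : mu w = ∑ i, w i := rfl
    rw [Fin.sum_univ_succ] at h1 h2
    have h3 : (k : ℂ) = a w k 0 + ∑ i : Fin n, (a w k i.succ : ℂ) := by exact_mod_cast h1.symm
    rw [h2, hw₀, h3]
    simp only [expo, Finset.sum_sub_distrib, ← Finset.mul_sum]
    push_cast
    ring
  rw [omega_eq w k, LinearMap.map_smul_of_tower, DOp_smul_mon, nablaThetaEuler_smul_complex,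
    nablaThetaEuler_smul, thetaDerX_T, zero_smul, zero_add, nablaThetaEuler_mon w hn hw₀, smul_add,
    smul_neg, ← Nat.cast_smul_eq_nsmul ℂ, ← Int.cast_smul_eq_zsmul ℂ, hs,
    smul_comm (LaurentPolynomial.T _ : CXTheta) (mu w : ℂ),
    smul_comm (LaurentPolynomial.T _ : CXTheta) tau, smul_comm (LaurentPolynomial.T _ : CXTheta) (_ - _ : ℂ),
    smul_comm tau (_ : ℂ), smul_add tau, smul_comm tau (_ : ℂ), tau_smul_theta_smul]
  push_cast
  module

end OmegaAction

/-! ### Linear maps out of the Gauss–Manin system -/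

section Universal

open Polynomial

variable {n : ℕ} (w : Fin (n + 1) → ℕ)
variable {M : Type*} [AddCommGroup M] [Module CTheta M] [Module CXTheta M]
  [IsScalarTower CTheta CXTheta M] (D : M →ₗ[CTheta] M) (e : M)

/-- The polynomial `∏ᵢ ∏_{j < mᵢ} (j θ - wᵢ X)`. -/
def shiftPoly (m : Fin n → ℕ) : CTheta[X] :=
  ∏ i, ∏ j ∈ Finset.range (m i), (C ((j : CTheta) * theta) - C (w i.succ : CTheta) * X)

/-- The operator `-x⁻¹ D`. -/
def shiftOp : Module.End CTheta M where
  toFun m := -((LaurentPolynomial.T (-1) : CXTheta) • D m)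
  map_add' m m' := by rw [map_add, smul_add, neg_add]
  map_smul' r m := by rw [map_smul, smul_comm, RingHom.id_apply, smul_neg]

variable {D}

/-- The operator -x⁻¹D plays the role of multiplication by u₀. Moving x⁻¹ across D changes D into D
+ θ. -/
theorem shiftOp_mul (hD : ∀ (r : CXTheta) m, D (r • m) = (theta • xDer r) • m + r • D m) :
    shiftOp D * D = (D + algebraMap CTheta (Module.End CTheta M) theta) * shiftOp D := by
  ext m
  change -((LaurentPolynomial.T (-1) : CXTheta) • D (D m)) =
    D (-((LaurentPolynomial.T (-1) : CXTheta) • D m)) +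
      theta • (-((LaurentPolynomial.T (-1) : CXTheta) • D m))
  rw [map_neg, hD, xDer_T, neg_one_smul, smul_neg, neg_smul, smul_assoc, smul_neg]
  abel

theorem shiftOp_aeval (hD : ∀ (r : CXTheta) m, D (r • m) = (theta • xDer r) • m + r • D m)
    (p : CTheta[X]) (m : M) :
    shiftOp D (aeval D p m) = aeval D (p.comp (X + C theta)) (shiftOp D m) := by
  have h : SemiconjBy (shiftOp D) (aeval D p) (aeval D (p.comp (X + C theta))) := by
    induction p using Polynomial.induction_on' with
    | add p q hp hq => simpa using hp.add_right hq
    | monomial k r =>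
      rw [← C_mul_X_pow_eq_monomial, map_mul, map_pow, aeval_X, aeval_C, mul_comp, C_comp, pow_comp,
        X_comp, map_mul, map_pow, aeval_C, map_add, aeval_X, aeval_C]
      exact SemiconjBy.mul_right (Algebra.commutes _ _).symm
        (SemiconjBy.pow_right (shiftOp_mul hD) k)
  exact LinearMap.congr_fun h m

theorem shiftOp_pow (hD : ∀ (r : CXTheta) m, D (r • m) = (theta • xDer r) • m + r • D m)
    (k : ℕ) (m : M) :
    (shiftOp D ^ k) (D m) = D ((shiftOp D ^ k) m) + k • theta • (shiftOp D ^ k) m := by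
  induction k with
  | zero => simp
  | succ k ih =>
    rw [pow_succ', Module.End.mul_apply, ih, map_add, map_nsmul, map_smul]
    have h := LinearMap.congr_fun (shiftOp_mul hD) ((shiftOp D ^ k) m)
    change shiftOp D (D _) = D (shiftOp D _) + theta • shiftOp D _ at h
    rw [h, Module.End.mul_apply, succ_nsmul]
    abel

theorem shiftPoly_add_single (m : Fin n → ℕ) (i : Fin n) : shiftPoly w (m + Pi.single i 1) =
    (C ((m i : CTheta) * theta) - C (w i.succ : CTheta) * X) * shiftPoly w m := by
  classical
  rw [shiftPoly, shiftPoly, ← Finset.mul_prod_erase _ _ (Finset.mem_univ i),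
    ← Finset.mul_prod_erase _ _ (Finset.mem_univ i)]
  have h2 : ∏ k ∈ Finset.univ.erase i, ∏ j ∈ Finset.range ((m + Pi.single i 1 : Fin n → ℕ) k),
        (C ((j : CTheta) * theta) - C (w k.succ : CTheta) * X) =
      ∏ k ∈ Finset.univ.erase i, ∏ j ∈ Finset.range (m k),
        (C ((j : CTheta) * theta) - C (w k.succ : CTheta) * X) :=
    Finset.prod_congr rfl fun k hk => by simp [Finset.ne_of_mem_erase hk]
  rw [h2, Pi.add_apply, Pi.single_eq_same, Finset.prod_range_succ]
  ring

variable {w e}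

/-- This is the identity u₀ · u^{m+w} = u^m in the module M. The factors with index at least w_i are
(w_i + j)θ - w_i D; passing `shiftOp` across them replaces D by D + θ and leaves jθ - w_i D. What
remains is `shiftOp` on the vector attached to u^w, which is e by `he`. -/
theorem shiftOp_shiftPoly
    (hD : ∀ (r : CXTheta) m, D (r • m) = (theta • xDer r) • m + r • D m)
    (he : -D (aeval D (shiftPoly w fun i => w i.succ) e) = xVar • e) (m : Fin n → ℕ) :
    shiftOp D (aeval D (shiftPoly w (m + fun i => w i.succ)) e) = aeval D (shiftPoly w m) e := by
  have h1 : shiftPoly w (m + fun i => w i.succ) =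
      (∏ i, ∏ j ∈ Finset.range (m i),
        (C (((w i.succ + j : ℕ) : CTheta) * theta) - C (w i.succ : CTheta) * X)) *
      shiftPoly w fun i => w i.succ := by
    rw [shiftPoly, shiftPoly, ← Finset.prod_mul_distrib]
    refine Finset.prod_congr rfl fun i _ => ?_
    rw [Pi.add_apply, add_comm, Finset.prod_range_add, mul_comm]
  have h2 : (∏ i, ∏ j ∈ Finset.range (m i),
        (C (((w i.succ + j : ℕ) : CTheta) * theta) - C (w i.succ : CTheta) * X)).comp
          (X + C theta) = shiftPoly w m := by
    simp only [prod_comp, shiftPoly]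
    refine Finset.prod_congr rfl fun i _ => Finset.prod_congr rfl fun j _ => ?_
    simp only [sub_comp, mul_comp, C_comp, X_comp, Nat.cast_add, map_mul (C : CTheta →+* CTheta[X]),
      map_add (C : CTheta →+* CTheta[X]), add_comp]
    ring
  have h3 : shiftOp D (aeval D (shiftPoly w fun i => w i.succ) e) = e := by
    change -((LaurentPolynomial.T (-1) : CXTheta) • D _) = e
    rw [← smul_neg, he, smul_smul, xVar, ← LaurentPolynomial.T_add, neg_add_cancel,
      LaurentPolynomial.T_zero, one_smul]
  rw [h1, map_mul, Module.End.mul_apply, shiftOp_aeval hD, h2, h3]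

variable (w D e) in
/-- The vector `(-x⁻¹ D)ᵏ ∏ᵢ ∏_{j < mᵢ + k wᵢ} (j θ - wᵢ D) e`. -/
def monVecAux (k : ℕ) (m : Fin n → ℤ) : M :=
  (shiftOp D ^ k) (aeval D (shiftPoly w fun i => (m i + k * w i.succ).toNat) e)

variable (w D e) in
/-- The image of `u^m` under the linear map `G → M` that sends `1` to `e`. -/
def monVec (m : Fin n → ℤ) : M := monVecAux w D e (∑ i, (m i).natAbs) m

/-- Negative exponents are reached by writing u^m = u₀^k u^{m + k w}. The vector does not depend on
k once all the exponents m_i + k w_i are nonnegative. -/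
theorem monVecAux_add
    (hD : ∀ (r : CXTheta) m, D (r • m) = (theta • xDer r) • m + r • D m)
    (he : -D (aeval D (shiftPoly w fun i => w i.succ) e) = xVar • e) {k : ℕ} {m : Fin n → ℤ}
    (hk : ∀ i, 0 ≤ m i + k * w i.succ) (l : ℕ) :
    monVecAux w D e (k + l) m = monVecAux w D e k m := by
  induction l with
  | zero => rfl
  | succ l ih =>
    have h : (fun i => (m i + (k + (l + 1) : ℕ) * w i.succ).toNat) =
        (fun i => (m i + (k + l : ℕ) * w i.succ).toNat) + fun i => w i.succ := by
      funext i
      have h1 := hk i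
      have h2 : 0 ≤ (l : ℤ) * w i.succ := by positivity
      have h3 : m i + (k + (l + 1) : ℕ) * w i.succ =
          (m i + (k + l : ℕ) * w i.succ) + w i.succ := by push_cast; ring
      have h4 : m i + (k + l : ℕ) * w i.succ = (m i + k * w i.succ) + l * w i.succ := by
        push_cast; ring
      rw [Pi.add_apply, h3, h4]
      omega
    rw [← ih, monVecAux, h, monVecAux, ← add_assoc, pow_succ, Module.End.mul_apply,
      shiftOp_shiftPoly hD he]

theorem monVec_eq (hw : ∀ i, 0 < w i)
    (hD : ∀ (r : CXTheta) m, D (r • m) = (theta • xDer r) • m + r • D m)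
    (he : -D (aeval D (shiftPoly w fun i => w i.succ) e) = xVar • e) {k : ℕ} {m : Fin n → ℤ}
    (hk : ∀ i, 0 ≤ m i + k * w i.succ) : monVec w D e m = monVecAux w D e k m := by
  -- The value ∑ |m_i| of k used in `monVec` is large enough because w_i ≥ 1.
  have h : ∀ i, 0 ≤ m i + (∑ i, (m i).natAbs : ℕ) * w i.succ := fun i => by
    have h1 : (m i).natAbs ≤ ∑ i, (m i).natAbs :=
      Finset.single_le_sum (f := fun i => (m i).natAbs) (fun _ _ => Nat.zero_le _)
        (Finset.mem_univ i)
    have h2 := hw i.succ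
    have h3 : ((m i).natAbs : ℤ) ≤ (∑ i, (m i).natAbs : ℕ) * w i.succ := by
      exact_mod_cast h1.trans (Nat.le_mul_of_pos_right _ h2)
    omega
  rw [monVec, ← monVecAux_add hD he h k, add_comm, monVecAux_add hD he hk]

theorem exists_shift (hw : ∀ i, 0 < w i) (m : Fin n → ℤ) :
    ∃ k : ℕ, ∀ i : Fin n, 0 ≤ m i + k * w i.succ := by
  refine ⟨∑ i, (m i).natAbs, fun i => ?_⟩
  have h1 : (m i).natAbs ≤ ∑ i, (m i).natAbs :=
    Finset.single_le_sum (f := fun i => (m i).natAbs) (fun _ _ => Nat.zero_le _)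
        (Finset.mem_univ i)
  have h2 := hw i.succ
  have h3 : ((m i).natAbs : ℤ) ≤ (∑ i, (m i).natAbs : ℕ) * w i.succ := by
    exact_mod_cast h1.trans (Nat.le_mul_of_pos_right _ h2)
  omega

theorem monVec_sub_wvec (hw : ∀ i, 0 < w i)
    (hD : ∀ (r : CXTheta) m, D (r • m) = (theta • xDer r) • m + r • D m)
    (he : -D (aeval D (shiftPoly w fun i => w i.succ) e) = xVar • e) (m : Fin n → ℤ) :
    monVec w D e (m - wvec w) = shiftOp D (monVec w D e m) := by
  obtain ⟨k, hk⟩ := exists_shift hw m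
  have h : ∀ i, m i - wvec w i + (k + 1 : ℕ) * w i.succ = m i + k * w i.succ := fun i => by
    rw [wvec]; push_cast; ring
  rw [monVec_eq hw hD he hk, monVec_eq hw hD he (k := k + 1) (fun i => by
    rw [Pi.sub_apply, h]; exact hk i), monVecAux, monVecAux, pow_succ', Module.End.mul_apply]
  simp only [Pi.sub_apply, h]

theorem monVec_add_single (hw : ∀ i, 0 < w i)
    (hD : ∀ (r : CXTheta) m, D (r • m) = (theta • xDer r) • m + r • D m)
    (he : -D (aeval D (shiftPoly w fun i => w i.succ) e) = xVar • e) (m : Fin n → ℤ) (i : Fin n) :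
    monVec w D e (m + Pi.single i 1) =
      -(w i.succ • D (monVec w D e m)) + m i • theta • monVec w D e m := by
  obtain ⟨k, hk⟩ := exists_shift hw m
  have h : (fun j => ((m + Pi.single i 1 : Fin n → ℤ) j + k * w j.succ).toNat) =
      (fun j => (m j + k * w j.succ).toNat) + Pi.single i 1 := by
    funext j
    have := hk j
    by_cases hj : j = i
    · subst hj
      simp only [Pi.add_apply, Pi.single_eq_same]
      omega
    · simp [hj]
  rw [monVec_eq hw hD he hk, monVec_eq hw hD he (k := k) (fun j => by
    have := hk j
    have h1 : 0 ≤ (Pi.single i 1 : Fin n → ℤ) j := by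
      rw [Pi.single_apply]; split_ifs <;> simp
    rw [Pi.add_apply]
    omega), monVecAux, monVecAux, h, shiftPoly_add_single]
  have hN : (((m i + k * w i.succ).toNat : ℕ) : CTheta) = m i + k * w i.succ := by
    have h2 : (((m i + k * w i.succ).toNat : ℕ) : ℤ) = m i + k * w i.succ := Int.toNat_of_nonneg (hk i)
    exact_mod_cast congrArg (Int.cast : ℤ → CTheta) h2
  rw [map_mul, Module.End.mul_apply, map_sub, map_mul (aeval D) (C _) X, aeval_C, aeval_C, aeval_X,
    hN]
  set Y := aeval D (shiftPoly w fun i => (m i + k * w i.succ).toNat) e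
  -- The new factor is (m_i + k w_i)θ - w_i D. Bringing D out of the k-th power of `shiftOp`
  -- produces an extra kθ, so the terms k w_i θ cancel and m_i θ - w_i D is left.
  rw [LinearMap.sub_apply, Module.End.mul_apply, Module.algebraMap_end_apply,
    Module.algebraMap_end_apply, map_sub, map_smul, map_smul, shiftOp_pow hD,
    ← Nat.cast_smul_eq_nsmul CTheta, ← Nat.cast_smul_eq_nsmul CTheta,
    ← Int.cast_smul_eq_zsmul CTheta]
  module

theorem Fun.induction {P : Fun n → Prop} (f : Fun n) (smul : ∀ (r : CXTheta) m, P (r • uMon m))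
    (add : ∀ f g, P f → P g → P (f + g)) : P f := by
  induction f using AddMonoidAlgebra.induction_linear with
  | zero => simpa using smul 0 0
  | add f g hf hg => exact add f g hf hg
  | single m r =>
    have : (AddMonoidAlgebra.single m r : Fun n) = r • uMon m := by
      rw [uMon, AddMonoidAlgebra.smul_single, smul_eq_mul, mul_one]
    rw [this]
    exact smul r m

/-- Universal property of G: it is generated by the class of 1 under D, with -D ∏_{i≥1} ∏_{j<w_i}
(jθ - w_i D) = x as the only relation. The map sends u^m to `monVec w D e m`; it kills the
boundaries because these vectors obey the same rules for u_i and u₀ as the monomials. -/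
theorem exists_linearMap (hw : ∀ i, 0 < w i)
    (hD : ∀ (r : CXTheta) m, D (r • m) = (theta • xDer r) • m + r • D m)
    (he : -D (aeval D (shiftPoly w fun i => w i.succ) e) = xVar • e) :
    ∃ Φ : GaussManin w →ₗ[CXTheta] M, Φ (mon w 0) = e ∧ ∀ g, Φ (DOp w g) = D (Φ g) := by
  let Ψ : Fun n →ₗ[CXTheta] M := Finsupp.linearCombination CXTheta (monVec w D e) ∘ₗ
    (AddMonoidAlgebra.coeffLinearEquiv CXTheta).toLinearMap
  have hΨ : ∀ m, Ψ (uMon m) = monVec w D e m := fun m => by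
    change Finsupp.linearCombination CXTheta (monVec w D e) (Finsupp.single m 1) = _
    simp
  have hx : ∀ m, xVar • monVec w D e (m - wvec w) = -D (monVec w D e m) := fun m => by
    rw [monVec_sub_wvec hw hD he]
    change xVar • -((LaurentPolynomial.T (-1) : CXTheta) • D _) = _
    rw [smul_neg, smul_smul, xVar, ← LaurentPolynomial.T_add, add_neg_cancel,
      LaurentPolynomial.T_zero, one_smul]
  have hs : ∀ (r : CTheta) f, Ψ (r • f) = r • Ψ f := fun r f => Ψ.map_smul_of_tower r f
  have hrel : ∀ i g, Ψ (uDer i g - tau • (uDer i (F w) * g)) = 0 := by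
    intro i g
    induction g using Fun.induction with
    | smul r m =>
      rw [uDer_smul, mul_smul_comm, smul_comm tau r, ← smul_sub, map_smul, relation_uMon, map_sub,
        map_zsmul, hs, map_sub, map_nsmul, map_smul, hΨ, hΨ, hΨ, hx, monVec_add_single hw hD he,
        smul_neg, sub_neg_eq_add, neg_add_cancel_comm, smul_comm tau, tau_smul_theta_smul, sub_self,
        smul_zero]
    | add f g hf hg =>
      rw [map_add, mul_add, smul_add, add_sub_add_comm, map_add, hf, hg, add_zero]
  have hmon : ∀ m, liftOf w Ψ hrel (mon w m) = monVec w D e m := fun m => by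
    rw [mon, liftOf_classOf, hΨ]
  refine ⟨liftOf w Ψ hrel, ?_, fun g => ?_⟩
  · rw [hmon, monVec_eq hw hD he (k := 0) (by simp), monVecAux]
    have : (fun i => ((0 : Fin n → ℤ) i + (0 : ℕ) * w i.succ).toNat) = 0 := by
      funext i; simp
    rw [this]
    simp [shiftPoly]
  · obtain ⟨f, rfl⟩ := classOf_surjective w g
    induction f using Fun.induction with
    | smul r m =>
      rw [map_smul, DOp_smul, map_add, map_smul, map_smul, map_smul, hD]
      change _ • liftOf w Ψ hrel (mon w m) + r • liftOf w Ψ hrel (DOp w (mon w m)) =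
        _ • liftOf w Ψ hrel (mon w m) + r • D (liftOf w Ψ hrel (mon w m))
      rw [DOp_mon, map_neg, map_smul, hmon, hmon, hx, neg_neg]
    | add f g hf hg => simp only [map_add, hf, hg]

end Universal

/-! ### Operators given by matrices -/

section ConnOp

variable {K A ι M : Type*} [CommRing K] [CommRing A] [Algebra K A] [AddCommGroup M]
  [Module A M] [Module K M] [IsScalarTower K A M] [Fintype ι]

/-- The `K`-linear operator `∇` with `∇(f bᵢ) = δ(f) bᵢ + f vᵢ`. -/
def connOp (b : Module.Basis ι A M) (δ : A →ₗ[K] A) (v : ι → M) : M →ₗ[K] M where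
  toFun m := ∑ i, (δ (b.repr m i) • b i + b.repr m i • v i)
  map_add' m m' := by
    rw [← Finset.sum_add_distrib]
    refine Finset.sum_congr rfl fun i _ => ?_
    rw [map_add, Finsupp.add_apply, map_add, add_smul, add_smul]
    abel
  map_smul' r m := by
    rw [RingHom.id_apply, Finset.smul_sum]
    refine Finset.sum_congr rfl fun i _ => ?_
    have h : b.repr (r • m) i = r • b.repr m i :=
      DFunLike.congr_fun (b.repr.toLinearMap.map_smul_of_tower r m) i
    rw [h, map_smul, smul_add, smul_assoc, smul_assoc]

theorem connOp_apply (b : Module.Basis ι A M) (δ : A →ₗ[K] A) (v : ι → M) (m : M) :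
    connOp b δ v m = ∑ i, (δ (b.repr m i) • b i + b.repr m i • v i) := rfl

theorem connOp_smul (b : Module.Basis ι A M) (δ : A →ₗ[K] A) (v : ι → M)
    (hδ : ∀ f g, δ (f * g) = δ f * g + f * δ g) (f : A) (m : M) :
    connOp b δ v (f • m) = δ f • m + f • connOp b δ v m := by
  conv_rhs => rw [← b.sum_repr m]
  rw [connOp_apply, connOp_apply, Finset.smul_sum, Finset.smul_sum, ← Finset.sum_add_distrib]
  refine Finset.sum_congr rfl fun i _ => ?_
  rw [map_smul, Finsupp.smul_apply, smul_eq_mul, hδ, b.sum_repr, add_smul, mul_smul, mul_smul,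
    mul_smul, smul_add]
  abel

theorem connOp_basis (b : Module.Basis ι A M) (δ : A →ₗ[K] A) (v : ι → M)
    (hδ : ∀ f g, δ (f * g) = δ f * g + f * δ g) (i : ι) : connOp b δ v (b i) = v i := by
  classical
  have h1 : δ 1 = 0 := by simpa using hδ 1 1
  rw [connOp_apply, Finset.sum_eq_single_of_mem i (Finset.mem_univ i)]
  · simp [h1]
  · intro j _ hj
    simp [Finsupp.single_eq_of_ne hj]

end ConnOp

/-! ### Freeness of the Gauss–Manin system -/

section Free

open Polynomial

variable {n : ℕ} (w : Fin (n + 1) → ℕ)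

/-- `θ x ∂_x`, as a `ℂ[θ, θ⁻¹]`-linear map. -/
def thetaXDer : CXTheta →ₗ[CTheta] CXTheta where
  toFun f := theta • xDer f
  map_add' f g := by rw [map_add, smul_add]
  map_smul' r f := by
    rw [Algebra.smul_def r f, Derivation.leibniz, xDer_algebraMap, smul_zero, add_zero,
      RingHom.id_apply, smul_eq_mul, ← Algebra.smul_def, smul_comm]

theorem thetaXDer_mul (f g : CXTheta) :
    thetaXDer (f * g) = thetaXDer f * g + f * thetaXDer g := by
  change theta • xDer (f * g) = theta • xDer f * g + f * theta • xDer g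
  rw [Derivation.leibniz, smul_add, smul_eq_mul, smul_eq_mul, smul_mul_assoc, mul_smul_comm,
    mul_comm g, add_comm]

/-- The standard vectors `e₀, …, e_{μ-1}`, continued by `x / w^w · e₀`. -/
def modelVec (k : ℕ) : Fin (mu w) → CXTheta :=
  if h : k < mu w then Pi.single ⟨k, h⟩ 1
  else (∏ i, (w i : ℂ) ^ w i)⁻¹ • xVar • (fun i => if (i : ℕ) = 0 then 1 else 0 : Fin (mu w) → CXTheta)

/-- The operator on the free module that corresponds to `θ x ∇_{∂_x}`. -/
def modelOp : (Fin (mu w) → CXTheta) →ₗ[CTheta] (Fin (mu w) → CXTheta) :=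
  connOp (Pi.basisFun CXTheta (Fin (mu w))) thetaXDer fun k =>
    ((c w k : ℚ) : ℂ) • theta • modelVec w k - modelVec w (k + 1)

theorem modelOp_smul (r : CXTheta) (m : Fin (mu w) → CXTheta) :
    modelOp w (r • m) = (theta • xDer r) • m + r • modelOp w m :=
  connOp_smul _ _ _ thetaXDer_mul r m

theorem modelOp_modelVec {k : ℕ} (hk : k < mu w) : modelOp w (modelVec w k) =
    ((c w k : ℚ) : ℂ) • theta • modelVec w k - modelVec w (k + 1) := by
  have h : modelVec w k = Pi.basisFun CXTheta (Fin (mu w)) ⟨k, hk⟩ := by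
    rw [modelVec, dif_pos hk, Pi.basisFun_apply]
  conv_lhs => rw [h]
  exact connOp_basis _ _ _ thetaXDer_mul _

variable {w}

theorem modelVec_mu (hw : ∀ i, 0 < w i) :
    modelVec w (mu w) = (∏ i, (w i : ℂ) ^ w i)⁻¹ • xVar • modelVec w 0 := by
  rw [modelVec, dif_neg (lt_irrefl _), modelVec, dif_pos ((Nat.zero_le n).trans_lt (n_lt_mu hw))]
  congr 2
  funext i
  rw [Pi.single_apply]
  simp [Fin.ext_iff]

theorem prod_pow_ne_zero (hw : ∀ i, 0 < w i) : ∏ i, (w i : ℂ) ^ w i ≠ 0 :=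
  Finset.prod_ne_zero_iff.mpr fun i _ => pow_ne_zero _ (by exact_mod_cast (hw i).ne')

theorem aeval_modelVec {K : ℕ} (hK : K ≤ mu w) :
    aeval (modelOp w) (∏ k ∈ Finset.range K, (C (((c w k : ℚ) : ℂ) • theta) - X)) (modelVec w 0) =
      modelVec w K := by
  induction K with
  | zero => simp
  | succ K ih =>
    rw [Finset.prod_range_succ, mul_comm, map_mul, Module.End.mul_apply, ih (by omega), map_sub,
      aeval_C, aeval_X, LinearMap.sub_apply, Module.algebraMap_end_apply, modelOp_modelVec w hK,
      smul_assoc]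
    abel

/-- Iterating the recursion gives ∏_{k<μ} (c_k θ - D) e₀ = x e₀ / w^w. By `prod_c` the product runs
over all (j / w_i)θ - D, and multiplying by w^w clears the denominators. -/
theorem modelOp_cyclic (hw : ∀ i, 0 < w i) (hw₀ : w 0 = 1) :
    -modelOp w (aeval (modelOp w) (shiftPoly w fun i => w i.succ) (modelVec w 0)) =
      xVar • modelVec w 0 := by
  have h := aeval_modelVec (w := w) le_rfl
  rw [prod_c hw (fun q => (C (((q : ℚ) : ℂ) • theta) - X : CTheta[X])), modelVec_mu hw] at h
  have hz := prod_pow_ne_zero hw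
  -- Each w_i^{w_i} is distributed over the w_i factors of its row. As w₀ = 1, the row i = 0
  -- consists of the single factor -X.
  have h2 : (C (algebraMap ℂ CTheta (∏ i, (w i : ℂ) ^ w i)) : CTheta[X]) *
      ∏ i, ∏ j ∈ Finset.range (w i), (C ((((j : ℚ) / (w i : ℚ) : ℚ) : ℂ) • theta) - X) =
      -X * shiftPoly w fun i => w i.succ := by
    have h3 : ∀ i, (C (algebraMap ℂ CTheta ((w i : ℂ) ^ w i)) : CTheta[X]) *
        ∏ j ∈ Finset.range (w i), (C ((((j : ℚ) / (w i : ℚ) : ℚ) : ℂ) • theta) - X) =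
        ∏ j ∈ Finset.range (w i), (C ((j : CTheta) * theta) - C (w i : CTheta) * X) := by
      intro i
      have hwi : (w i : ℂ) ≠ 0 := by exact_mod_cast (hw i).ne'
      have : (C (algebraMap ℂ CTheta ((w i : ℂ) ^ w i)) : CTheta[X]) =
          ∏ _j ∈ Finset.range (w i), C (algebraMap ℂ CTheta (w i : ℂ)) := by
        simp
      rw [this, ← Finset.prod_mul_distrib]
      refine Finset.prod_congr rfl fun j _ => ?_
      rw [mul_sub, ← map_mul, ← Algebra.smul_def, smul_smul]
      have h4 : (w i : ℂ) * (((j : ℚ) / (w i : ℚ) : ℚ) : ℂ) = (j : ℂ) := by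
        push_cast
        field_simp
      rw [h4, Algebra.smul_def, map_natCast, map_natCast]
    rw [map_prod, map_prod, ← Finset.prod_mul_distrib, Finset.prod_congr rfl fun i _ => h3 i,
      Fin.prod_univ_succ, hw₀]
    simp [shiftPoly]
  have h5 := congrArg (fun v => (∏ i, (w i : ℂ) ^ w i) • v) h
  simp only [smul_smul, mul_inv_cancel₀ hz, one_smul] at h5
  have h6 : ∀ (r : CTheta) (p : CTheta[X]) v,
      r • aeval (modelOp w) p v = aeval (modelOp w) (C r * p) v := fun r p v => by
    rw [map_mul, aeval_C, Module.End.mul_apply, Module.algebraMap_end_apply]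
  rw [← h5, ← algebraMap_smul CTheta (∏ i, (w i : ℂ) ^ w i), h6, h2, map_mul, map_neg, aeval_X]
  rfl

/-- The recursion determines ω_{k+1} from ω_k and D ω_k, and the model vectors satisfy the same
recursion. -/
theorem exists_model (hn : 0 < n) (hw : ∀ i, 0 < w i) (hw₀ : w 0 = 1) :
    ∃ Φ : GaussManin w →ₗ[CXTheta] (Fin (mu w) → CXTheta),
      ∀ k ≤ mu w, Φ (omega w k) = modelVec w k := by
  obtain ⟨Φ, h0, hΦ⟩ := exists_linearMap (w := w) hw (modelOp_smul w) (modelOp_cyclic hw hw₀)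
  refine ⟨Φ, fun k => ?_⟩
  induction k with
  | zero => intro _; rw [omega_zero, h0]
  | succ k ih =>
    intro hk
    have h1 := hΦ (omega w k)
    have hs : ∀ (r : CTheta) g, Φ (r • g) = r • Φ g := fun r g => Φ.map_smul_of_tower r g
    have hs' : ∀ (r : ℂ) g, Φ (r • g) = r • Φ g := fun r g => Φ.map_smul_of_tower r g
    rw [DOp_omega hn hw hw₀, ih (by omega), modelOp_modelVec w hk, map_sub, hs', hs, ih (by omega),
      c_eq_level hw hk] at h1
    exact sub_right_injective h1

theorem omega_linearIndependent (hn : 0 < n) (hw : ∀ i, 0 < w i) (hw₀ : w 0 = 1) :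
    LinearIndependent CXTheta fun k : Fin (mu w) => omega w k := by
  obtain ⟨Φ, hΦ⟩ := exists_model hn hw hw₀
  refine LinearIndependent.of_comp Φ ?_
  have : (Φ ∘ fun k : Fin (mu w) => omega w k) = Pi.basisFun CXTheta (Fin (mu w)) := by
    funext k
    rw [Function.comp_apply, hΦ k k.2.le, modelVec, dif_pos k.2, Pi.basisFun_apply]
  rw [this]
  exact (Pi.basisFun CXTheta (Fin (mu w))).linearIndependent

/-- The span is stable under D, the last step being closed by ω_μ = x ω₀ / w^w. Multiplication by u₀
and by u_i is expressed through D, θ and x⁻¹, so every monomial is reached from ω₀ = 1. -/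
theorem omega_span (hn : 0 < n) (hw : ∀ i, 0 < w i) (hw₀ : w 0 = 1) :
    ⊤ ≤ Submodule.span CXTheta (Set.range fun k : Fin (mu w) => omega w k) := by
  set W := Submodule.span CXTheta (Set.range fun k : Fin (mu w) => omega w k) with hW
  have hmu := n_lt_mu hw
  have hω : ∀ k ≤ mu w, omega w k ∈ W := by
    intro k hk
    rcases hk.lt_or_eq with hk | rfl
    · exact Submodule.subset_span ⟨⟨k, hk⟩, rfl⟩
    · rw [omega_mu hw hw₀]
      exact W.smul_of_tower_mem _ (W.smul_mem _
        (Submodule.subset_span ⟨⟨0, by omega⟩, rfl⟩))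
  have hD : ∀ g ∈ W, DOp w g ∈ W := by
    intro g hg
    induction hg using Submodule.span_induction with
    | mem g hg =>
      obtain ⟨k, rfl⟩ := hg
      rw [DOp_omega hn hw hw₀]
      exact W.sub_mem (W.smul_of_tower_mem _ (W.smul_of_tower_mem _ (hω k k.2.le)))
        (hω _ k.2)
    | zero => rw [map_zero]; exact W.zero_mem
    | add g h _ _ hg hh => rw [map_add]; exact W.add_mem hg hh
    | smul r g h hg => rw [DOp_smul]; exact W.add_mem (W.smul_mem _ h) (W.smul_mem _ hg)
  have hsub : ∀ m, mon w m ∈ W → mon w (m - wvec w) ∈ W := fun m hm => by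
    rw [mon_sub_wvec]
    exact W.neg_mem (W.smul_mem _ (hD _ hm))
  have hadd : ∀ m i, mon w m ∈ W → mon w (m + Pi.single i 1) ∈ W := fun m i hm => by
    rw [mon_add_single' w hn]
    exact W.add_mem (W.neg_mem (W.smul_of_tower_mem _ (hD _ hm)))
      (W.smul_of_tower_mem _ (W.smul_of_tower_mem _ hm))
  have hnat : ∀ m : Fin n → ℕ, mon w (fun i => (m i : ℤ)) ∈ W := by
    intro m
    induction hs : ∑ i, m i generalizing m with
    | zero =>
      have : (fun i => (m i : ℤ)) = 0 := by
        funext i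
        have := (Finset.sum_eq_zero_iff.mp hs) i (Finset.mem_univ i)
        simp [this]
      rw [this, ← omega_zero]
      exact hω 0 (Nat.zero_le _)
    | succ s ih =>
      obtain ⟨i, -, hi⟩ : ∃ i ∈ Finset.univ, m i ≠ 0 :=
        Finset.exists_ne_zero_of_sum_ne_zero (by rw [hs]; simp)
      obtain ⟨m', rfl⟩ : ∃ m', m = m' + Pi.single i 1 :=
        ⟨m - Pi.single i 1, by
          funext j
          by_cases hj : j = i
          · subst hj; simp; omega
          · simp [hj]⟩
      have hm' : ∑ i, m' i = s := by
        simpa [Finset.sum_add_distrib] using hs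
      have := hadd _ i (ih m' hm')
      convert this using 2
      funext j
      by_cases hj : j = i
      · subst hj; simp
      · simp [hj]
  have hmon : ∀ m, mon w m ∈ W := by
    intro m
    obtain ⟨k, hk⟩ := exists_shift hw m
    -- The monomial with nonnegative exponents m + k w is multiplied l times by u₀; l = k gives u^m.
    have h : ∀ l : ℕ, mon w (m + ((k : ℤ) - l) • wvec w) ∈ W := by
      intro l
      induction l with
      | zero =>
        have := hnat fun i => (m i + k * w i.succ).toNat
        convert this using 2
        funext i
        rw [Int.toNat_of_nonneg (hk i)]
        simp [wvec]
      | succ l ih =>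
        convert hsub _ ih using 2
        push_cast
        rw [sub_add_eq_sub_sub, sub_smul _ 1, one_smul]
        abel
    simpa using h k
  intro g _
  obtain ⟨f, rfl⟩ := classOf_surjective w g
  induction f using Fun.induction with
  | smul r m => rw [map_smul]; exact W.smul_mem _ (hmon m)
  | add f g hf hg => rw [map_add]; exact W.add_mem (hf trivial) (hg trivial)

/-- The basis `ω₀, …, ω_{μ-1}` of `G`. -/
def omegaBasis (hn : 0 < n) (hw : ∀ i, 0 < w i) (hw₀ : w 0 = 1) :
    Module.Basis (Fin (mu w)) CXTheta (GaussManin w) :=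
  Module.Basis.mk (omega_linearIndependent hn hw hw₀) (omega_span hn hw hw₀)

theorem omegaBasis_apply (hn : 0 < n) (hw : ∀ i, 0 < w i) (hw₀ : w 0 = 1) (k : Fin (mu w)) :
    omegaBasis hn hw hw₀ k = omega w k := by
  rw [omegaBasis, Module.Basis.mk_apply]

end Free

/-! ### Spans of the elements `x^p ω_k` -/

section GenSpan

variable {n : ℕ} (w : Fin (n + 1) → ℕ)

/-- The `ℂ[θ, θ⁻¹]`-span of the `x^p ω_k` with `p + c_k ∈ s`. -/
def genSpan (s : Set ℚ) : Submodule CTheta (GaussManin w) :=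
  Submodule.span CTheta {g | ∃ (k : Fin (mu w)) (p : ℤ), (p : ℚ) + c w k ∈ s ∧
    g = (LaurentPolynomial.T p : CXTheta) • omega w k}

theorem V_eq_genSpan (α : ℚ) : V w α = genSpan w (Set.Ici α) := rfl

theorem V_antitone : Antitone (V w) := fun _ _ h =>
  Submodule.span_mono fun _ ⟨k, p, hp, hg⟩ => ⟨k, p, h.trans hp, hg⟩

theorem genSpan_mono {s t : Set ℚ} (h : s ⊆ t) : genSpan w s ≤ genSpan w t :=
  Submodule.span_mono fun _ ⟨k, p, hp, hg⟩ => ⟨k, p, h hp, hg⟩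

variable {w}

theorem T_smul_omega_mem {s : Set ℚ} (k : Fin (mu w)) (p : ℤ) (h : (p : ℚ) + c w k ∈ s) :
    (LaurentPolynomial.T p : CXTheta) • omega w k ∈ genSpan w s :=
  Submodule.subset_span ⟨k, p, h, rfl⟩

theorem T_smul_omega_mem_V {α : ℚ} (k : Fin (mu w)) (p : ℤ) (h : α ≤ (p : ℚ) + c w k) :
    (LaurentPolynomial.T p : CXTheta) • omega w k ∈ V w α :=
  Submodule.subset_span ⟨k, p, h, rfl⟩

variable (w) in
-- V^α and V^{>α} both become spans indexed by an upper set, so that stability is proved once for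
-- the two of them.
theorem Vgt_V (α : ℚ) : Vgt (V w) α = genSpan w (Set.Ioi α) := by
  apply le_antisymm
  · refine iSup_le fun β => ?_
    rw [V_eq_genSpan]
    refine genSpan_mono w ?_
    exact fun γ hγ => Set.mem_Ioi.mpr ((Set.mem_Ioi.mp β.2).trans_le (Set.mem_Ici.mp hγ))
  · refine Submodule.span_le.mpr ?_
    rintro _ ⟨k, p, hp, rfl⟩
    exact Submodule.mem_iSup_of_mem (⟨(p : ℚ) + c w k, hp⟩ : Set.Ioi α)
      (T_smul_omega_mem_V k p le_rfl)

theorem T_smul_T_smul (p q : ℤ) (g : GaussManin w) :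
    (LaurentPolynomial.T p : CXTheta) • (LaurentPolynomial.T q : CXTheta) • g =
      (LaurentPolynomial.T (p + q) : CXTheta) • g := by
  rw [smul_smul, LaurentPolynomial.T_add]

theorem T_smul_mem {s t : Set ℚ} (q : ℤ) (h : ∀ γ ∈ s, γ + q ∈ t) {g : GaussManin w}
    (hg : g ∈ genSpan w s) : (LaurentPolynomial.T q : CXTheta) • g ∈ genSpan w t := by
  induction hg using Submodule.span_induction with
  | mem g hg =>
    obtain ⟨k, p, hp, rfl⟩ := hg
    rw [T_smul_T_smul]
    refine T_smul_omega_mem k _ ?_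
    convert h _ hp using 1
    push_cast
    ring
  | zero => rw [smul_zero]; exact zero_mem _
  | add g h _ _ hg hh => rw [smul_add]; exact add_mem hg hh
  | smul r g _ hg => rw [smul_comm]; exact Submodule.smul_mem _ _ hg

variable (hn : 0 < n) (hw : ∀ i, 0 < w i) (hw₀ : w 0 = 1)
include hn hw hw₀

omit hn in
-- Going from ω_k to ω_{k+1} does not lower the index, c being nondecreasing; at k = μ - 1 the
-- vector ω_μ is a multiple of x ω₀, of index 1 + c₀ > c_{μ-1}.
theorem T_smul_omega_succ_mem {s : Set ℚ} (hs : IsUpperSet s) (k : Fin (mu w)) (p : ℤ)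
    (h : (p : ℚ) + c w k ∈ s) :
    (LaurentPolynomial.T p : CXTheta) • omega w (k + 1) ∈ genSpan w s := by
  rcases (Nat.succ_le_of_lt k.2).lt_or_eq with hk | hk
  · exact T_smul_omega_mem ⟨k + 1, hk⟩ p
      (hs (by have := c_mono hw (Nat.le_succ k) hk; simpa using this) h)
  · have h0 : 0 < mu w := (Nat.zero_le _).trans_lt k.2
    rw [show (k : ℕ) + 1 = mu w from hk, omega_mu hw hw₀, smul_comm, xVar, T_smul_T_smul]
    refine Submodule.smul_of_tower_mem _ _ (T_smul_omega_mem ⟨0, h0⟩ _ (hs ?_ h))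
    have h1 := (c_mem w k).2
    have h2 := (c_mem w 0).1
    push_cast
    linarith

theorem nablaXEuler_T_smul_omega (k : Fin (mu w)) (p : ℤ) :
    nablaXEuler w ((LaurentPolynomial.T p : CXTheta) • omega w k) =
      (((p : ℚ) + c w k : ℚ) : ℂ) • (LaurentPolynomial.T p : CXTheta) • omega w k -
        tau • (LaurentPolynomial.T p : CXTheta) • omega w (k + 1) := by
  rw [nablaXEuler_smul, xDer_T, nablaXEuler_eq, DOp_omega hn hw hw₀, c_eq_level hw k.2, smul_sub,
    smul_comm tau (_ : ℂ), tau_smul_theta_smul, smul_sub,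
    smul_comm (LaurentPolynomial.T p : CXTheta) (_ : ℂ),
    smul_comm (LaurentPolynomial.T p : CXTheta) tau, smul_assoc, ← Int.cast_smul_eq_zsmul ℂ]
  push_cast
  module

theorem nablaThetaEuler_omega' (k : Fin (mu w)) :
    nablaThetaEuler w (omega w k) =
      ((alpha w k : ℚ) : ℂ) • omega w k + (mu w : ℂ) • tau • omega w (k + 1) := by
  rw [nablaThetaEuler_omega hn hw₀, DOp_omega hn hw hw₀, alpha, c_eq_level hw k.2, smul_sub tau,
    smul_comm tau (_ : ℂ), tau_smul_theta_smul]
  push_cast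
  module

theorem nablaXEuler_mem {s : Set ℚ} (hs : IsUpperSet s) {g : GaussManin w}
    (hg : g ∈ genSpan w s) : nablaXEuler w g ∈ genSpan w s := by
  induction hg using Submodule.span_induction with
  | mem g hg =>
    obtain ⟨k, p, hp, rfl⟩ := hg
    rw [nablaXEuler_T_smul_omega hn hw hw₀]
    exact sub_mem (Submodule.smul_of_tower_mem _ _ (T_smul_omega_mem k p hp))
      (Submodule.smul_mem _ _ (T_smul_omega_succ_mem hw hw₀ hs k p hp))
  | zero => rw [nablaXEuler_eq, map_zero, smul_zero]; exact zero_mem _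
  | add g h _ _ hg hh => rw [nablaXEuler_add]; exact add_mem hg hh
  | smul r g _ hg => rw [nablaXEuler_smul_theta]; exact Submodule.smul_mem _ _ hg

theorem nablaThetaEuler_mem {s : Set ℚ} (hs : IsUpperSet s) {g : GaussManin w}
    (hg : g ∈ genSpan w s) : nablaThetaEuler w g ∈ genSpan w s := by
  induction hg using Submodule.span_induction with
  | mem g hg =>
    obtain ⟨k, p, hp, rfl⟩ := hg
    rw [nablaThetaEuler_smul, thetaDerX_T, zero_smul, zero_add, nablaThetaEuler_omega' hn hw hw₀,
      smul_add, smul_comm _ (_ : ℂ), smul_comm _ (_ : ℂ), smul_comm _ tau]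
    exact add_mem (Submodule.smul_of_tower_mem _ _ (T_smul_omega_mem k p hp))
      (Submodule.smul_of_tower_mem _ _ (Submodule.smul_mem _ _
        (T_smul_omega_succ_mem hw hw₀ hs k p hp)))
  | zero =>
    have := nablaThetaEuler_add w 0 0
    rw [add_zero, left_eq_add] at this
    rw [this]; exact zero_mem _
  | add g h _ _ hg hh => rw [nablaThetaEuler_add]; exact add_mem hg hh
  | smul r g hg' hg =>
    rw [nablaThetaEuler_smul_theta]
    exact add_mem (Submodule.smul_mem _ _ hg') (Submodule.smul_mem _ _ hg)

theorem genSpan_univ : genSpan w Set.univ = ⊤ := by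
  rw [eq_top_iff]
  intro g _
  have hg := omega_span hn hw hw₀ (Submodule.mem_top (x := g))
  induction hg using Submodule.span_induction with
  | mem g hg =>
    obtain ⟨k, rfl⟩ := hg
    simpa using T_smul_omega_mem k 0 (Set.mem_univ _)
  | zero => exact zero_mem _
  | add g h _ _ hg hh => exact add_mem (hg trivial) (hh trivial)
  | smul r g _ hg =>
    induction r using AddMonoidAlgebra.induction_linear with
    | zero => rw [zero_smul]; exact zero_mem _
    | add r r' hr hr' => rw [add_smul]; exact add_mem (hr trivial) (hr' trivial)
    | single p s =>
      have : (AddMonoidAlgebra.single p s : CXTheta) = s • LaurentPolynomial.T p := by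
        rw [LaurentPolynomial.T, AddMonoidAlgebra.smul_single, smul_eq_mul, mul_one]
      rw [this, smul_assoc]
      exact Submodule.smul_mem _ _ (T_smul_mem p (fun _ _ => Set.mem_univ _) (hg trivial))

/-! ### The Kashiwara–Malgrange filtration -/

theorem exists_mem_V (g : GaussManin w) : ∃ α, g ∈ V w α := by
  have hg : g ∈ genSpan w Set.univ := by rw [genSpan_univ hn hw hw₀]; trivial
  induction hg using Submodule.span_induction with
  | mem g hg =>
    obtain ⟨k, p, -, rfl⟩ := hg
    exact ⟨(p : ℚ) + c w k, T_smul_omega_mem_V k p le_rfl⟩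
  | zero => exact ⟨0, zero_mem _⟩
  | add g h _ _ hg hh =>
    obtain ⟨α, hα⟩ := hg
    obtain ⟨β, hβ⟩ := hh
    exact ⟨min α β, add_mem (V_antitone w (min_le_left _ _) hα) (V_antitone w (min_le_right _ _) hβ)⟩
  | smul r g _ hg =>
    obtain ⟨α, hα⟩ := hg
    exact ⟨α, Submodule.smul_mem _ _ hα⟩

omit hn hw hw₀ in
theorem exists_c_denominator : ∃ N : ℕ, 0 < N ∧ ∀ k : Fin (mu w), ∃ z : ℤ, (N : ℚ) * c w k = z := by
  refine ⟨∏ k : Fin (mu w), (c w k).den, Finset.prod_pos fun k _ => (c w k).pos, fun k => ?_⟩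
  rw [← Finset.mul_prod_erase _ _ (Finset.mem_univ k)]
  refine ⟨(c w k).num * (∏ k ∈ Finset.univ.erase k, (c w k).den : ℕ), ?_⟩
  conv_lhs => rw [mul_comm, ← Rat.num_div_den (c w k)]
  have : ((c w k).den : ℚ) ≠ 0 := by exact_mod_cast (c w k).pos.ne'
  rw [Rat.num_div_den]
  push_cast
  rw [← mul_assoc, Rat.mul_den_eq_num]

/-- On a generator x^p ω_k of index exactly α the eigenvalue cancels, and the operator is -τ times
the shift k ↦ k + 1. After at most μ shifts the vector becomes a multiple of x^{p+1} ω₀ or has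
already left index α. -/
theorem nilpotent_V (α : ℚ) (g : GaussManin w) (hg : g ∈ V w α) :
    (fun h => nablaXEuler w h - (α : ℂ) • h)^[mu w] g ∈ Vgt (V w) α := by
  let f : Module.End CTheta (GaussManin w) :=
    { toFun := fun h => nablaXEuler w h - (α : ℂ) • h
      map_add' := fun g h => by rw [nablaXEuler_add, smul_add]; abel
      map_smul' := fun r g => by
        rw [nablaXEuler_smul_theta, RingHom.id_apply, smul_sub, smul_comm r (α : ℂ)] }
  have hIoi : IsUpperSet (Set.Ioi α) := isUpperSet_Ioi α
  have hf : ∀ j, ∀ g ∈ genSpan w (Set.Ioi α), (f ^ j) g ∈ genSpan w (Set.Ioi α) := by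
    intro j
    induction j with
    | zero => intro g hg; simpa using hg
    | succ j ih =>
      intro g hg
      rw [pow_succ, Module.End.mul_apply]
      exact ih _ (sub_mem (nablaXEuler_mem hn hw hw₀ hIoi hg) (Submodule.smul_of_tower_mem _ _ hg))
  -- Induction on a bound j for the number μ - k of shifts left before ω_μ.
  have key : ∀ j (k : Fin (mu w)) (p : ℤ), mu w ≤ k + j → α ≤ p + c w k →
      (f ^ j) ((LaurentPolynomial.T p : CXTheta) • omega w k) ∈ genSpan w (Set.Ioi α) := by
    intro j
    induction j with
    | zero => intro k p hk; exact absurd k.2 (by omega)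
    | succ j ih =>
      intro k p hk hp
      rcases hp.lt_or_eq with hp | hp
      · exact hf _ _ (T_smul_omega_mem k p hp)
      · have h1 : f ((LaurentPolynomial.T p : CXTheta) • omega w k) =
            -(tau • (LaurentPolynomial.T p : CXTheta) • omega w (k + 1)) := by
          change nablaXEuler w _ - (α : ℂ) • _ = _
          rw [nablaXEuler_T_smul_omega hn hw hw₀, ← hp]
          abel
        rw [pow_succ, Module.End.mul_apply, h1, map_neg, map_smul]
        refine neg_mem (Submodule.smul_mem _ _ ?_)
        rcases (Nat.succ_le_of_lt k.2).lt_or_eq with hk' | hk'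
        · refine ih ⟨k + 1, hk'⟩ p (by simp only; omega) ?_
          rw [hp]
          have := c_mono hw (Nat.le_succ k) hk'
          simpa using this
        · apply hf
          have h0 : 0 < mu w := (Nat.zero_le _).trans_lt k.2
          rw [show (k : ℕ) + 1 = mu w from hk', omega_mu hw hw₀, smul_comm, xVar, T_smul_T_smul]
          refine Submodule.smul_of_tower_mem _ _ (T_smul_omega_mem ⟨0, h0⟩ _ ?_)
          have h1 := (c_mem w k).2
          have h2 := (c_mem w 0).1
          rw [Set.mem_Ioi, hp]
          push_cast
          linarith
  have hfe : (f ^ mu w) g = (fun h => nablaXEuler w h - (α : ℂ) • h)^[mu w] g := by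
    rw [Module.End.pow_apply]; rfl
  rw [← hfe, Vgt_V]
  induction hg using Submodule.span_induction with
  | mem g hg =>
    obtain ⟨k, p, hp, rfl⟩ := hg
    exact key _ k p (by omega) hp
  | zero => rw [map_zero]; exact zero_mem _
  | add g h _ _ hg hh =>
    rw [map_add]
    exact add_mem (hg (by rw [Module.End.pow_apply]; rfl)) (hh (by rw [Module.End.pow_apply]; rfl))
  | smul r g _ hg =>
    rw [map_smul]
    exact Submodule.smul_mem _ _ (hg (by rw [Module.End.pow_apply]; rfl))

theorem isKashiwaraMalgrange_V : IsKashiwaraMalgrange w (V w) where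
  antitone := V_antitone w
  exhaustive := exists_mem_V hn hw hw₀
  discrete := by
    obtain ⟨N, hN, h⟩ := exists_c_denominator (w := w)
    have hN' : (0 : ℚ) < N := by exact_mod_cast hN
    refine ⟨N, hN, fun α => ?_⟩
    -- All indices p + c_k lie in (1/N)ℤ, so rounding α up to that grid does not change which of
    -- them are at least α.
    have key : ∀ (k : Fin (mu w)) (p : ℤ), α ≤ p + c w k ↔ (⌈(N : ℚ) * α⌉ : ℚ) / N ≤ p + c w k := by
      intro k p
      obtain ⟨z, hz⟩ := h k
      have e : (N : ℚ) * (p + c w k) = ((N * p + z : ℤ) : ℚ) := by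
        rw [mul_add, hz]; push_cast; ring
      rw [div_le_iff₀ hN', mul_comm _ (N : ℚ), e, Int.cast_le, Int.ceil_le, ← e,
        mul_le_mul_iff_right₀ hN']
    unfold V
    simp only [key]
  x_smul α g := by
    constructor
    · intro h
      rw [V_eq_genSpan] at h ⊢
      have := T_smul_mem (t := Set.Ici α) (-1) (fun γ (hγ : α + 1 ≤ γ) => by
        rw [Set.mem_Ici]; push_cast; linarith) h
      rw [xVar, T_smul_T_smul] at this
      simpa using this
    · rw [V_eq_genSpan, V_eq_genSpan]
      exact T_smul_mem 1 (fun γ (hγ : α ≤ γ) => by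
        rw [Set.mem_Ici]; push_cast; linarith)
  finite_type α := by
    classical
    -- For each k the generator is the lowest power of x allowed, with exponent ⌈α - c_k⌉.
    refine ⟨Finset.univ.image fun k : Fin (mu w) =>
      (LaurentPolynomial.T ⌈α - c w k⌉ : CXTheta) • omega w k, ?_⟩
    unfold V
    congr 1
    ext g
    simp only [Set.mem_ofPred_eq, Finset.mem_image, Finset.mem_univ, true_and]
    constructor
    · rintro ⟨k, p, hp, rfl⟩
      have h1 : ⌈α - c w k⌉ ≤ p := Int.ceil_le.mpr (by linarith)
      obtain ⟨q, hq⟩ := Int.eq_ofNat_of_zero_le (sub_nonneg.mpr h1)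
      refine ⟨q, _, ⟨k, rfl⟩, ?_⟩
      rw [T_pow_smul, T_smul_T_smul]
      congr 2
      omega
    · rintro ⟨q, _, ⟨k, rfl⟩, rfl⟩
      refine ⟨k, q + ⌈α - c w k⌉, ?_, by rw [T_pow_smul, T_smul_T_smul]⟩
      have := Int.le_ceil (α - c w k)
      push_cast
      have hq : (0 : ℚ) ≤ q := by positivity
      linarith
  x_stable α g hg := nablaXEuler_mem hn hw hw₀ (isUpperSet_Ici α) hg
  theta_stable α g hg := nablaThetaEuler_mem hn hw hw₀ (isUpperSet_Ici α) hg
  nilpotent α := ⟨mu w, nilpotent_V hn hw hw₀ α⟩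

end GenSpan

/-! ### Uniqueness of the Kashiwara–Malgrange filtration -/

section Uniqueness

open Polynomial

variable {n : ℕ} {w : Fin (n + 1) → ℕ} {U U' : ℚ → Submodule CTheta (GaussManin w)}

variable (w) in
/-- `x ∇_{∂_x}`, as a `ℂ`-linear endomorphism. -/
def EulerOp : Module.End ℂ (GaussManin w) where
  toFun := nablaXEuler w
  map_add' := nablaXEuler_add w
  map_smul' z g := by
    rw [← algebraMap_smul CTheta z g, nablaXEuler_smul_theta, algebraMap_smul]
    rfl

theorem aeval_mem {W : Submodule CTheta (GaussManin w)} (hW : ∀ g ∈ W, nablaXEuler w g ∈ W)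
    (p : ℂ[X]) {g : GaussManin w} (hg : g ∈ W) : aeval (EulerOp w) p g ∈ W := by
  induction p using Polynomial.induction_on' generalizing g with
  | add p q hp hq => rw [map_add]; exact add_mem (hp hg) (hq hg)
  | monomial k z =>
    rw [aeval_monomial, Module.End.mul_apply, Module.algebraMap_end_apply]
    refine W.smul_of_tower_mem _ ?_
    induction k with
    | zero => simpa using hg
    | succ k ih => rw [pow_succ', Module.End.mul_apply]; exact hW _ ih

namespace IsKashiwaraMalgrange

theorem x_pow_smul (hU : IsKashiwaraMalgrange w U) (p : ℕ) (α : ℚ) (g : GaussManin w) :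
    xVar ^ p • g ∈ U (α + p) ↔ g ∈ U α := by
  induction p with
  | zero => simp
  | succ p ih =>
    rw [pow_succ', mul_smul, Nat.cast_succ, ← add_assoc, hU.x_smul, ih]

theorem Vgt_le (hU : IsKashiwaraMalgrange w U) {N : ℕ} (hN : 0 < N)
    (h : ∀ α : ℚ, U α = U ((⌈(N : ℚ) * α⌉ : ℚ) / N)) (z : ℤ) :
    Vgt U ((z : ℚ) / N) ≤ U (((z + 1 : ℤ) : ℚ) / N) := by
  have hN' : (0 : ℚ) < N := by exact_mod_cast hN
  refine iSup_le fun β => ?_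
  rw [h β]
  apply hU.antitone
  have h1 : z < ⌈(N : ℚ) * β⌉ := by
    rw [Int.lt_ceil]
    have := β.2
    rw [Set.mem_Ioi, div_lt_iff₀ hN'] at this
    linarith
  gcongr
  exact_mod_cast h1

/-- U^α has finitely many generators over ℂ[x, θ, θ⁻¹]. U' is exhaustive, so one step of it contains
them all, and it is stable under x. -/
theorem exists_le (hU : IsKashiwaraMalgrange w U) (hU' : IsKashiwaraMalgrange w U') (α : ℚ) :
    ∃ β, U α ≤ U' β := by
  obtain ⟨s, hs⟩ := hU.finite_type α
  have h1 : ∃ β, ∀ h ∈ s, h ∈ U' β := by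
    classical
    clear hs
    induction s using Finset.induction_on with
    | empty => exact ⟨0, by simp⟩
    | insert h s _ ih =>
      obtain ⟨β, hβ⟩ := ih
      obtain ⟨γ, hγ⟩ := hU'.exhaustive h
      refine ⟨min β γ, fun h' hh' => ?_⟩
      rcases Finset.mem_insert.mp hh' with rfl | hh'
      · exact hU'.antitone (min_le_right _ _) hγ
      · exact hU'.antitone (min_le_left _ _) (hβ _ hh')
  obtain ⟨β, hβ⟩ := h1
  refine ⟨β, ?_⟩
  rw [hs, Submodule.span_le]
  rintro _ ⟨p, h, hh, rfl⟩
  refine hU'.antitone ?_ ((hU'.x_pow_smul p β h).mpr (hβ h hh))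
  simp

/-- The product of the (X - γ)^m over j consecutive grid points γ ≥ z/N raises the filtration by
j/N. Its roots are at least z/N, whence the nonvanishing below z/N. -/
theorem exists_poly (hU : IsKashiwaraMalgrange w U) {N : ℕ} (hN : 0 < N)
    (h : ∀ α : ℚ, U α = U ((⌈(N : ℚ) * α⌉ : ℚ) / N)) (z : ℤ) (j : ℕ) :
    ∃ q : ℂ[X], (∀ γ : ℚ, γ < (z : ℚ) / N → q.eval (γ : ℂ) ≠ 0) ∧
      ∀ g ∈ U ((z : ℚ) / N), aeval (EulerOp w) q g ∈ U (((z + j : ℤ) : ℚ) / N) := by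
  have hN' : (0 : ℚ) < N := by exact_mod_cast hN
  induction j with
  | zero => exact ⟨1, by simp, by simp⟩
  | succ j ih =>
    obtain ⟨q, hq, hq'⟩ := ih
    obtain ⟨m, hm⟩ := hU.nilpotent (((z + j : ℤ) : ℚ) / N)
    refine ⟨(X - C ((((z + j : ℤ) : ℚ) / N : ℚ) : ℂ)) ^ m * q, fun γ hγ => ?_, fun g hg => ?_⟩
    · rw [eval_mul, eval_pow]
      refine mul_ne_zero (pow_ne_zero _ ?_) (hq γ hγ)
      rw [eval_sub, eval_X, eval_C, sub_ne_zero]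
      have : γ < ((z + j : ℤ) : ℚ) / N := hγ.trans_le (by gcongr; simp)
      exact_mod_cast this.ne
    · rw [map_mul, Module.End.mul_apply, map_pow, Module.End.pow_apply]
      have h1 := hU.Vgt_le hN h _ (hm _ (hq' g hg))
      rw [Nat.cast_succ, ← add_assoc]
      convert h1 using 3
      rw [map_sub, aeval_X, aeval_C]
      rfl

/-- Taking j = pN raises U^{z/N} by p, into x^p U^{z/N}. This lies in x^p U'^β = U'^{β+p}, and p is
chosen with β + p ≥ z/N. -/
theorem exists_poly_le (hU : IsKashiwaraMalgrange w U) (hU' : IsKashiwaraMalgrange w U') {N : ℕ}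
    (hN : 0 < N) (h : ∀ α : ℚ, U α = U ((⌈(N : ℚ) * α⌉ : ℚ) / N)) (z : ℤ) :
    ∃ q : ℂ[X], (∀ γ : ℚ, γ < (z : ℚ) / N → q.eval (γ : ℂ) ≠ 0) ∧
      ∀ g ∈ U ((z : ℚ) / N), aeval (EulerOp w) q g ∈ U' ((z : ℚ) / N) := by
  have hN' : (N : ℚ) ≠ 0 := by exact_mod_cast hN.ne'
  obtain ⟨β, hβ⟩ := hU.exists_le hU' ((z : ℚ) / N)
  obtain ⟨p, hp⟩ := exists_nat_ge ((z : ℚ) / N - β)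
  obtain ⟨q, hq, hq'⟩ := hU.exists_poly hN h z (p * N)
  refine ⟨q, hq, fun g hg => ?_⟩
  have h1 := hq' g hg
  have h2 : ((z + (p * N : ℕ) : ℤ) : ℚ) / N = (z : ℚ) / N + p := by
    push_cast
    field_simp
  rw [h2] at h1
  have h3 : xVar ^ p • (LaurentPolynomial.T (-p : ℤ) : CXTheta) • aeval (EulerOp w) q g =
      aeval (EulerOp w) q g := by
    rw [T_pow_smul, T_smul_T_smul]
    simp
  rw [← h3, hU.x_pow_smul] at h1
  rw [← h3]
  exact hU'.antitone (by linarith) ((hU'.x_pow_smul p β _).mpr (hβ h1))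

/-- An element g of U^α lies in some U'^β and climbs the grid of U' up to α. At a level y/N' < α,
both q(E) g, with E = x∇_{∂_x} and q from `exists_poly_le`, and (E - y/N')^m g lie in the next step.
The two polynomials are coprime, so g is a combination of these elements with coefficients
polynomial in E. -/
protected theorem le (hU : IsKashiwaraMalgrange w U) (hU' : IsKashiwaraMalgrange w U') :
    U ≤ U' := by
  intro α
  obtain ⟨N, hN, h⟩ := hU.discrete
  obtain ⟨N', hN', h'⟩ := hU'.discrete
  have hNq : (0 : ℚ) < N := by exact_mod_cast hN
  have hNq' : (0 : ℚ) < N' := by exact_mod_cast hN'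
  suffices H : ∀ z : ℤ, U ((z : ℚ) / N) ≤ U' ((z : ℚ) / N) by
    rw [h α]
    refine (H _).trans (hU'.antitone ?_)
    rw [le_div_iff₀ hNq, mul_comm]
    exact Int.le_ceil _
  clear α
  intro z g hg
  set α := (z : ℚ) / N with hα
  obtain ⟨q, hq, hq'⟩ := hU.exists_poly_le hU' hN h z
  have step : ∀ y : ℤ, y < ⌈(N' : ℚ) * α⌉ → g ∈ U' ((y : ℚ) / N') →
      g ∈ U' (((y + 1 : ℤ) : ℚ) / N') := by
    intro y hy hgy
    obtain ⟨m, hm⟩ := hU'.nilpotent ((y : ℚ) / N')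
    have hyα : (y : ℚ) / N' < α := by
      rw [div_lt_iff₀ hNq', mul_comm]
      exact Int.lt_ceil.mp hy
    -- The linear factor is irreducible, and q does not vanish at y/N' < α.
    have hcop : IsCoprime q ((X - C (((y : ℚ) / N' : ℚ) : ℂ)) ^ m) := by
      refine IsCoprime.pow_right ?_
      refine ((irreducible_X_sub_C _).coprime_iff_not_dvd.mpr ?_).symm
      rw [dvd_iff_isRoot]
      exact hq _ hyα
    obtain ⟨a, b, hab⟩ := hcop
    have h1 : g = aeval (EulerOp w) a (aeval (EulerOp w) q g) + aeval (EulerOp w) b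
        (aeval (EulerOp w) ((X - C (((y : ℚ) / N' : ℚ) : ℂ)) ^ m) g) := by
      rw [← Module.End.mul_apply, ← Module.End.mul_apply, ← map_mul, ← map_mul,
        ← LinearMap.add_apply, ← map_add, hab, map_one, Module.End.one_apply]
    rw [h1]
    refine add_mem (aeval_mem (hU'.x_stable _) _ ?_) (aeval_mem (hU'.x_stable _) _ ?_)
    · have h2 := hq' g hg
      rw [h'] at h2
      refine hU'.antitone ?_ h2
      gcongr
      exact Int.cast_le.mpr hy
    · refine hU'.Vgt_le hN' h' y ?_
      have h2 := hm g hgy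
      rw [map_pow, Module.End.pow_apply, map_sub, aeval_X, aeval_C]
      exact h2
  obtain ⟨β, hβ⟩ := hU.exists_le hU' α
  have h0 := hβ hg
  rw [h'] at h0
  rw [h']
  rcases le_total ⌈(N' : ℚ) * β⌉ ⌈(N' : ℚ) * α⌉ with hle | hle
  · have : ∀ y : ℤ, ⌈(N' : ℚ) * β⌉ ≤ y → y ≤ ⌈(N' : ℚ) * α⌉ → g ∈ U' ((y : ℚ) / N') := by
      intro y hy
      induction y, hy using Int.leInduction with
      | base => exact fun _ => h0
      | succ y _ ih => exact fun hy' => step y (by omega) (ih (by omega))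
    exact this _ hle le_rfl
  · exact hU'.antitone (by gcongr) h0

end IsKashiwaraMalgrange

theorem isKashiwaraMalgrange_iff (hn : 0 < n) (hw : ∀ i, 0 < w i) (hw₀ : w 0 = 1)
    (U : ℚ → Submodule CTheta (GaussManin w)) : IsKashiwaraMalgrange w U ↔ U = V w := by
  have hV := isKashiwaraMalgrange_V hn hw hw₀
  refine ⟨fun hU => le_antisymm (hU.le hV) (hV.le hU), ?_⟩
  rintro rfl
  exact hV

end Uniqueness

/-! ### The basis of `Ḡ` -/

section GBarBasis

variable {n : ℕ} {w : Fin (n + 1) → ℕ}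

theorem V_induction {α : ℚ} {P : ∀ g, g ∈ V w α → Prop}
    (gen : ∀ (k : Fin (mu w)) (p : ℤ) (hp : α ≤ p + c w k),
      P ((LaurentPolynomial.T p : CXTheta) • omega w k) (T_smul_omega_mem_V k p hp))
    (zero : P 0 (zero_mem _))
    (add : ∀ g h hg hh, P g hg → P h hh → P (g + h) (add_mem hg hh))
    (smul : ∀ (r : CTheta) g hg, P g hg → P (r • g) (Submodule.smul_mem _ r hg))
    {g : GaussManin w} (hg : g ∈ V w α) : P g hg := by
  refine Submodule.span_induction (p := P) ?_ zero add smul hg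
  rintro _ ⟨k, p, hp, rfl⟩
  exact gen k p hp

/-- The class in `Ḡ`, as a linear map. -/
def gclsLin (α : Set.Ico (0 : ℚ) 1) : V w α →ₗ[CTheta] GBar w :=
  (DirectSum.lof CTheta (Set.Ico (0 : ℚ) 1) (fun α : Set.Ico (0 : ℚ) 1 => Gr w α) α).comp
    (Gr.mk w α)

theorem gcls_add {α : Set.Ico (0 : ℚ) 1} {g h : GaussManin w} (hg : g ∈ V w α) (hh : h ∈ V w α)
    (hgh : g + h ∈ V w α) : gcls α ⟨g + h, hgh⟩ = gcls α ⟨g, hg⟩ + gcls α ⟨h, hh⟩ :=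
  map_add (gclsLin α) ⟨g, hg⟩ ⟨h, hh⟩

theorem gcls_smul {α : Set.Ico (0 : ℚ) 1} {g : GaussManin w} (r : CTheta) (hg : g ∈ V w α)
    (hrg : r • g ∈ V w α) : gcls α ⟨r • g, hrg⟩ = r • gcls α ⟨g, hg⟩ :=
  map_smul (gclsLin α) r ⟨g, hg⟩

theorem gcls_complex_smul {α : Set.Ico (0 : ℚ) 1} {g : GaussManin w} (z : ℂ) (hg : g ∈ V w α)
    (hzg : z • g ∈ V w α) : gcls α ⟨z • g, hzg⟩ = z • gcls α ⟨g, hg⟩ := by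
  rw [← algebraMap_smul CTheta z (gcls α _), ← gcls_smul _ hg
    (by rw [algebraMap_smul]; exact hzg)]
  congr 2
  exact (algebraMap_smul CTheta z g).symm

theorem gcls_eq_zero {α : Set.Ico (0 : ℚ) 1} {g : GaussManin w} (hg : g ∈ V w α)
    (hg' : g ∈ Vgt (V w) α) : gcls α ⟨g, hg⟩ = 0 := by
  have : Gr.mk w α ⟨g, hg⟩ = 0 := (Submodule.Quotient.mk_eq_zero _).mpr hg'
  rw [gcls, this]
  exact map_zero _

theorem gcls_zero {α : Set.Ico (0 : ℚ) 1} (h : (0 : GaussManin w) ∈ V w α) :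
    gcls α ⟨0, h⟩ = 0 := gcls_eq_zero h (zero_mem _)

theorem gcls_omega {α : Set.Ico (0 : ℚ) 1} {k : Fin (mu w)} (h : omega w k ∈ V w α)
    (hα : (α : ℚ) = c w k) : gcls α ⟨omega w k, h⟩ = omegaBar w k := by
  obtain rfl : α = ⟨c w k, c_mem w k⟩ := Subtype.ext hα
  rfl

theorem int_eq_zero_of_mem_Ico {x : ℚ} {p : ℤ} (α : Set.Ico (0 : ℚ) 1) (hx : x ∈ Set.Ico (0 : ℚ) 1)
    (h : (α : ℚ) = p + x) : p = 0 := by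
  have h1 := α.2.1
  have h2 := α.2.2
  have h3 := hx.1
  have h4 := hx.2
  have h5 : (-1 : ℚ) < p := by linarith
  have h6 : (p : ℚ) < 1 := by linarith
  have h5' : -1 < p := by exact_mod_cast h5
  have h6' : p < 1 := by exact_mod_cast h6
  omega

theorem int_nonneg_of_le {x : ℚ} {p : ℤ} (α : Set.Ico (0 : ℚ) 1) (hx : x ∈ Set.Ico (0 : ℚ) 1)
    (h : (α : ℚ) ≤ p + x) : 0 ≤ p := by
  have h1 := α.2.1
  have h4 := hx.2
  have h5 : (-1 : ℚ) < p := by linarith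
  have h5' : -1 < p := by exact_mod_cast h5
  omega

/-- Both α and c_k lie in [0, 1), so α = p + c_k forces p = 0; any other generator of V^α has larger
index and dies in the quotient. -/
theorem gcls_T_smul {α : Set.Ico (0 : ℚ) 1} {k : Fin (mu w)} {p : ℤ} (hp : (α : ℚ) ≤ p + c w k)
    (h : (LaurentPolynomial.T p : CXTheta) • omega w k ∈ V w α) :
    gcls α ⟨(LaurentPolynomial.T p : CXTheta) • omega w k, h⟩ =
      if (α : ℚ) = p + c w k then omegaBar w k else 0 := by
  split_ifs with heq
  · obtain rfl := int_eq_zero_of_mem_Ico α (c_mem w k) heq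
    have h' : (LaurentPolynomial.T 0 : CXTheta) • omega w k = omega w k := by simp
    rw [← gcls_omega (h' ▸ h) (by simpa using heq)]
    congr 2
  · refine gcls_eq_zero h ?_
    rw [Vgt_V]
    exact T_smul_omega_mem k p (lt_of_le_of_ne hp heq)

variable (w) in
theorem omegaBar_span : ⊤ ≤ Submodule.span CTheta (Set.range (omegaBar w)) := by
  intro x _
  induction x using DirectSum.induction_on with
  | zero => exact zero_mem _
  | add x y hx hy => exact add_mem (hx trivial) (hy trivial)
  | of α x =>
    obtain ⟨⟨g, hg⟩, rfl⟩ := Submodule.mkQ_surjective _ x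
    change gcls α ⟨g, hg⟩ ∈ _
    induction hg using V_induction with
    | gen k p hp =>
      rw [gcls_T_smul hp]
      split_ifs
      · exact Submodule.subset_span ⟨k, rfl⟩
      · exact zero_mem _
    | zero => rw [gcls_zero]; exact zero_mem _
    | add g h hg' hh' hg hh => rw [gcls_add hg' hh']; exact add_mem (hg trivial) (hh trivial)
    | smul r g hg' hg => rw [gcls_smul r hg']; exact Submodule.smul_mem _ _ (hg trivial)

/-- The coefficient of `x^p`. -/
def coeffX (p : ℤ) : CXTheta →ₗ[CTheta] CTheta where
  toFun f := f.coeff p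
  map_add' f g := by simp
  map_smul' r f := by simp

variable (hn : 0 < n) (hw : ∀ i, 0 < w i) (hw₀ : w 0 = 1)

/-- The `x^0`-coordinates, with respect to the `ω_k` with `c_k = α`. -/
def gradedCoord (α : ℚ) : GaussManin w →ₗ[CTheta] (Fin (mu w) → CTheta) :=
  LinearMap.pi fun k => if c w k = α then
    coeffX 0 ∘ₗ ((omegaBasis hn hw hw₀).coord k).restrictScalars CTheta else 0

theorem gradedCoord_T_smul (α : ℚ) (k : Fin (mu w)) (p : ℤ) :
    gradedCoord hn hw hw₀ α ((LaurentPolynomial.T p : CXTheta) • omega w k) =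
      if c w k = α ∧ p = 0 then Pi.single k 1 else 0 := by
  classical
  funext l
  rw [← omegaBasis_apply hn hw hw₀, gradedCoord, LinearMap.pi_apply]
  by_cases hl : l = k
  · subst hl
    by_cases hα : c w l = α
    · rw [if_pos hα]
      simp only [LinearMap.comp_apply, LinearMap.restrictScalars_apply, map_smul,
        Module.Basis.coord_apply, Module.Basis.repr_self, Finsupp.single_eq_same, smul_eq_mul,
        mul_one]
      change (LaurentPolynomial.T p : CXTheta).coeff 0 = _
      rw [LaurentPolynomial.T, AddMonoidAlgebra.coeff_single, Finsupp.single_apply]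
      by_cases hp : p = 0 <;> simp [hp, hα]
    · simp [hα]
  · have h1 : (if c w k = α ∧ p = 0 then Pi.single k 1 else 0 : Fin (mu w) → CTheta) l = 0 := by
      split_ifs
      · exact Pi.single_eq_of_ne hl _
      · rfl
    rw [h1]
    split_ifs
    · simp only [LinearMap.comp_apply, LinearMap.restrictScalars_apply, map_smul,
        Module.Basis.coord_apply, Module.Basis.repr_self, Finsupp.single_eq_of_ne hl, smul_zero,
        map_zero]
    · rfl

/-- The coordinates of an element of `Ḡ`. -/
def gbarCoord : GBar w →ₗ[CTheta] (Fin (mu w) → CTheta) :=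
  DirectSum.toModule CTheta _ _ fun α : Set.Ico (0 : ℚ) 1 =>
    ((Vgt (V w) α).comap (V w α).subtype).liftQ (gradedCoord hn hw hw₀ α ∘ₗ (V w α).subtype) (by
      rintro ⟨g, hg'⟩ hg
      rw [Submodule.mem_comap, Vgt_V] at hg
      change gradedCoord hn hw hw₀ α g = 0
      change g ∈ _ at hg
      clear hg'
      induction hg using Submodule.span_induction with
      | mem g hg =>
        obtain ⟨k, p, hp, rfl⟩ := hg
        rw [gradedCoord_T_smul, if_neg]
        rintro ⟨h1, rfl⟩
        rw [Set.mem_Ioi, h1] at hp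
        simp at hp
      | zero => rw [map_zero]
      | add g h _ _ hg hh => rw [map_add, hg, hh, add_zero]
      | smul r g _ hg => rw [map_smul, hg, smul_zero])

theorem gbarCoord_gcls (α : Set.Ico (0 : ℚ) 1) (g : V w α) :
    gbarCoord hn hw hw₀ (gcls α g) = gradedCoord hn hw hw₀ α g := by
  rw [gbarCoord, gcls]
  erw [DirectSum.toModule_lof]
  rfl

include hn hw hw₀ in
-- The x⁰-coordinates with c_k = α vanish on V^{>α}, so they descend to `gbarCoord`, which sends
-- [ω_k] to the k-th standard vector.
theorem omegaBar_linearIndependent : LinearIndependent CTheta (omegaBar w) := by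
  refine LinearIndependent.of_comp (gbarCoord hn hw hw₀) ?_
  have : (gbarCoord hn hw hw₀ ∘ omegaBar w) = Pi.basisFun CTheta (Fin (mu w)) := by
    funext k
    rw [Function.comp_apply, omegaBar, gbarCoord_gcls, Pi.basisFun_apply]
    have := gradedCoord_T_smul hn hw hw₀ (c w k) k 0
    simpa using this
  rw [this]
  exact (Pi.basisFun CTheta (Fin (mu w))).linearIndependent

/-- The basis `[ω₀], …, [ω_{μ-1}]` of `Ḡ`. -/
def gbarBasis : Module.Basis (Fin (mu w)) CTheta (GBar w) :=
  Module.Basis.mk (omegaBar_linearIndependent hn hw hw₀) (omegaBar_span w)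

theorem gbarBasis_apply (k : Fin (mu w)) : gbarBasis hn hw hw₀ k = omegaBar w k := by
  rw [gbarBasis, Module.Basis.mk_apply]

end GBarBasis

/-! ### The limit of the connection -/

section LimitConnection

variable {n : ℕ} {w : Fin (n + 1) → ℕ} (hn : 0 < n) (hw : ∀ i, 0 < w i) (hw₀ : w 0 = 1)

/-- The operator `∇̄_{θ∂_θ}`. -/
def nablaBar : GBar w →ₗ[ℂ] GBar w :=
  connOp (gbarBasis hn hw hw₀) (thetaDer : CTheta →ₗ[ℂ] CTheta) fun k =>
    ∑ j, (ABar w j k • tau + AInf w j k • (1 : CTheta)) • gbarBasis hn hw hw₀ j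

theorem thetaDer_mul (f g : CTheta) :
    (thetaDer : CTheta →ₗ[ℂ] CTheta) (f * g) =
      (thetaDer : CTheta →ₗ[ℂ] CTheta) f * g + f * (thetaDer : CTheta →ₗ[ℂ] CTheta) g := by
  change thetaDer (f * g) = thetaDer f * g + f * thetaDer g
  rw [Derivation.leibniz, smul_eq_mul, smul_eq_mul]
  ring

theorem nablaBar_smul (f : CTheta) (h : GBar w) :
    nablaBar hn hw hw₀ (f • h) = thetaDer f • h + f • nablaBar hn hw hw₀ h :=
  connOp_smul _ _ _ thetaDer_mul f h

theorem nablaBar_basis (k : Fin (mu w)) : nablaBar hn hw hw₀ (gbarBasis hn hw hw₀ k) =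
    ∑ j, (ABar w j k • tau + AInf w j k • (1 : CTheta)) • gbarBasis hn hw hw₀ j :=
  connOp_basis _ _ _ thetaDer_mul k

theorem ABar_sum {M : Type*} [AddCommGroup M] [Module CTheta M] (v : Fin (mu w) → M)
    (k : Fin (mu w)) :
    ∑ j, (ABar w j k • tau + AInf w j k • (1 : CTheta)) • v j =
      (algebraMap ℂ CTheta ((alpha w k : ℚ) : ℂ)) • v k + if h : (k : ℕ) + 1 < mu w then
        if c w (k + 1) = c w k then (algebraMap ℂ CTheta (mu w : ℂ)) • tau • v ⟨k + 1, h⟩ else 0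
      else 0 := by
  simp only [add_smul, Finset.sum_add_distrib]
  rw [add_comm]
  congr 1
  · rw [Finset.sum_eq_single_of_mem k (Finset.mem_univ k)]
    · rw [AInf, Matrix.diagonal_apply_eq, ← Algebra.algebraMap_eq_smul_one]
    · intro j _ hj
      rw [AInf, Matrix.diagonal_apply_ne _ hj, zero_smul, zero_smul]
  · split_ifs with h hc
    · rw [Finset.sum_eq_single_of_mem ⟨k + 1, h⟩ (Finset.mem_univ _)]
      · rw [ABar, Matrix.of_apply, if_pos ⟨rfl, hc⟩, Algebra.smul_def, mul_smul]
      · intro j _ hj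
        rw [ABar, Matrix.of_apply, if_neg fun hh => hj (Fin.ext hh.1), zero_smul, zero_smul]
    · refine Finset.sum_eq_zero fun j _ => ?_
      rw [ABar, Matrix.of_apply, if_neg, zero_smul, zero_smul]
      rintro ⟨hj, hc'⟩
      rw [hj] at hc'
      exact hc hc'
    · refine Finset.sum_eq_zero fun j _ => ?_
      rw [ABar, Matrix.of_apply, if_neg, zero_smul, zero_smul]
      rintro ⟨hj, -⟩
      exact h (hj ▸ j.2)

/-- From ∇_{θ∂_θ} ω_k = α_k ω_k + μ τ ω_{k+1}: the second term has class [ω_{k+1}] when c_{k+1} =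
c_k, and class 0 when c_{k+1} > c_k or k + 1 = μ, for then ω_{k+1} lies in V^{>c_k}. -/
theorem isLimitConnection_nablaBar : IsLimitConnection w (nablaBar hn hw hw₀) := by
  have hmem : ∀ {α : ℚ} {g : GaussManin w}, g ∈ V w α → nablaThetaEuler w g ∈ V w α :=
    fun {α} {g} hg => nablaThetaEuler_mem hn hw hw₀ (isUpperSet_Ici α) hg
  rintro α ⟨g, hg⟩
  refine ⟨hmem hg, ?_⟩
  induction hg using V_induction with
  | gen k p hp =>
    have hgV : (LaurentPolynomial.T p : CXTheta) • omega w k ∈ V w α := T_smul_omega_mem_V k p hp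
    rw [gcls_T_smul hp]
    split_ifs with heq
    · obtain rfl := int_eq_zero_of_mem_Ico α (c_mem w k) heq
      have hα : (α : ℚ) = c w k := by simpa using heq
      have hk : omega w k ∈ V w α := by simpa using hgV
      have hk1 : omega w (k + 1) ∈ V w α := by
        rw [V_eq_genSpan]
        have := T_smul_omega_succ_mem hw hw₀ (isUpperSet_Ici (α : ℚ)) k 0 hp
        simpa using this
      have e1 : nablaThetaEuler w ((LaurentPolynomial.T 0 : CXTheta) • omega w k) =
          ((alpha w k : ℚ) : ℂ) • omega w k + (mu w : ℂ) • tau • omega w (k + 1) := by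
        rw [LaurentPolynomial.T_zero, one_smul, nablaThetaEuler_omega' hn hw hw₀]
      have h1 := Submodule.smul_of_tower_mem (V w α) ((alpha w k : ℚ) : ℂ) hk
      have h2 := Submodule.smul_mem (V w α) tau hk1
      have h3 := Submodule.smul_of_tower_mem (V w α) (mu w : ℂ) h2
      have e2 : gcls α ⟨nablaThetaEuler w ((LaurentPolynomial.T 0 : CXTheta) • omega w k),
          hmem hgV⟩ = ((alpha w k : ℚ) : ℂ) • omegaBar w k +
            (mu w : ℂ) • tau • gcls α ⟨omega w (k + 1), hk1⟩ := by
        rw [← gcls_omega hk hα, ← gcls_complex_smul _ hk h1, ← gcls_smul _ hk1 h2,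
          ← gcls_complex_smul _ h2 h3, ← gcls_add h1 h3 (add_mem h1 h3)]
        congr 2
      rw [e2, ← gbarBasis_apply hn hw hw₀, nablaBar_basis, ABar_sum, algebraMap_smul]
      congr 1
      split_ifs with h hc
      · rw [algebraMap_smul, gbarBasis_apply]
        congr 2
        exact (gcls_omega (k := ⟨k + 1, h⟩) hk1 (hα.trans hc.symm)).symm
      · rw [gcls_eq_zero, smul_zero, smul_zero]
        rw [Vgt_V]
        have := T_smul_omega_mem (s := Set.Ioi (α : ℚ)) ⟨k + 1, h⟩ 0 (by
          rw [Set.mem_Ioi, hα, Int.cast_zero, zero_add]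
          exact lt_of_le_of_ne (c_mono hw (Nat.le_succ k) h) (Ne.symm hc))
        simpa using this
      · have hk' : (k : ℕ) + 1 = mu w := by have := k.2; omega
        rw [gcls_eq_zero, smul_zero, smul_zero]
        have h0 : 0 < mu w := (Nat.zero_le _).trans_lt k.2
        rw [Vgt_V, hk', omega_mu hw hw₀]
        refine Submodule.smul_of_tower_mem _ _ (T_smul_omega_mem ⟨0, h0⟩ _ ?_)
        have h1 := α.2.2
        have h2 := (c_mem w 0).1
        rw [Set.mem_Ioi]
        push_cast
        linarith
    · rw [map_zero, gcls_eq_zero]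
      rw [Vgt_V]
      exact nablaThetaEuler_mem hn hw hw₀ (isUpperSet_Ioi _)
        (T_smul_omega_mem k p (lt_of_le_of_ne hp heq))
  | zero =>
    rw [gcls_zero, map_zero, gcls_eq_zero]
    rw [Vgt_V]
    exact nablaThetaEuler_mem hn hw hw₀ (isUpperSet_Ioi _) (zero_mem _)
  | add g h hg' hh' hg hh =>
    rw [gcls_add hg' hh', map_add, hg, hh, ← gcls_add _ _ (add_mem (hmem hg') (hmem hh'))]
    congr 2
    exact (nablaThetaEuler_add w g h).symm
  | smul r g hg' hg =>
    have h1 := Submodule.smul_mem (V w α) (thetaDer r) hg'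
    have h2 := Submodule.smul_mem (V w α) r (hmem hg')
    rw [gcls_smul r hg', nablaBar_smul, hg, ← gcls_smul _ _ h1, ← gcls_smul _ _ h2,
      ← gcls_add _ _ (add_mem h1 h2)]
    congr 2
    exact (nablaThetaEuler_smul_theta w r g).symm

end LimitConnection

/-! ### The pairing and its limit -/

section Pairing

/-- The sesquilinear pairing with given values on a basis. -/
def sesqOfBasis {R ι H : Type*} [CommRing R] [AddCommGroup H] [Module R H] [Fintype ι]
    (σ : R →+* R) (b : Module.Basis ι R H) (s : ι → ι → R) : H →ₗ[R] H →ₛₗ[σ] R :=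
  LinearMap.mk₂'ₛₗ (RingHom.id R) σ (fun x y => ∑ i, ∑ j, b.repr x i * σ (b.repr y j) * s i j)
    (fun x x' y => by
      simp only [map_add, Finsupp.add_apply, add_mul, Finset.sum_add_distrib])
    (fun r x y => by
      simp only [map_smul, Finsupp.smul_apply, smul_eq_mul, Finset.mul_sum, RingHom.id_apply,
        mul_assoc])
    (fun x y y' => by
      simp only [map_add, Finsupp.add_apply, add_mul, mul_add, Finset.sum_add_distrib])
    (fun r x y => by
      simp only [map_smul, Finsupp.smul_apply, smul_eq_mul, Finset.mul_sum, map_mul]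
      refine Finset.sum_congr rfl fun i _ => Finset.sum_congr rfl fun j _ => ?_
      ring)

theorem sesqOfBasis_apply {R ι H : Type*} [CommRing R] [AddCommGroup H] [Module R H] [Fintype ι]
    (σ : R →+* R) (b : Module.Basis ι R H) (s : ι → ι → R) (x y : H) :
    sesqOfBasis σ b s x y = ∑ i, ∑ j, b.repr x i * σ (b.repr y j) * s i j := rfl

theorem sesqOfBasis_basis {R ι H : Type*} [CommRing R] [AddCommGroup H] [Module R H] [Fintype ι]
    (σ : R →+* R) (b : Module.Basis ι R H) (s : ι → ι → R) (i j : ι) :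
    sesqOfBasis σ b s (b i) (b j) = s i j := by
  classical
  rw [sesqOfBasis_apply, Finset.sum_eq_single_of_mem i (Finset.mem_univ i),
    Finset.sum_eq_single_of_mem j (Finset.mem_univ j)]
  · simp
  · intro k _ hk
    simp [Finsupp.single_eq_of_ne hk]
  · intro k _ hk
    simp [Finsupp.single_eq_of_ne hk]

variable {n : ℕ} (w : Fin (n + 1) → ℕ)

/-- The values of the pairing on the `ω_k`. -/
def pairVal (k l : Fin (mu w)) : CXTheta :=
  if (k : ℕ) + l = n then ((∏ i, (w i : ℂ))⁻¹ • theta ^ n) • (1 : CXTheta)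
  else if n + 1 ≤ (k : ℕ) ∧ (k : ℕ) + l = mu w + n then
    ((∏ i, (w i : ℂ) ^ w i)⁻¹ • (∏ i, (w i : ℂ))⁻¹ • theta ^ n) • xVar
  else 0

/-- The coefficient of `θⁿ` in the values of the limit pairing on the `[ω_k]`. -/
def pairCoeff (k l : Fin (mu w)) : ℂ :=
  if (k : ℕ) + l = n then (∏ i, (w i : ℂ))⁻¹
  else if n + 1 ≤ (k : ℕ) ∧ (k : ℕ) + l = mu w + n then (∏ i, (w i : ℂ) ^ (w i + 1))⁻¹
  else 0

variable {w} (hn : 0 < n) (hw : ∀ i, 0 < w i) (hw₀ : w 0 = 1)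

/-- The pairing `S` on `G`. -/
def pairing : GaussManin w →ₗ[CXTheta] GaussManin w →ₛₗ[conjThetaX] CXTheta :=
  sesqOfBasis conjThetaX (omegaBasis hn hw hw₀) (pairVal w)

/-- The pairing `S̄` on `Ḡ`. -/
def pairingBar : GBar w →ₗ[CTheta] GBar w →ₛₗ[conjTheta] CTheta :=
  sesqOfBasis conjTheta (gbarBasis hn hw hw₀) fun k l => pairCoeff w k l • theta ^ n

theorem pairing_omega (k l : Fin (mu w)) :
    pairing hn hw hw₀ (omega w k) (omega w l) = pairVal w k l := by
  rw [← omegaBasis_apply hn hw hw₀, ← omegaBasis_apply hn hw hw₀, pairing, sesqOfBasis_basis]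

theorem pairingBar_omegaBar (k l : Fin (mu w)) :
    pairingBar hn hw hw₀ (omegaBar w k) (omegaBar w l) = pairCoeff w k l • theta ^ n := by
  rw [← gbarBasis_apply hn hw hw₀, ← gbarBasis_apply hn hw hw₀, pairingBar, sesqOfBasis_basis]

theorem isPairing_pairing : IsPairing w (pairing hn hw hw₀) := pairing_omega hn hw hw₀

theorem hasLimitValues_pairingBar : HasLimitValues w (pairingBar hn hw hw₀) := by
  intro k l
  rw [pairingBar_omegaBar, pairCoeff]
  split_ifs
  · rfl
  · rfl
  · rw [zero_smul]

theorem conjThetaX_T (p : ℤ) :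
    conjThetaX (LaurentPolynomial.T p) = LaurentPolynomial.T p := by
  rw [conjThetaX, LaurentPolynomial.T, AddMonoidAlgebra.mapRingHom_single, map_one]

theorem conjThetaX_algebraMap (r : CTheta) :
    conjThetaX (algebraMap CTheta CXTheta r) = algebraMap CTheta CXTheta (conjTheta r) := by
  have h' : ∀ r, algebraMap CTheta CXTheta r = AddMonoidAlgebra.single 0 r := fun _ => rfl
  rw [h', h', conjThetaX, AddMonoidAlgebra.mapRingHom_single]

theorem coeffX_T_mul_smul (p m e : ℤ) (r : CTheta) :
    coeffX m (LaurentPolynomial.T p * r • (LaurentPolynomial.T e : CXTheta)) =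
      if m = p + e then r else 0 := by
  rw [mul_smul_comm, ← LaurentPolynomial.T_add, map_smul]
  change r • (LaurentPolynomial.T (p + e) : CXTheta).coeff m = _
  rw [LaurentPolynomial.T, AddMonoidAlgebra.coeff_single, Finsupp.single_apply]
  by_cases h : m = p + e
  · simp [h]
  · simp [h, Ne.symm h]

theorem pairing_T_smul (k l : Fin (mu w)) (p q : ℤ) :
    pairing hn hw hw₀ ((LaurentPolynomial.T p : CXTheta) • omega w k)
      ((LaurentPolynomial.T q : CXTheta) • omega w l) =
      LaurentPolynomial.T (p + q) * pairVal w k l := by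
  rw [map_smul (pairing hn hw hw₀), LinearMap.smul_apply,
    LinearMap.map_smulₛₗ (pairing hn hw hw₀ _), pairing_omega, conjThetaX_T,
    smul_eq_mul, smul_eq_mul, ← mul_assoc, LaurentPolynomial.T_add]

theorem coeffX_pairing_T_smul (k l : Fin (mu w)) (p q m : ℤ) :
    coeffX m (pairing hn hw hw₀ ((LaurentPolynomial.T p : CXTheta) • omega w k)
      ((LaurentPolynomial.T q : CXTheta) • omega w l)) =
      if (k : ℕ) + l = n then if m = p + q then pairCoeff w k l • theta ^ n else 0
      else if n + 1 ≤ (k : ℕ) ∧ (k : ℕ) + l = mu w + n then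
        if m = p + q + 1 then pairCoeff w k l • theta ^ n else 0
      else 0 := by
  rw [pairing_T_smul, pairVal]
  by_cases h1 : (k : ℕ) + l = n
  · rw [if_pos h1, if_pos h1, ← LaurentPolynomial.T_zero, coeffX_T_mul_smul, add_zero, pairCoeff,
      if_pos h1]
  · rw [if_neg h1, if_neg h1]
    by_cases h2 : n + 1 ≤ (k : ℕ) ∧ (k : ℕ) + l = mu w + n
    · rw [if_pos h2, if_pos h2, xVar, coeffX_T_mul_smul, pairCoeff, if_neg h1, if_pos h2, smul_smul,
        ← mul_inv, ← Finset.prod_mul_distrib]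
      simp only [pow_succ]
    · rw [if_neg h2, if_neg h2, mul_zero, map_zero]

theorem pairingBar_gcls {β γ : Set.Ico (0 : ℚ) 1} {k l : Fin (mu w)} {p q : ℤ}
    (hp : (β : ℚ) ≤ p + c w k) (hq : (γ : ℚ) ≤ q + c w l)
    (hg : (LaurentPolynomial.T p : CXTheta) • omega w k ∈ V w β)
    (hh : (LaurentPolynomial.T q : CXTheta) • omega w l ∈ V w γ) :
    pairingBar hn hw hw₀ (gcls β ⟨_, hg⟩) (gcls γ ⟨_, hh⟩) =
      if (β : ℚ) = p + c w k ∧ (γ : ℚ) = q + c w l then pairCoeff w k l • theta ^ n else 0 := by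
  rw [gcls_T_smul hp, gcls_T_smul hq]
  by_cases h1 : (β : ℚ) = p + c w k <;> by_cases h2 : (γ : ℚ) = q + c w l <;>
    simp [h1, h2, pairingBar_omegaBar]

include hw in
theorem c_of_pairCoeff_ne_zero {k l : Fin (mu w)} (h : pairCoeff w k l ≠ 0) :
    ((k : ℕ) + l = n ∧ c w k = 0 ∧ c w l = 0) ∨
      ((n + 1 ≤ (k : ℕ) ∧ (k : ℕ) + l = mu w + n) ∧ c w k + c w l = 1) := by
  rw [pairCoeff] at h
  split_ifs at h with h1 h2
  · exact Or.inl ⟨h1, c_eq_zero hw k.2 (by omega), c_eq_zero hw l.2 (by omega)⟩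
  · exact Or.inr ⟨h2, c_symm hw k.2 h2.1 h2.2⟩
  · exact absurd rfl h

theorem V_induction₂ {α β : ℚ} {P : ∀ g h, g ∈ V w α → h ∈ V w β → Prop}
    (gen : ∀ (k l : Fin (mu w)) (p q : ℤ) (hp : α ≤ p + c w k) (hq : β ≤ q + c w l),
      P ((LaurentPolynomial.T p : CXTheta) • omega w k)
        ((LaurentPolynomial.T q : CXTheta) • omega w l) (T_smul_omega_mem_V k p hp)
        (T_smul_omega_mem_V l q hq))
    (zero_left : ∀ h hh, P 0 h (zero_mem _) hh) (zero_right : ∀ g hg, P g 0 hg (zero_mem _))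
    (add_left : ∀ g g' h hg hg' hh, P g h hg hh → P g' h hg' hh →
      P (g + g') h (add_mem hg hg') hh)
    (add_right : ∀ g h h' hg hh hh', P g h hg hh → P g h' hg hh' →
      P g (h + h') hg (add_mem hh hh'))
    (smul_left : ∀ (r : CTheta) g h hg hh, P g h hg hh →
      P (r • g) h (Submodule.smul_mem _ r hg) hh)
    (smul_right : ∀ (r : CTheta) g h hg hh, P g h hg hh →
      P g (r • h) hg (Submodule.smul_mem _ r hh))
    {g h : GaussManin w} (hg : g ∈ V w α) (hh : h ∈ V w β) : P g h hg hh := by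
  refine Submodule.span_induction₂ (p := P) ?_ zero_left zero_right add_left add_right smul_left
    smul_right hg hh
  rintro _ _ ⟨k, p, hp, rfl⟩ ⟨l, q, hq, rfl⟩
  exact gen k l p q hp hq

theorem pairing_smul_left (r : CTheta) (g h : GaussManin w) :
    pairing hn hw hw₀ (r • g) h = r • pairing hn hw hw₀ g h := by
  rw [← algebraMap_smul CXTheta r g, map_smul, LinearMap.smul_apply, algebraMap_smul]

theorem pairing_smul_right (r : CTheta) (g h : GaussManin w) :
    pairing hn hw hw₀ g (r • h) = conjTheta r • pairing hn hw hw₀ g h := by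
  rw [← algebraMap_smul CXTheta r h, LinearMap.map_smulₛₗ (pairing hn hw hw₀ g),
    conjThetaX_algebraMap, algebraMap_smul]

/-- The cases β + γ = 0 and β + γ = 1 are treated together. When x^p ω_k and x^q ω_l pair
nontrivially, the only power of x in the value has exponent (p + c_k) + (q + c_l), because c_k + c_l
is 0 or 1 accordingly. This is at least β + γ, with equality exactly when both classes survive. -/
theorem limitPairing_aux {β γ : Set.Ico (0 : ℚ) 1} {e : ℤ} (he : (β : ℚ) + γ = e)
    {g h : GaussManin w} (hg : g ∈ V w β) (hh : h ∈ V w γ) :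
    (∀ m : ℤ, m < e → coeffX m (pairing hn hw hw₀ g h) = 0) ∧
      pairingBar hn hw hw₀ (gcls β ⟨g, hg⟩) (gcls γ ⟨h, hh⟩) =
        coeffX e (pairing hn hw hw₀ g h) := by
  induction hg, hh using V_induction₂ with
  | gen k l p q hp hq =>
    have hp0 := int_nonneg_of_le β (c_mem w k) hp
    have hq0 := int_nonneg_of_le γ (c_mem w l) hq
    rw [pairingBar_gcls hn hw hw₀ hp hq]
    by_cases h0 : pairCoeff w k l = 0
    · simp only [coeffX_pairing_T_smul, h0, zero_smul, ite_self, implies_true, and_self]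
    have hβ := β.2.2
    have hγ := γ.2.2
    rcases c_of_pairCoeff_ne_zero hw h0 with ⟨h1, hk, hl⟩ | ⟨h1, hkl⟩
    · simp only [coeffX_pairing_T_smul, if_pos h1]
      rw [hk, add_zero] at hp
      rw [hl, add_zero] at hq
      have hpq : e ≤ p + q := by
        have : (e : ℚ) ≤ p + q := by linarith
        exact_mod_cast this
      refine ⟨fun m hm => if_neg (by omega), ?_⟩
      congr 1
      rw [hk, hl, add_zero, add_zero, eq_iff_iff]
      constructor
      · rintro ⟨h2, h3⟩
        rw [h2, h3] at he
        exact_mod_cast he.symm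
      · intro h2
        rw [h2] at he
        push_cast at he
        constructor <;> linarith
    · have h2 : ¬ (k : ℕ) + l = n := by omega
      simp only [coeffX_pairing_T_smul, if_neg h2, if_pos h1]
      have hpq : e ≤ p + q + 1 := by
        have : (e : ℚ) ≤ p + q + 1 := by linarith
        exact_mod_cast this
      refine ⟨fun m hm => if_neg (by omega), ?_⟩
      congr 1
      rw [eq_iff_iff]
      constructor
      · rintro ⟨h2, h3⟩
        have : (e : ℚ) = p + q + 1 := by linarith
        exact_mod_cast this
      · intro h2
        rw [h2] at he
        push_cast at he
        constructor <;> linarith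
  | zero_left h hh => simp [gcls_zero]
  | zero_right g hg => simp [gcls_zero]
  | add_left g g' h hg hg' hh h1 h2 =>
    rw [gcls_add hg hg', map_add, map_add, LinearMap.add_apply, LinearMap.add_apply, map_add,
      h1.2, h2.2]
    exact ⟨fun m hm => by rw [map_add, h1.1 m hm, h2.1 m hm, add_zero], rfl⟩
  | add_right g h h' hg hh hh' h1 h2 =>
    rw [gcls_add hh hh', map_add, map_add, map_add, h1.2, h2.2]
    exact ⟨fun m hm => by rw [map_add, h1.1 m hm, h2.1 m hm, add_zero], rfl⟩
  | smul_left r g h hg hh h1 =>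
    rw [gcls_smul r hg, map_smul (pairingBar hn hw hw₀), LinearMap.smul_apply, pairing_smul_left,
      map_smul, h1.2]
    exact ⟨fun m hm => by rw [map_smul, h1.1 m hm, smul_zero], rfl⟩
  | smul_right r g h hg hh h1 =>
    rw [gcls_smul r hh, LinearMap.map_smulₛₗ (pairingBar hn hw hw₀ _), pairing_smul_right, map_smul,
      h1.2]
    exact ⟨fun m hm => by rw [map_smul, h1.1 m hm, smul_zero], rfl⟩

theorem pairingBar_eq_zero {β γ : Set.Ico (0 : ℚ) 1} (h0 : (β : ℚ) + γ ≠ 0) (h1 : (β : ℚ) + γ ≠ 1)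
    {g h : GaussManin w} (hg : g ∈ V w β) (hh : h ∈ V w γ) :
    pairingBar hn hw hw₀ (gcls β ⟨g, hg⟩) (gcls γ ⟨h, hh⟩) = 0 := by
  induction hg, hh using V_induction₂ with
  | gen k l p q hp hq =>
    rw [pairingBar_gcls hn hw hw₀ hp hq]
    split_ifs with h2
    · obtain ⟨h2, h3⟩ := h2
      obtain rfl := int_eq_zero_of_mem_Ico β (c_mem w k) h2
      obtain rfl := int_eq_zero_of_mem_Ico γ (c_mem w l) h3
      by_cases h4 : pairCoeff w k l = 0
      · rw [h4, zero_smul]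
      rw [Int.cast_zero, zero_add] at h2 h3
      rcases c_of_pairCoeff_ne_zero hw h4 with ⟨-, hk, hl⟩ | ⟨-, hkl⟩
      · exact absurd (by rw [h2, h3, hk, hl, add_zero]) h0
      · exact absurd (by rw [h2, h3, hkl]) h1
    · rfl
  | zero_left h hh => simp [gcls_zero]
  | zero_right g hg => simp [gcls_zero]
  | add_left g g' h hg hg' hh h1 h2 =>
    rw [gcls_add hg hg', map_add, LinearMap.add_apply, h1, h2, add_zero]
  | add_right g h h' hg hh hh' h1 h2 => rw [gcls_add hh hh', map_add, h1, h2, add_zero]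
  | smul_left r g h hg hh h1 => rw [gcls_smul r hg, map_smul, LinearMap.smul_apply, h1, smul_zero]
  | smul_right r g h hg hh h1 =>
    rw [gcls_smul r hh, LinearMap.map_smulₛₗ (pairingBar hn hw hw₀ _), h1, smul_zero]

theorem isLimitPairing_pairingBar :
    IsLimitPairing w (pairing hn hw hw₀) (pairingBar hn hw hw₀) := by
  rintro β γ ⟨g, hg⟩ ⟨h, hh⟩
  exact ⟨fun h0 => limitPairing_aux hn hw hw₀ (by rw [h0]; simp) hg hh,
    fun h1 => limitPairing_aux hn hw hw₀ (by rw [h1]; simp) hg hh,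
    fun h0 h1 => pairingBar_eq_zero hn hw hw₀ h0 h1 hg hh⟩

end Pairing

/-! ### The rings `ℂ[θ]` and `ℂ[τ]` -/

section Charts

theorem conjTheta_C (z : ℂ) : conjTheta (LaurentPolynomial.C z) = LaurentPolynomial.C z :=
  LaurentPolynomial.eval₂_C _ _ z

theorem conjTheta_theta : conjTheta theta = -theta := by
  have h := LaurentPolynomial.eval₂_T (LaurentPolynomial.C : ℂ →+* CTheta)
    (-(LaurentPolynomial.isUnit_T (R := ℂ) 1).unit) 1
  rw [zpow_one, Units.val_neg, IsUnit.unit_spec] at h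
  exact h

theorem conjTheta_tau : conjTheta tau = -tau := by
  have h : conjTheta tau * conjTheta theta = 1 := by rw [← map_mul, tau_mul_theta, map_one]
  rw [conjTheta_theta] at h
  calc conjTheta tau = (conjTheta tau * -theta) * -tau := by
        rw [mul_assoc, neg_mul_neg, theta_mul_tau, mul_one]
    _ = -tau := by rw [h, one_mul]

theorem algebraMap_eq_C (z : ℂ) : algebraMap ℂ CTheta z = LaurentPolynomial.C z := rfl

theorem conjTheta_smul (z : ℂ) (f : CTheta) : conjTheta (z • f) = z • conjTheta f := by
  rw [Algebra.smul_def, Algebra.smul_def, map_mul, algebraMap_eq_C, conjTheta_C]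

theorem T_succ_eq (p : ℤ) : (LaurentPolynomial.T (p + 1) : CTheta) = LaurentPolynomial.T p * theta :=
  LaurentPolynomial.T_add p 1

theorem T_pred_eq (p : ℤ) : (LaurentPolynomial.T (p - 1) : CTheta) = LaurentPolynomial.T p * tau :=
  LaurentPolynomial.T_add p (-1)

/-- Induction on Laurent polynomials in `θ`. -/
theorem CTheta.induction {P : CTheta → Prop} (add : ∀ f g, P f → P g → P (f + g))
    (smul : ∀ (z : ℂ) (p : ℤ), P (z • LaurentPolynomial.T p)) (f : CTheta) : P f := by
  induction f using AddMonoidAlgebra.induction_linear with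
  | zero => simpa using smul 0 0
  | add f g hf hg => exact add f g hf hg
  | single p z =>
    have : (AddMonoidAlgebra.single p z : CTheta) = z • LaurentPolynomial.T p := by
      rw [LaurentPolynomial.T, AddMonoidAlgebra.smul_single, smul_eq_mul, mul_one]
    rw [this]
    exact smul z p

theorem conjTheta_T (p : ℤ) :
    conjTheta (LaurentPolynomial.T p) = ((-1 : ℂ) ^ p) • LaurentPolynomial.T p := by
  induction p using Int.induction_on with
  | zero => simp
  | succ p ih =>
    rw [T_succ_eq, map_mul, ih, conjTheta_theta, zpow_add_one₀ (by simp), smul_mul_assoc]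
    simp
  | pred p ih =>
    rw [T_pred_eq, map_mul, ih, conjTheta_tau, zpow_sub_one₀ (by simp), smul_mul_assoc]
    simp

theorem conjTheta_conjTheta (f : CTheta) : conjTheta (conjTheta f) = f := by
  induction f using CTheta.induction with
  | add f g hf hg => rw [map_add, map_add, hf, hg]
  | smul z p =>
    rw [conjTheta_smul, conjTheta_smul, conjTheta_T, conjTheta_smul, conjTheta_T,
      smul_smul ((-1 : ℂ) ^ p), ← mul_zpow, neg_one_mul, neg_neg, one_zpow, one_smul]

theorem thetaDer_conjTheta (f : CTheta) : thetaDer (conjTheta f) = conjTheta (thetaDer f) := by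
  induction f using CTheta.induction with
  | add f g hf hg => rw [map_add, map_add, map_add, map_add, hf, hg]
  | smul z p =>
    rw [conjTheta_smul, conjTheta_T, Derivation.map_smul, Derivation.map_smul, thetaDer_T,
      Derivation.map_smul, thetaDer_T, conjTheta_smul, map_zsmul, conjTheta_T]
    congr 1
    rw [smul_comm]

theorem theta_mem : theta ∈ OZero := Algebra.subset_adjoin rfl

theorem tau_mem : tau ∈ OInf := Algebra.subset_adjoin rfl

theorem conjTheta_mem_of_adjoin {t f : CTheta} (ht : conjTheta t = -t)
    (hf : f ∈ Algebra.adjoin ℂ {t}) : conjTheta f ∈ Algebra.adjoin ℂ {t} := by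
  induction hf using Algebra.adjoin_induction with
  | mem f hf =>
    rw [Set.mem_singleton_iff.mp hf, ht]
    exact neg_mem (Algebra.subset_adjoin rfl)
  | algebraMap z => rw [algebraMap_eq_C, conjTheta_C]; exact Subalgebra.algebraMap_mem _ z
  | add f g _ _ hf hg => rw [map_add]; exact add_mem hf hg
  | mul f g _ _ hf hg => rw [map_mul]; exact mul_mem hf hg

theorem thetaDer_mem_of_adjoin {t f : CTheta} (ht : thetaDer t ∈ Algebra.adjoin ℂ {t})
    (hf : f ∈ Algebra.adjoin ℂ {t}) : thetaDer f ∈ Algebra.adjoin ℂ {t} := by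
  induction hf using Algebra.adjoin_induction with
  | mem f hf => rw [Set.mem_singleton_iff.mp hf]; exact ht
  | algebraMap z => rw [Derivation.map_algebraMap]; exact zero_mem _
  | add f g _ _ hf hg => rw [map_add]; exact add_mem hf hg
  | mul f g hf' hg' hf hg =>
    rw [Derivation.leibniz]
    exact add_mem (mul_mem hf' hg) (mul_mem hg' hf)

theorem thetaDer_mem_OZero {f : CTheta} (hf : f ∈ OZero) : thetaDer f ∈ OZero :=
  thetaDer_mem_of_adjoin (by rw [theta, thetaDer_T, one_smul]; exact theta_mem) hf

theorem thetaDer_mem_OInf {f : CTheta} (hf : f ∈ OInf) : thetaDer f ∈ OInf :=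
  thetaDer_mem_of_adjoin (by rw [tau, thetaDer_T, neg_one_smul]; exact neg_mem tau_mem) hf

theorem exists_eq_add_mul {t f : CTheta} (hf : f ∈ Algebra.adjoin ℂ {t}) :
    ∃ (z : ℂ) (g : CTheta), g ∈ Algebra.adjoin ℂ {t} ∧ f = LaurentPolynomial.C z + t * g := by
  have hC : ∀ z : ℂ, (LaurentPolynomial.C z : CTheta) ∈ Algebra.adjoin ℂ {t} := fun z =>
    Subalgebra.algebraMap_mem _ z
  have ht : t ∈ Algebra.adjoin ℂ {t} := Algebra.subset_adjoin rfl
  induction hf using Algebra.adjoin_induction with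
  | mem f hf =>
    rw [Set.mem_singleton_iff.mp hf]
    exact ⟨0, 1, one_mem _, by simp⟩
  | algebraMap z => exact ⟨z, 0, zero_mem _, by rw [mul_zero, add_zero]; rfl⟩
  | add f g _ _ hf hg =>
    obtain ⟨z, f', hf', rfl⟩ := hf
    obtain ⟨y, g', hg', rfl⟩ := hg
    exact ⟨z + y, f' + g', add_mem hf' hg', by rw [map_add]; ring⟩
  | mul f g _ _ hf hg =>
    obtain ⟨z, f', hf', rfl⟩ := hf
    obtain ⟨y, g', hg', rfl⟩ := hg
    refine ⟨z * y, LaurentPolynomial.C z * g' + f' * LaurentPolynomial.C y + t * (f' * g'), ?_, ?_⟩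
    · exact add_mem (add_mem (mul_mem (hC z) hg') (mul_mem hf' (hC y)))
        (mul_mem ht (mul_mem hf' hg'))
    · rw [map_mul]; ring

theorem coeff_C (z : ℂ) (m : ℤ) :
    (LaurentPolynomial.C z : CTheta).coeff m = if m = 0 then z else 0 := by
  change (AddMonoidAlgebra.single 0 z : CTheta).coeff m = _
  rw [AddMonoidAlgebra.coeff_single, Finsupp.single_apply]
  simp [eq_comm]

theorem coeff_T_mul (p : ℤ) (f : CTheta) (m : ℤ) :
    (LaurentPolynomial.T p * f : CTheta).coeff m = f.coeff (m - p) := by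
  induction f using CTheta.induction with
  | add f g hf hg => rw [mul_add, AddMonoidAlgebra.coeff_add, AddMonoidAlgebra.coeff_add,
      Finsupp.add_apply, Finsupp.add_apply, hf, hg]
  | smul z q =>
    rw [mul_smul_comm, ← LaurentPolynomial.T_add, AddMonoidAlgebra.coeff_smul,
      AddMonoidAlgebra.coeff_smul, Finsupp.smul_apply, Finsupp.smul_apply, LaurentPolynomial.T,
      LaurentPolynomial.T, AddMonoidAlgebra.coeff_single, AddMonoidAlgebra.coeff_single,
      Finsupp.single_apply, Finsupp.single_apply]
    congr 2
    rw [eq_iff_iff]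
    omega

/-- Polynomials in θ^s involve only the exponents k s with k ≥ 0; s = 1 and s = -1 are the two
charts of ℙ¹. -/
theorem coeff_eq_zero_of_adjoin {s : ℤ} {f : CTheta}
    (hf : f ∈ Algebra.adjoin ℂ {(LaurentPolynomial.T s : CTheta)}) {m : ℤ}
    (hm : ∀ k : ℕ, m ≠ k * s) : f.coeff m = 0 := by
  rw [Algebra.adjoin_singleton_eq_range_aeval] at hf
  obtain ⟨p, rfl⟩ := hf
  change (Polynomial.aeval (LaurentPolynomial.T s : CTheta) p).coeff m = 0
  induction p using Polynomial.induction_on' with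
  | add p q hp hq =>
    rw [map_add, AddMonoidAlgebra.coeff_add, Finsupp.add_apply, hp, hq, add_zero]
  | monomial k z =>
    rw [Polynomial.aeval_monomial, LaurentPolynomial.T_pow, ← Algebra.smul_def,
      AddMonoidAlgebra.coeff_smul, Finsupp.smul_apply, LaurentPolynomial.T,
      AddMonoidAlgebra.coeff_single, Finsupp.single_eq_of_ne (hm k), smul_zero]

theorem coeff_eq_zero_of_mem_OZero {f : CTheta} (hf : f ∈ OZero) {m : ℤ} (hm : m < 0) :
    f.coeff m = 0 :=
  coeff_eq_zero_of_adjoin hf fun k => by omega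

theorem coeff_eq_zero_of_mem_OInf {f : CTheta} (hf : f ∈ OInf) {m : ℤ} (hm : 0 < m) :
    f.coeff m = 0 :=
  coeff_eq_zero_of_adjoin hf fun k => by omega

theorem theta_mul_coeff_zero {f : CTheta} (hf : f ∈ OZero) : (theta * f).coeff 0 = 0 := by
  rw [theta, coeff_T_mul]
  exact coeff_eq_zero_of_mem_OZero hf (by norm_num)

/-- The value at `θ = 0`. -/
def valZero : CTheta →ₗ[ℂ] ℂ where
  toFun f := f.coeff 0
  map_add' f g := by simp
  map_smul' r f := by simp

theorem valZero_C (z : ℂ) : valZero (LaurentPolynomial.C z) = z := by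
  change (LaurentPolynomial.C z : CTheta).coeff 0 = z
  rw [coeff_C, if_pos rfl]

/-- Functions regular on both charts of ℙ¹ are constant. -/
theorem eq_C_of_mem {f : CTheta} (h0 : f ∈ OZero) (hinf : f ∈ OInf) :
    f = LaurentPolynomial.C (valZero f) := by
  ext m
  rw [coeff_C]
  rcases lt_trichotomy m 0 with hm | rfl | hm
  · rw [coeff_eq_zero_of_mem_OZero h0 hm, if_neg hm.ne]
  · rw [if_pos rfl]; rfl
  · rw [coeff_eq_zero_of_mem_OInf hinf hm, if_neg hm.ne']

theorem valZero_theta_mul {f : CTheta} (hf : f ∈ OZero) : valZero (theta * f) = 0 :=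
  theta_mul_coeff_zero hf

theorem exists_eq_valZero_add {f : CTheta} (hf : f ∈ OZero) :
    ∃ g ∈ OZero, f = LaurentPolynomial.C (valZero f) + theta * g := by
  obtain ⟨z, g, hg, rfl⟩ := exists_eq_add_mul hf
  refine ⟨g, hg, ?_⟩
  rw [map_add, valZero_C, valZero_theta_mul hg, add_zero]

theorem valZero_mul {f g : CTheta} (hf : f ∈ OZero) (hg : g ∈ OZero) :
    valZero (f * g) = valZero f * valZero g := by
  obtain ⟨z, f', hf', rfl⟩ := exists_eq_add_mul hf
  have h1 : (LaurentPolynomial.C z + theta * f') * g = z • g + theta * (f' * g) := by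
    rw [Algebra.smul_def, algebraMap_eq_C]; ring
  rw [h1, map_add, map_add, valZero_C, valZero_theta_mul hf', valZero_theta_mul (mul_mem hf' hg),
    map_smul, smul_eq_mul, add_zero, add_zero]

theorem conjTheta_mem_OZero {f : CTheta} (hf : f ∈ OZero) : conjTheta f ∈ OZero :=
  conjTheta_mem_of_adjoin conjTheta_theta hf

theorem conjTheta_mem_OInf {f : CTheta} (hf : f ∈ OInf) : conjTheta f ∈ OInf :=
  conjTheta_mem_of_adjoin conjTheta_tau hf

theorem valZero_conjTheta {f : CTheta} (hf : f ∈ OZero) : valZero (conjTheta f) = valZero f := by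
  obtain ⟨z, f', hf', rfl⟩ := exists_eq_add_mul hf
  rw [map_add, map_mul, conjTheta_C, conjTheta_theta, neg_mul, map_add, map_neg, map_add,
    valZero_theta_mul hf', valZero_theta_mul (conjTheta_mem_OZero hf'), neg_zero]

theorem theta_pow_eq_T (n : ℕ) : theta ^ n = LaurentPolynomial.T (n : ℤ) := by
  rw [theta, LaurentPolynomial.T_pow, mul_one]

theorem coeff_mul_theta_pow (f : CTheta) (n : ℕ) : (f * theta ^ n).coeff (n : ℤ) = valZero f := by
  rw [mul_comm, theta_pow_eq_T, coeff_T_mul, sub_self]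
  rfl

end Charts

/-! ### Saito structures given by matrices -/

section MatrixSaito

variable {ι H : Type*} [Fintype ι] [AddCommGroup H] [Module ℂ H] [Module CTheta H]
  [IsScalarTower ℂ CTheta H]

omit [Fintype ι] [Module ℂ H] [IsScalarTower ℂ CTheta H] in
theorem mem_span_iff {A : Subalgebra ℂ CTheta} (b : Module.Basis ι CTheta H) (h : H) :
    h ∈ Submodule.span A (Set.range b) ↔ ∀ i, b.repr h i ∈ A := by
  rw [b.mem_span_iff_repr_mem A]
  refine forall_congr' fun i => ?_
  constructor
  · rintro ⟨f, hf⟩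
    rw [← hf]
    exact f.2
  · exact fun hf => ⟨⟨_, hf⟩, rfl⟩

/-- The operator `∇_{θ∂_θ}` with matrix `A₀ τ + A_∞`. -/
def matConn (b : Module.Basis ι CTheta H) (A₀ Ainf : Matrix ι ι ℂ) : H →ₗ[ℂ] H :=
  connOp b (thetaDer : CTheta →ₗ[ℂ] CTheta) fun k =>
    ∑ j, (A₀ j k • tau + Ainf j k • (1 : CTheta)) • b j

/-- The pairing with matrix `P θⁿ`. -/
def matPairing (b : Module.Basis ι CTheta H) (n : ℕ) (P : Matrix ι ι ℂ) :
    H →ₗ[CTheta] H →ₛₗ[conjTheta] CTheta :=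
  sesqOfBasis conjTheta b fun k l => P k l • theta ^ n

variable (b : Module.Basis ι CTheta H) (n : ℕ) (A₀ Ainf P : Matrix ι ι ℂ)

theorem matConn_repr (h : H) (i : ι) : b.repr (matConn b A₀ Ainf h) i =
    thetaDer (b.repr h i) +
      ∑ k, b.repr h k * (A₀ i k • tau + Ainf i k • (1 : CTheta)) := by
  classical
  rw [matConn, connOp_apply]
  simp only [Finset.sum_add_distrib, map_add, map_sum, map_smul, Finsupp.add_apply,
    Finsupp.finsetSum_apply, Finsupp.smul_apply, Module.Basis.repr_self, Finsupp.single_apply,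
    smul_eq_mul, mul_ite, mul_one, mul_zero, Finset.sum_ite_eq', Finset.mem_univ, if_true]
  rfl

theorem matConn_smul (f : CTheta) (h : H) :
    matConn b A₀ Ainf (f • h) = thetaDer f • h + f • matConn b A₀ Ainf h :=
  connOp_smul _ _ _ thetaDer_mul f h

theorem matConn_basis (k : ι) : matConn b A₀ Ainf (b k) =
    ∑ j, (A₀ j k • tau + Ainf j k • (1 : CTheta)) • b j :=
  connOp_basis _ _ _ thetaDer_mul k

omit [Module ℂ H] [IsScalarTower ℂ CTheta H] in
theorem matPairing_basis (k l : ι) : matPairing b n P (b k) (b l) = P k l • theta ^ n :=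
  sesqOfBasis_basis _ _ _ _ _

omit [Module ℂ H] [IsScalarTower ℂ CTheta H] in
theorem matPairing_apply (x y : H) : matPairing b n P x y =
    theta ^ n * ∑ i, ∑ j, P i j • (b.repr x i * conjTheta (b.repr y j)) := by
  rw [matPairing, sesqOfBasis_apply, Finset.mul_sum]
  refine Finset.sum_congr rfl fun i _ => ?_
  rw [Finset.mul_sum]
  refine Finset.sum_congr rfl fun j _ => ?_
  rw [mul_smul_comm, mul_smul_comm, mul_comm]

variable {P}

omit [Module ℂ H] [IsScalarTower ℂ CTheta H] in
theorem matPairing_values {A : Subalgebra ℂ CTheta} (hA : ∀ f ∈ A, conjTheta f ∈ A) {h h' : H}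
    (hh : h ∈ Submodule.span A (Set.range b)) (hh' : h' ∈ Submodule.span A (Set.range b)) :
    ∃ f ∈ A, matPairing b n P h h' = theta ^ n * f := by
  rw [mem_span_iff] at hh hh'
  exact ⟨_, sum_mem fun i _ => sum_mem fun j _ =>
    A.smul_mem (mul_mem (hh i) (hA _ (hh' j))) _, matPairing_apply b n P h h'⟩

theorem tau_pow_mul_theta_pow (n : ℕ) : tau ^ n * theta ^ n = 1 := by
  rw [← mul_pow, tau_mul_theta, one_pow]

variable {σ : ι → ι} {d : ι → ℂ} [DecidableEq ι]

omit [Module ℂ H] [IsScalarTower ℂ CTheta H] in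
theorem matPairing_basis_left (hP : ∀ k l, P k l = if l = σ k then d k else 0) (k : ι) (y : H) :
    matPairing b n P (b k) y = theta ^ n * (d k • conjTheta (b.repr y (σ k))) := by
  rw [matPairing_apply, Finset.sum_eq_single_of_mem k (Finset.mem_univ k),
    Finset.sum_eq_single_of_mem (σ k) (Finset.mem_univ _)]
  · simp [hP]
  · intro l _ hl
    rw [hP, if_neg hl, zero_smul]
  · intro i _ hi
    refine Finset.sum_eq_zero fun l _ => ?_
    simp [Finsupp.single_eq_of_ne hi]

omit [Module ℂ H] [IsScalarTower ℂ CTheta H] in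
-- The matrix P is monomial along the involution σ, so φ(b_k) involves only the σ(k)-coordinate of
-- h'. That coordinate can be solved for and stays in A, which stands for either chart.
theorem matPairing_nondeg {A : Subalgebra ℂ CTheta} (hA : ∀ f ∈ A, conjTheta f ∈ A)
    (hP : ∀ k l, P k l = if l = σ k then d k else 0) (hσ : ∀ k, σ (σ k) = k) (hd : ∀ k, d k ≠ 0)
    (φ : H →ₗ[CTheta] CTheta)
    (hφ : ∀ h ∈ Submodule.span A (Set.range b), ∃ f ∈ A, φ h = theta ^ n * f) :
    ∃! h', h' ∈ Submodule.span A (Set.range b) ∧ ∀ h, φ h = matPairing b n P h h' := by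
  choose f hf hφf using fun k => hφ (b k) (Submodule.subset_span ⟨k, rfl⟩)
  have hrepr : ∀ i, b.repr (∑ k, ((d (σ k))⁻¹ • conjTheta (f (σ k))) • b k) i =
      (d (σ i))⁻¹ • conjTheta (f (σ i)) := fun i => b.repr_sum_self _ ▸ rfl
  refine ⟨∑ k, ((d (σ k))⁻¹ • conjTheta (f (σ k))) • b k, ⟨?_, ?_⟩, ?_⟩
  · rw [mem_span_iff]
    intro i
    rw [hrepr]
    exact A.smul_mem (hA _ (hf _)) _
  · have : φ = (matPairing b n P).flip (∑ k, ((d (σ k))⁻¹ • conjTheta (f (σ k))) • b k) := by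
      refine b.ext fun k => ?_
      rw [LinearMap.flip_apply, matPairing_basis_left b n hP, hrepr, hσ, conjTheta_smul,
        conjTheta_conjTheta, smul_smul, mul_inv_cancel₀ (hd k), one_smul, hφf]
    intro h
    exact LinearMap.congr_fun this h
  · rintro y ⟨-, hy⟩
    refine b.repr.injective (Finsupp.ext fun i => ?_)
    rw [hrepr]
    have h1 := hy (b (σ i))
    rw [hφf, matPairing_basis_left b n hP, hσ] at h1
    have h2 := congrArg (tau ^ n * ·) h1
    simp only [← mul_assoc, tau_pow_mul_theta_pow, one_mul] at h2
    rw [h2, conjTheta_smul, conjTheta_conjTheta, smul_smul, inv_mul_cancel₀ (hd _), one_smul]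

omit [DecidableEq ι] [Module ℂ H] [IsScalarTower ℂ CTheta H] in
theorem matPairing_symm (hP : ∀ k l, P k l = P l k) (h h' : H) :
    matPairing b n P h' h = (-1) ^ n * conjTheta (matPairing b n P h h') := by
  rw [matPairing_apply, matPairing_apply, map_mul, map_pow, conjTheta_theta, ← mul_assoc,
    ← mul_pow, neg_one_mul, neg_neg, Finset.sum_comm]
  congr 1
  rw [map_sum]
  refine Finset.sum_congr rfl fun i _ => ?_
  rw [map_sum]
  refine Finset.sum_congr rfl fun j _ => ?_
  rw [conjTheta_smul, map_mul, conjTheta_conjTheta, hP, mul_comm]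

omit [DecidableEq ι] in
-- On basis vectors the identity splits by powers of θ. In degree n - 1 the two A₀ terms have
-- opposite signs, since τ becomes -τ in the second variable, so A₀ must be self-adjoint. In degree
-- n the equation is A_∞ + A_∞* = n. The Leibniz rule extends this to all sections.
theorem matPairing_flat
    (hA₀ : ∀ k l, ∑ j, A₀ j k * P j l = ∑ j, A₀ j l * P k j)
    (hAinf : ∀ k l, ∑ j, Ainf j k * P j l + ∑ j, Ainf j l * P k j = n * P k l) (h h' : H) :
    thetaDer (matPairing b n P h h') =
      matPairing b n P (matConn b A₀ Ainf h) h' + matPairing b n P h (matConn b A₀ Ainf h') := by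
  have hspan : ∀ x : H, x ∈ Submodule.span CTheta (Set.range b) := fun x => by
    rw [b.span_eq]; trivial
  induction hspan h, hspan h' using Submodule.span_induction₂ with
  | mem_mem x y hx hy =>
    obtain ⟨k, rfl⟩ := hx
    obtain ⟨l, rfl⟩ := hy
    have e1 : matPairing b n P (matConn b A₀ Ainf (b k)) (b l) =
        (tau * theta ^ n) * LaurentPolynomial.C (∑ j, A₀ j k * P j l) +
          theta ^ n * LaurentPolynomial.C (∑ j, Ainf j k * P j l) := by
      rw [matConn_basis, map_sum, LinearMap.sum_apply, map_sum, map_sum, Finset.mul_sum,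
        Finset.mul_sum, ← Finset.sum_add_distrib]
      refine Finset.sum_congr rfl fun j _ => ?_
      rw [map_smul, LinearMap.smul_apply, matPairing_basis, smul_eq_mul]
      simp only [Algebra.smul_def, algebraMap_eq_C, map_mul]
      ring
    have e2 : matPairing b n P (b k) (matConn b A₀ Ainf (b l)) =
        -((tau * theta ^ n) * LaurentPolynomial.C (∑ j, A₀ j l * P k j)) +
          theta ^ n * LaurentPolynomial.C (∑ j, Ainf j l * P k j) := by
      rw [matConn_basis, map_sum, map_sum, map_sum, Finset.mul_sum, Finset.mul_sum,
        ← Finset.sum_neg_distrib, ← Finset.sum_add_distrib]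
      refine Finset.sum_congr rfl fun j _ => ?_
      rw [LinearMap.map_smulₛₗ (matPairing b n P (b k)), matPairing_basis, map_add, conjTheta_smul,
        conjTheta_smul, conjTheta_tau, map_one, smul_eq_mul]
      simp only [Algebra.smul_def, algebraMap_eq_C, map_mul]
      ring
    have e3 : thetaDer (matPairing b n P (b k) (b l)) =
        theta ^ n * LaurentPolynomial.C (n * P k l) := by
      rw [matPairing_basis, Derivation.map_smul, theta_pow_eq_T, thetaDer_T, Algebra.smul_def,
        algebraMap_eq_C, map_mul, map_natCast, zsmul_eq_mul]
      push_cast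
      ring
    rw [e1, e2, e3, hA₀ k l, ← hAinf k l, map_add]
    ring
  | zero_left y hy => simp
  | zero_right x hx => simp
  | add_left x y z hx hy hz h1 h2 =>
    simp only [map_add, LinearMap.add_apply, h1, h2]
    ring
  | add_right x y z hx hy hz h1 h2 =>
    simp only [map_add, h1, h2]
    ring
  | smul_left r x y hx hy h1 =>
    simp only [matConn_smul, map_add, map_smul, LinearMap.add_apply, LinearMap.smul_apply,
      smul_eq_mul, Derivation.leibniz, h1]
    ring
  | smul_right r x y hx hy h1 =>
    rw [matConn_smul, map_add]
    simp only [LinearMap.map_smulₛₗ (matPairing b n P _), smul_eq_mul]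
    rw [Derivation.leibniz, h1, thetaDer_conjTheta]
    simp only [smul_eq_mul]
    ring

theorem isSaitoStructure_mat {r : ℕ} (hn : 0 < n) (b : Module.Basis (Fin r) CTheta H)
    (A₀ Ainf P : Matrix (Fin r) (Fin r) ℂ) {σ : Fin r → Fin r} {d : Fin r → ℂ}
    (hP : ∀ k l, P k l = if l = σ k then d k else 0) (hσ : ∀ k, σ (σ k) = k) (hd : ∀ k, d k ≠ 0)
    (hPs : ∀ k l, P k l = P l k)
    (hA₀ : ∀ k l, ∑ j, A₀ j k * P j l = ∑ j, A₀ j l * P k j)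
    (hAinf : ∀ k l, ∑ j, Ainf j k * P j l + ∑ j, Ainf j l * P k j = n * P k l) :
    IsSaitoStructure n (Submodule.span OZero (Set.range b)) (Submodule.span OInf (Set.range b))
      (matConn b A₀ Ainf) (matPairing b n P) where
  weight_pos := hn
  trivial := ⟨r, b, rfl, rfl⟩
  leibniz := matConn_smul b A₀ Ainf
  pole_zero h hh := by
    rw [mem_span_iff] at hh ⊢
    intro i
    rw [map_smul, Finsupp.smul_apply, matConn_repr, smul_eq_mul, mul_add, Finset.mul_sum]
    refine add_mem (mul_mem theta_mem (thetaDer_mem_OZero (hh i))) (sum_mem fun k _ => ?_)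
    have : theta * (b.repr h k * (A₀ i k • tau + Ainf i k • (1 : CTheta))) =
        b.repr h k * (A₀ i k • (theta * tau) + Ainf i k • theta) := by
      simp only [Algebra.smul_def]
      ring
    rw [this, theta_mul_tau]
    exact mul_mem (hh k) (add_mem (Subalgebra.smul_mem _ (one_mem _) _)
      (Subalgebra.smul_mem _ theta_mem _))
  pole_inf h hh := by
    rw [mem_span_iff] at hh ⊢
    intro i
    rw [matConn_repr]
    exact add_mem (thetaDer_mem_OInf (hh i)) (sum_mem fun k _ => mul_mem (hh k)
      (add_mem (Subalgebra.smul_mem _ tau_mem _) (Subalgebra.smul_mem _ (one_mem _) _)))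
  flat := matPairing_flat b n A₀ Ainf hA₀ hAinf
  values_zero _ hh _ hh' := matPairing_values b n (fun _ => conjTheta_mem_OZero) hh hh'
  values_inf _ hh _ hh' := matPairing_values b n (fun _ => conjTheta_mem_OInf) hh hh'
  nondeg_zero := matPairing_nondeg b n (fun _ => conjTheta_mem_OZero) hP hσ hd
  nondeg_inf := matPairing_nondeg b n (fun _ => conjTheta_mem_OInf) hP hσ hd
  symm := matPairing_symm b n hPs

/-! ### The fibre at `θ = 0` -/

variable {A₀ Ainf}

omit [DecidableEq ι] [Module ℂ H] [IsScalarTower ℂ CTheta H] in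
-- An element of ℂ[θ] is divisible by θ exactly when its value at θ = 0 vanishes; this is applied
-- coordinatewise.
theorem fibre_mk_eq_iff (h h' : Submodule.span OZero (Set.range b)) :
    Fibre.mk _ h = Fibre.mk _ h' ↔
      ∀ i, valZero (b.repr (h : H) i) = valZero (b.repr (h' : H) i) := by
  rw [Fibre.mk]
  erw [Submodule.Quotient.eq]
  rw [Submodule.ideal_span_singleton_smul, Submodule.mem_smul_pointwise_iff_exists]
  constructor
  · rintro ⟨y, -, hy⟩ i
    have h1 : (h : H) = h' + theta • (y : H) := by
      have : ((thetaZero • y : Submodule.span OZero (Set.range b)) : H) = h - h' := by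
        rw [hy]; rfl
      rw [eq_sub_iff_add_eq'] at this
      exact this.symm
    rw [h1, map_add, map_smul, Finsupp.add_apply, Finsupp.smul_apply, smul_eq_mul, map_add,
      valZero_theta_mul ((mem_span_iff b _).mp y.2 i), add_zero]
  · intro hv
    have hh := (mem_span_iff b _).mp h.2
    have hh' := (mem_span_iff b _).mp h'.2
    choose g hg hgeq using fun i => exists_eq_valZero_add (hh i)
    choose g' hg' hgeq' using fun i => exists_eq_valZero_add (hh' i)
    have hy : ∑ i, (g i - g' i) • b i ∈ Submodule.span OZero (Set.range b) := by
      rw [mem_span_iff]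
      intro i
      rw [b.repr_sum_self]
      exact sub_mem (hg i) (hg' i)
    refine ⟨⟨_, hy⟩, trivial, Subtype.ext ?_⟩
    change theta • ∑ i, (g i - g' i) • b i = (h : H) - h'
    rw [← b.sum_repr (h : H), ← b.sum_repr (h' : H), ← Finset.sum_sub_distrib, Finset.smul_sum]
    refine Finset.sum_congr rfl fun i _ => ?_
    rw [← sub_smul, smul_smul]
    congr 1
    rw [hgeq i, hgeq' i, hv i]
    ring

/-- The class of a basis vector in the fibre. -/
def fibreVec (i : ι) : Fibre (Submodule.span OZero (Set.range b)) :=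
  Fibre.mk _ ⟨b i, Submodule.subset_span ⟨i, rfl⟩⟩

omit [DecidableEq ι] in
theorem fibre_sum_mem (z : ι → ℂ) : ∑ i, z i • b i ∈ Submodule.span OZero (Set.range b) :=
  sum_mem fun i _ => Submodule.smul_of_tower_mem _ _ (Submodule.subset_span ⟨i, rfl⟩)

omit [DecidableEq ι] in
theorem fibre_mk_sum (z : ι → ℂ) :
    Fibre.mk _ ⟨∑ i, z i • b i, fibre_sum_mem b z⟩ = ∑ i, z i • fibreVec b i := by
  have : (⟨∑ i, z i • b i, fibre_sum_mem b z⟩ : Submodule.span OZero (Set.range b)) =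
      ∑ i, z i • ⟨b i, Submodule.subset_span ⟨i, rfl⟩⟩ := by
    refine Subtype.ext ?_
    rw [AddSubmonoidClass.coe_finsetSum]
    rfl
  rw [this, map_sum]
  rfl

omit [DecidableEq ι] in
theorem repr_sum_smul (z : ι → ℂ) (i : ι) :
    b.repr (∑ i, z i • b i) i = LaurentPolynomial.C (z i) := by
  have : ∑ i, z i • b i = ∑ i, (LaurentPolynomial.C (z i) : CTheta) • b i :=
    Finset.sum_congr rfl fun i _ => (algebraMap_smul CTheta (z i) (b i)).symm
  rw [this, b.repr_sum_self]

omit [DecidableEq ι] in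
theorem fibre_mk_eq_sum (h : Submodule.span OZero (Set.range b)) :
    Fibre.mk _ h = ∑ i, valZero (b.repr (h : H) i) • fibreVec b i := by
  rw [← fibre_mk_sum, fibre_mk_eq_iff]
  intro i
  rw [repr_sum_smul, valZero_C]

/-- The basis of the fibre. -/
def fibreBasis : Module.Basis ι ℂ (Fibre (Submodule.span OZero (Set.range b))) :=
  Module.Basis.mk (v := fibreVec b) (by
    rw [Fintype.linearIndependent_iff]
    intro z hz i
    have h0 : Fibre.mk (Submodule.span OZero (Set.range b)) 0 = 0 := map_zero _
    rw [← fibre_mk_sum, ← h0, fibre_mk_eq_iff] at hz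
    have := hz i
    rw [repr_sum_smul, valZero_C] at this
    rw [this]
    simp) (by
    intro x _
    obtain ⟨h, rfl⟩ := Submodule.mkQ_surjective _ x
    change Fibre.mk _ h ∈ _
    rw [fibre_mk_eq_sum]
    exact sum_mem fun i _ => Submodule.smul_mem _ _ (Submodule.subset_span ⟨i, rfl⟩))

omit [DecidableEq ι] in
theorem fibreBasis_apply (i : ι) : fibreBasis b i = fibreVec b i := by
  rw [fibreBasis, Module.Basis.mk_apply]

omit [DecidableEq ι] in
theorem fibreBasis_repr (h : Submodule.span OZero (Set.range b)) (i : ι) :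
    (fibreBasis b).repr (Fibre.mk _ h) i = valZero (b.repr (h : H) i) := by
  rw [fibre_mk_eq_sum]
  simp only [← fibreBasis_apply]
  rw [Module.Basis.repr_sum_self]

omit [DecidableEq ι] in
theorem valZero_theta_matConn {h : H} (hh : h ∈ Submodule.span OZero (Set.range b)) (i : ι) :
    valZero (b.repr (theta • matConn b A₀ Ainf h) i) =
      ∑ k, A₀ i k * valZero (b.repr h k) := by
  rw [mem_span_iff] at hh
  rw [map_smul, Finsupp.smul_apply, matConn_repr, smul_eq_mul, mul_add, map_add,
    valZero_theta_mul (thetaDer_mem_OZero (hh i)), zero_add, Finset.mul_sum, map_sum]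
  refine Finset.sum_congr rfl fun k _ => ?_
  have : theta * (b.repr h k * (A₀ i k • tau + Ainf i k • (1 : CTheta))) =
      A₀ i k • ((theta * tau) * b.repr h k) + theta * (Ainf i k • b.repr h k) := by
    simp only [Algebra.smul_def]
    ring
  rw [this, map_add, theta_mul_tau, one_mul, map_smul, smul_eq_mul,
    valZero_theta_mul (Subalgebra.smul_mem _ (hh k) _), add_zero]

/-- At θ = 0 only A₀ survives in θ∇_{θ∂_θ}. A global section has constant coordinates z, and
∇_{τ∂_τ} turns them into -(A₀ τ + A_∞) z, whose value at τ = 0 is -A_∞ z. -/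
theorem isAttached_mat (hP₀ : ∀ h ∈ Submodule.span OZero (Set.range b),
      theta • matConn b A₀ Ainf h ∈ Submodule.span OZero (Set.range b)) :
    IsAttached n (Submodule.span OZero (Set.range b)) (Submodule.span OInf (Set.range b))
      (matConn b A₀ Ainf) (matPairing b n P)
      (Matrix.toLin (fibreBasis b) (fibreBasis b) A₀)
      (Matrix.toLin (fibreBasis b) (fibreBasis b) (-Ainf))
      (Matrix.toBilin (fibreBasis b) P) where
  zero h := by
    refine ⟨⟨_, hP₀ _ h.2⟩, rfl, (fibreBasis b).repr.injective (Finsupp.ext fun i => ?_)⟩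
    rw [fibreBasis_repr, valZero_theta_matConn b h.2, Matrix.repr_toLin, Matrix.mulVec, dotProduct]
    exact Finset.sum_congr rfl fun k _ => by rw [fibreBasis_repr]
  inf h hh := by
    have h1 := (mem_span_iff b _).mp h.2
    have h2 := (mem_span_iff b _).mp hh
    set z : ι → ℂ := fun k => valZero (b.repr (h : H) k) with hz
    have h3 : ∀ k, b.repr (h : H) k = LaurentPolynomial.C (z k) := fun k => eq_C_of_mem (h1 k) (h2 k)
    have hC : ∀ (A : Subalgebra ℂ CTheta) (y : ℂ), LaurentPolynomial.C y ∈ A := fun A y =>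
      A.algebraMap_mem y
    -- Here ρ = -A_∞ z, and the difference with -∇σ is τ times -A₀ z.
    refine ⟨⟨_, fibre_sum_mem b fun i => ∑ k, (-Ainf) i k * z k⟩, ?_, ⟨-∑ i, (∑ k, A₀ i k * z k) • b i,
      ?_, ?_⟩, (fibreBasis b).repr.injective (Finsupp.ext fun i => ?_)⟩
    · rw [mem_span_iff]
      intro i
      rw [repr_sum_smul]
      exact hC _ _
    · rw [mem_span_iff]
      intro i
      rw [map_neg, Finsupp.neg_apply, repr_sum_smul]
      exact neg_mem (hC _ _)
    · refine b.repr.injective (Finsupp.ext fun i => ?_)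
      rw [map_sub, map_neg, map_smul, map_neg, Finsupp.sub_apply, Finsupp.smul_apply,
        Finsupp.neg_apply, Finsupp.neg_apply, repr_sum_smul, repr_sum_smul, matConn_repr, h3,
        ← algebraMap_eq_C (z i), Derivation.map_algebraMap, zero_add, map_sum, map_sum, smul_eq_mul,
        mul_neg, Finset.mul_sum, ← Finset.sum_neg_distrib, ← Finset.sum_neg_distrib,
        ← Finset.sum_sub_distrib]
      refine Finset.sum_congr rfl fun k _ => ?_
      rw [h3, Matrix.neg_apply, Algebra.smul_def, Algebra.smul_def, algebraMap_eq_C,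
        algebraMap_eq_C, map_mul, map_mul, map_neg]
      ring
    · rw [fibreBasis_repr, repr_sum_smul, valZero_C, Matrix.repr_toLin, Matrix.mulVec, dotProduct]
      exact Finset.sum_congr rfl fun k _ => by rw [fibreBasis_repr]
  pairing h h' := by
    have h1 := (mem_span_iff b _).mp h.2
    have h2 := (mem_span_iff b _).mp h'.2
    rw [matPairing_apply, mul_comm, coeff_mul_theta_pow, Matrix.toBilin_apply, map_sum]
    refine Finset.sum_congr rfl fun i _ => ?_
    rw [map_sum]
    refine Finset.sum_congr rfl fun j _ => ?_
    rw [fibreBasis_repr, fibreBasis_repr, map_smul,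
      valZero_mul (h1 i) (conjTheta_mem_OZero (h2 j)), valZero_conjTheta (h2 j), smul_eq_mul]
    ring

theorem isFrobeniusTypeOnPoint_mat {E : Type*} [AddCommGroup E] [Module ℂ E]
    (e : Module.Basis ι ℂ E) (hP : ∀ k l, P k l = if l = σ k then d k else 0)
    (hσ : ∀ k, σ (σ k) = k) (hd : ∀ k, d k ≠ 0) (hPs : ∀ k l, P k l = P l k)
    (hA₀ : ∀ k l, ∑ j, A₀ j k * P j l = ∑ j, A₀ j l * P k j)
    (hAinf : ∀ k l, ∑ j, Ainf j k * P j l + ∑ j, Ainf j l * P k j = n * P k l) :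
    IsFrobeniusTypeOnPoint (Matrix.toLin e e A₀) (Matrix.toLin e e (-Ainf)) (Matrix.toBilin e P) := by
  have hg : ∀ k l, Matrix.toBilin e P (e k) (e l) = P k l := fun k l => by
    rw [← LinearMap.BilinForm.toMatrix_apply e, LinearMap.BilinForm.toMatrix_toBilin]
  have hleft : ∀ (A : Matrix ι ι ℂ) k l,
      Matrix.toBilin e P (Matrix.toLin e e A (e k)) (e l) = ∑ j, A j k * P j l := fun A k l => by
    rw [Matrix.toLin_self, map_sum, LinearMap.sum_apply]
    exact Finset.sum_congr rfl fun j _ => by rw [map_smul, LinearMap.smul_apply, hg, smul_eq_mul]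
  have hright : ∀ (A : Matrix ι ι ℂ) k l,
      Matrix.toBilin e P (e k) (Matrix.toLin e e A (e l)) = ∑ j, A j l * P k j := fun A k l => by
    rw [Matrix.toLin_self, map_sum]
    exact Finset.sum_congr rfl fun j _ => by rw [map_smul, hg, smul_eq_mul]
  have hsymm : (Matrix.toBilin e P).IsSymm := ⟨fun x y => by
    have : Matrix.toBilin e P = (Matrix.toBilin e P).flip :=
      e.ext fun k => e.ext fun l => by
        rw [LinearMap.BilinForm.flip_apply, hg, hg, hPs]
    exact LinearMap.congr_fun₂ this x y⟩
  have hsep : ∀ x, (∀ y, Matrix.toBilin e P y x = 0) → x = 0 := by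
    intro x hx
    refine e.repr.injective (Finsupp.ext fun i => ?_)
    have h1 := hx (e (σ i))
    rw [Matrix.toBilin_apply, Finset.sum_eq_single_of_mem (σ i) (Finset.mem_univ _),
      Finset.sum_eq_single_of_mem i (Finset.mem_univ _)] at h1
    · rw [hP, hσ, if_pos rfl] at h1
      simpa [hd] using h1
    · intro l _ hl
      rw [hP, hσ, if_neg hl]
      simp
    · intro k _ hk
      refine Finset.sum_eq_zero fun l _ => ?_
      simp [Finsupp.single_eq_of_ne hk]
  -- The constant r is -n because R_∞ has matrix -A_∞.
  refine ⟨Module.Finite.of_basis e, hsymm, ⟨fun x hx => hsep x fun y => ?_, fun x hx => hsep x hx⟩,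
    ?_, -n, ?_⟩
  · rw [hsymm.eq]; exact hx y
  · intro x y
    have : Matrix.toBilin e P ∘ₗ Matrix.toLin e e A₀ =
        (Matrix.toBilin e P).compl₂ (Matrix.toLin e e A₀) :=
      e.ext fun k => e.ext fun l => by
        rw [LinearMap.comp_apply, LinearMap.compl₂_apply, hleft, hright, hA₀]
    exact LinearMap.congr_fun₂ this x y
  · intro x y
    have : Matrix.toBilin e P ∘ₗ Matrix.toLin e e (-Ainf) +
        (Matrix.toBilin e P).compl₂ (Matrix.toLin e e (-Ainf)) = (-n : ℂ) • Matrix.toBilin e P :=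
      e.ext fun k => e.ext fun l => by
        rw [LinearMap.add_apply, LinearMap.add_apply, LinearMap.comp_apply, LinearMap.compl₂_apply,
          hleft, hright, LinearMap.smul_apply, LinearMap.smul_apply, hg, smul_eq_mul, neg_mul,
          ← hAinf]
        simp only [Matrix.neg_apply, neg_mul, Finset.sum_neg_distrib]
        ring
    exact LinearMap.congr_fun₂ this x y

end MatrixSaito

/-! ### The limit Saito structure -/

section Limit

variable {n : ℕ} {w : Fin (n + 1) → ℕ}

theorem ABar_sum_mul (k : Fin (mu w)) (f : Fin (mu w) → ℂ) : ∑ j, ABar w j k * f j =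
    if h : (k : ℕ) + 1 < mu w then
      if c w (k + 1) = c w k then mu w * f ⟨k + 1, h⟩ else 0
    else 0 := by
  split_ifs with h h'
  · rw [Finset.sum_eq_single_of_mem ⟨k + 1, h⟩ (Finset.mem_univ _)]
    · simp [ABar, h']
    · intro j _ hj
      have : (j : ℕ) ≠ k + 1 := fun e => hj (Fin.ext e)
      simp [ABar, this]
  · refine Finset.sum_eq_zero fun j _ => ?_
    have : ¬((j : ℕ) = k + 1 ∧ c w j = c w k) := by
      rintro ⟨e, e'⟩
      exact h' (by rw [← e, e'])
    simp [ABar, this]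
  · refine Finset.sum_eq_zero fun j _ => ?_
    have : (j : ℕ) ≠ k + 1 := fun e => h (e ▸ j.2)
    simp [ABar, this]

variable (w) in
/-- The index dual to `k` with respect to the limit pairing. -/
def dualNat (k : ℕ) : ℕ := if k ≤ n then n - k else mu w + n - k

theorem dualNat_lt (hw : ∀ i, 0 < w i) {k : ℕ} (hk : k < mu w) : dualNat w k < mu w := by
  have := n_lt_mu hw
  rw [dualNat]
  split_ifs <;> omega

theorem dualNat_dualNat {k : ℕ} (hk : k < mu w) : dualNat w (dualNat w k) = k := by
  simp only [dualNat]
  split_ifs <;> omega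

/-- The duality of the indices, with respect to the limit pairing. -/
def dualIndex (hw : ∀ i, 0 < w i) (k : Fin (mu w)) : Fin (mu w) :=
  ⟨dualNat w k, dualNat_lt hw k.2⟩

variable (w) in
/-- The nonzero values of the limit pairing. -/
def dualCoeff (k : Fin (mu w)) : ℂ :=
  if (k : ℕ) ≤ n then (∏ i, (w i : ℂ))⁻¹ else (∏ i, (w i : ℂ) ^ (w i + 1))⁻¹

theorem dualCoeff_ne_zero (hw : ∀ i, 0 < w i) (k : Fin (mu w)) : dualCoeff w k ≠ 0 := by
  have h : ∀ i, (w i : ℂ) ≠ 0 := fun i => Nat.cast_ne_zero.mpr (hw i).ne'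
  rw [dualCoeff]
  split_ifs
  · exact inv_ne_zero (Finset.prod_ne_zero_iff.mpr fun i _ => h i)
  · exact inv_ne_zero (Finset.prod_ne_zero_iff.mpr fun i _ => pow_ne_zero _ (h i))

theorem pairCoeff_eq (hw : ∀ i, 0 < w i) (k l : Fin (mu w)) :
    pairCoeff w k l = if l = dualIndex hw k then dualCoeff w k else 0 := by
  have hk := k.2
  have hl := l.2
  simp only [pairCoeff, dualCoeff, dualIndex, dualNat, Fin.ext_iff]
  split_ifs <;> first | rfl | omega

theorem pairCoeff_symm (k l : Fin (mu w)) : pairCoeff w k l = pairCoeff w l k := by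
  have hk := k.2
  have hl := l.2
  simp only [pairCoeff]
  split_ifs <;> first | rfl | omega

/-- Both sides vanish unless k + l + 1 is n or μ + n. In the first case all the c involved are 0. In
the second, c_{k+1} + c_l = 1 = c_k + c_{l+1}, so that c_{k+1} = c_k exactly when c_{l+1} = c_l. -/
theorem ABar_selfAdjoint (hw : ∀ i, 0 < w i) (k l : Fin (mu w)) :
    ∑ j, ABar w j k * pairCoeff w j l = ∑ j, ABar w j l * pairCoeff w k j := by
  have hk := k.2
  have hl := l.2
  have hnm := n_lt_mu hw
  rw [ABar_sum_mul, ABar_sum_mul]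
  simp only [pairCoeff]
  by_cases hA : (k : ℕ) + l + 1 = n
  · rw [dif_pos (by omega), dif_pos (by omega), if_pos (by omega : (k : ℕ) + 1 + l = n),
      if_pos (by omega : (k : ℕ) + (l + 1) = n), c_eq_zero hw (by omega) (by omega : (k : ℕ) + 1 ≤ n),
      c_eq_zero hw hk (by omega), c_eq_zero hw (by omega) (by omega : (l : ℕ) + 1 ≤ n),
      c_eq_zero hw hl (by omega)]
  · simp only [if_neg (by omega : ¬(k : ℕ) + 1 + l = n), if_neg (by omega : ¬(k : ℕ) + (l + 1) = n)]
    by_cases hB : (k : ℕ) + l + 1 = mu w + n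
    · by_cases hkm : (k : ℕ) + 1 < mu w <;> by_cases hlm : (l : ℕ) + 1 < mu w
      · have h1 := c_symm hw hkm (by omega) (by omega : (k : ℕ) + 1 + l = mu w + n)
        have h2 := c_symm hw hk (by omega) (by omega : (k : ℕ) + (l + 1) = mu w + n)
        have h3 : c w (k + 1) = c w k ↔ c w (l + 1) = c w l := by
          constructor <;> intro h <;> linarith
        rw [dif_pos hkm, dif_pos hlm,
          if_pos (by omega : n + 1 ≤ (k : ℕ) + 1 ∧ (k : ℕ) + 1 + l = mu w + n),
          if_pos (by omega : n + 1 ≤ (k : ℕ) ∧ (k : ℕ) + (l + 1) = mu w + n)]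
        simp only [h3]
      -- Here l = μ - 1 and hence k = n: the entry of Ā₀ vanishes because c_n = 0 < c_{n+1}. The
      -- next case exchanges k and l.
      · have h1 := c_eq_zero hw hk (by omega)
        have h2 := c_pos hw hkm (by omega)
        rw [dif_pos hkm, dif_neg hlm, if_neg (by rw [h1]; exact h2.ne')]
      · have h1 := c_eq_zero hw hl (by omega)
        have h2 := c_pos hw hlm (by omega)
        rw [dif_neg hkm, dif_pos hlm, if_neg (by rw [h1]; exact h2.ne')]
      · rw [dif_neg hkm, dif_neg hlm]
    · simp only [if_neg (by omega : ¬(n + 1 ≤ (k : ℕ) + 1 ∧ (k : ℕ) + 1 + l = mu w + n)),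
        if_neg (by omega : ¬(n + 1 ≤ (k : ℕ) ∧ (k : ℕ) + (l + 1) = mu w + n))]
      simp

/-- The sum is k + l - μ(c_k + c_l). When k + l = n both c vanish; when k + l = μ + n they add up to
1. -/
theorem alpha_add_alpha (hw : ∀ i, 0 < w i) {k l : Fin (mu w)} (h : pairCoeff w k l ≠ 0) :
    alpha w k + alpha w l = n := by
  rw [alpha, alpha]
  rcases c_of_pairCoeff_ne_zero hw h with ⟨h1, h2, h3⟩ | ⟨⟨-, h1⟩, h2⟩
  · have : (k : ℚ) + l = n := by exact_mod_cast h1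
    rw [h2, h3]
    linarith
  · have : (k : ℚ) + l = mu w + n := by exact_mod_cast h1
    linear_combination this - (mu w : ℚ) * h2

theorem AInf_add_adjoint (hw : ∀ i, 0 < w i) (k l : Fin (mu w)) :
    ∑ j, AInf w j k * pairCoeff w j l + ∑ j, AInf w j l * pairCoeff w k j =
      n * pairCoeff w k l := by
  rw [Finset.sum_eq_single_of_mem k (Finset.mem_univ k) fun j _ hj => by
      rw [AInf, Matrix.diagonal_apply_ne _ hj, zero_mul],
    Finset.sum_eq_single_of_mem l (Finset.mem_univ l) fun j _ hj => by
      rw [AInf, Matrix.diagonal_apply_ne _ hj, zero_mul],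
    AInf, Matrix.diagonal_apply_eq, Matrix.diagonal_apply_eq, ← add_mul]
  by_cases h : pairCoeff w k l = 0
  · rw [h, mul_zero, mul_zero]
  · rw [← Rat.cast_add, alpha_add_alpha hw h, Rat.cast_natCast]

end Limit

/-! ### From a basis and matrices to the Saito and Frobenius type structures -/

section Lattice

variable {H : Type*} [AddCommGroup H] [Module ℂ H] [Module CTheta H] [IsScalarTower ℂ CTheta H]

/-- The family v is kept apart from the basis b so that the lattices are literally the spans of the
[ω_k]. -/
theorem exists_frobeniusType {r n : ℕ} (hn : 0 < n) (b : Module.Basis (Fin r) CTheta H)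
    {v : Fin r → H} (hv : ∀ k, b k = v k)
    {A₀ Ainf P : Matrix (Fin r) (Fin r) ℂ} {σ : Fin r → Fin r} {d : Fin r → ℂ}
    (hP : ∀ k l, P k l = if l = σ k then d k else 0) (hσ : ∀ k, σ (σ k) = k) (hd : ∀ k, d k ≠ 0)
    (hPs : ∀ k l, P k l = P l k)
    (hA₀ : ∀ k l, ∑ j, A₀ j k * P j l = ∑ j, A₀ j l * P k j)
    (hAinf : ∀ k l, ∑ j, Ainf j k * P j l + ∑ j, Ainf j l * P k j = n * P k l) :
    IsSaitoStructure n (Submodule.span OZero (Set.range v)) (Submodule.span OInf (Set.range v))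
      (matConn b A₀ Ainf) (matPairing b n P) ∧
    ∃ (e : Module.Basis (Fin r) ℂ (Fibre (Submodule.span OZero (Set.range v))))
      (R₀ Rinf : Module.End ℂ (Fibre (Submodule.span OZero (Set.range v))))
      (g : LinearMap.BilinForm ℂ (Fibre (Submodule.span OZero (Set.range v)))),
      (∀ k, e k = Fibre.mk (Submodule.span OZero (Set.range v))
        ⟨v k, Submodule.subset_span ⟨k, rfl⟩⟩) ∧
      IsAttached n (Submodule.span OZero (Set.range v)) (Submodule.span OInf (Set.range v))
        (matConn b A₀ Ainf) (matPairing b n P) R₀ Rinf g ∧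
      LinearMap.toMatrix e e R₀ = A₀ ∧ LinearMap.toMatrix e e Rinf = -Ainf ∧
      IsFrobeniusTypeOnPoint R₀ Rinf g := by
  obtain rfl : ⇑b = v := funext hv
  have hS := isSaitoStructure_mat n hn b A₀ Ainf P hP hσ hd hPs hA₀ hAinf
  exact ⟨hS, fibreBasis b, Matrix.toLin _ _ A₀, Matrix.toLin _ _ (-Ainf), Matrix.toBilin _ P,
    fibreBasis_apply b, isAttached_mat b n hS.pole_zero, LinearMap.toMatrix_toLin _ _ _,
    LinearMap.toMatrix_toLin _ _ _,
    isFrobeniusTypeOnPoint_mat n (fibreBasis b) hP hσ hd hPs hA₀ hAinf⟩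

end Lattice

end LimitSaito

end

/-! ### The limit Saito structure and its Frobenius type structure -/

theorem mainTheorem5 (n : ℕ) (hn : 0 < n) (w : Fin (n + 1) → ℕ) (hw : ∀ i, 0 < w i)
    (hw₀ : w 0 = 1) :
    (∀ V', LimitSaito.IsKashiwaraMalgrange w V' ↔ V' = LimitSaito.V w) ∧
    ∃ (b : Module.Basis (Fin (LimitSaito.mu w)) LimitSaito.CTheta (LimitSaito.GBar w))
      (nablaBar : LimitSaito.GBar w →ₗ[ℂ] LimitSaito.GBar w)
      (S : LimitSaito.GaussManin w →ₗ[LimitSaito.CXTheta]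
        LimitSaito.GaussManin w →ₛₗ[LimitSaito.conjThetaX] LimitSaito.CXTheta)
      (SBar : LimitSaito.GBar w →ₗ[LimitSaito.CTheta]
        LimitSaito.GBar w →ₛₗ[LimitSaito.conjTheta] LimitSaito.CTheta),
      (∀ k, b k = LimitSaito.omegaBar w k) ∧
      LimitSaito.IsLimitConnection w nablaBar ∧
      (∀ k, nablaBar (b k) = ∑ j, (LimitSaito.ABar w j k • LimitSaito.tau +
        LimitSaito.AInf w j k • (1 : LimitSaito.CTheta)) • b j) ∧
      LimitSaito.IsPairing w S ∧
      LimitSaito.IsLimitPairing w S SBar ∧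
      LimitSaito.HasLimitValues w SBar ∧
      LimitSaito.IsSaitoStructure n (LimitSaito.GBarZero w) (LimitSaito.GBarInf w)
        nablaBar SBar ∧
      ∃ (bE : Module.Basis (Fin (LimitSaito.mu w)) ℂ (LimitSaito.Fibre (LimitSaito.GBarZero w)))
        (R₀ Rinf : Module.End ℂ (LimitSaito.Fibre (LimitSaito.GBarZero w)))
        (g : LinearMap.BilinForm ℂ (LimitSaito.Fibre (LimitSaito.GBarZero w))),
        (∀ k, bE k = LimitSaito.omegaFibre w k) ∧
        LimitSaito.IsAttached n (LimitSaito.GBarZero w) (LimitSaito.GBarInf w)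
          nablaBar SBar R₀ Rinf g ∧
        LinearMap.toMatrix bE bE R₀ = LimitSaito.ABar w ∧
        LinearMap.toMatrix bE bE Rinf = -LimitSaito.AInf w ∧
        LimitSaito.IsFrobeniusTypeOnPoint R₀ Rinf g := by
  exact ⟨LimitSaito.isKashiwaraMalgrange_iff hn hw hw₀, LimitSaito.gbarBasis hn hw hw₀,
    LimitSaito.nablaBar hn hw hw₀, LimitSaito.pairing hn hw hw₀, LimitSaito.pairingBar hn hw hw₀,
    LimitSaito.gbarBasis_apply hn hw hw₀, LimitSaito.isLimitConnection_nablaBar hn hw hw₀,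
    LimitSaito.nablaBar_basis hn hw hw₀, LimitSaito.isPairing_pairing hn hw hw₀,
    LimitSaito.isLimitPairing_pairingBar hn hw hw₀,
    LimitSaito.hasLimitValues_pairingBar hn hw hw₀,
    -- For this basis, `nablaBar` and `pairingBar` unfold to `matConn` and `matPairing` with the
    -- matrices `ABar w`, `AInf w` and `pairCoeff w`.
    LimitSaito.exists_frobeniusType hn (LimitSaito.gbarBasis hn hw hw₀)
      (LimitSaito.gbarBasis_apply hn hw hw₀) (P := LimitSaito.pairCoeff w)
      (LimitSaito.pairCoeff_eq hw) (fun k => Fin.ext (LimitSaito.dualNat_dualNat k.2))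
      (LimitSaito.dualCoeff_ne_zero hw) LimitSaito.pairCoeff_symm
      (LimitSaito.ABar_selfAdjoint hw) (LimitSaito.AInf_add_adjoint hw)⟩
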